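/- Let $K$ be a field of characteristic zero and let $V$ be a finite-dimensional $K$-vector space with a nondegenerate bilinear form $\langle-,-\rangle$ that is symmetric or alternating. Let $\mathrm{GAut}(V)$ be the group of linear automorphisms of $V$ that preserve $\langle-,-\rangle$ up to a nonzero scalar, with Lie algebra $$\mathrm{Lie}\,\mathrm{GAut}(V)=\{X\in\mathrm{End}(V):\ \exists c\in K\ \forall v,w,\ \langle Xv,w\rangle+\langle v,Xw\rangle=c\langle v,w\rangle\},$$ and let $\phi\in\mathrm{GAut}(V)$. Let $\mathsf m\ge 0$ and let $A_0,\dots,A_{\mathsf m}$ be $K$-vector spaces, each equipped with a decreasing $\mathbf Z$-indexed filtration and a linear automorphism $\phi_j$; let $A_{\mathsf m}$ be equipped moreover with a bilinear form. Fix an integer $d\ge 0$. A self-dual filtration of $V$ is a decreasing filtration $V=F^0V\supseteq F^1V\supseteq\dots\supseteq F^dV\supseteq F^{d+1}V=0$ with $(F^pV)^\perp=F^{d+1-p}V$ for all $p$ (where $F^p V=V$ for $p\le 0$ and $F^pV=0$ for $p>d$). Fix one self-dual filtration $F_0$, and let $\mathcal H$ be the variety of all self-dual filtrations $F$ with $\dim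 F^pV=\dim F_0^pV$ for all $p$. Call $F\in\mathcal H(K)$ bad if there is a self-dual flag of subspaces $$0=\mathfrak f^0\subseteq\mathfrak f^1\subseteq\dots\subseteq\mathfrak f^{\mathsf m}\subseteq\mathfrak f^{\mathsf m+1}\subseteq\dots\subseteq\mathfrak f^{2\mathsf m+1}=V,\qquad (\mathfrak f^i)^\perp=\mathfrak f^{2\mathsf m+1-i},$$ (equalities being allowed) such that, with $\mathrm{gr}^j_{\mathfrak f}=\mathfrak f^{j+1}/\mathfrak f^j$ for $0\le j\le 2\mathsf m$, and with $\mathrm{gr}^j_{\mathfrak f}$ carrying the filtration induced by $F$, i.e. the images of the spaces $F^pV\cap\mathfrak f^{j+1}$: (a) every $\mathfrak f^i$ is $\phi$-stable; (b) for every $j$ with $W:=\mathrm{gr}^j_{\mathfrak f}\neq 0$, the weight $\frac{1}{\dim W}\sum_{p\ge 0}p\,\dim(F^pW/F^{p+1}W)$ of the induced filtration equals $d/2$; (c) for each $0\le j\le\mathsf m$ there is a linear isomorphism $\mathrm{gr}^j_{\mathfrak f}\simeq A_j$ that carries the induced filtration to that of $A_j$ and the automorphism induced by $\phi$ to $\phi_j$,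 and for the middle piece $j=\mathsf m$ it also carries the form induced by $\langle-,-\rangle$ to the form on $A_{\mathsf m}$. Let $F_0$ induce on $\mathrm{Lie}\,\mathrm{GAut}(V)$ the filtration whose $p$-th step is $\{X: X F_0^iV\subseteq F_0^{i+p}V\ \forall i\}$, and let $h^p=\dim\mathrm{gr}^p_{F_0}\mathrm{Lie}\,\mathrm{GAut}(V)$ for $p\in\mathbf Z$. The Hodge numbers are the integers $p$ with $h^p\ne 0$, each listed with multiplicity $h^p$. Let $T$ be the continuous piecewise linear function on $[0,\sum_p h^p]$ with $T(0)=0$ and slope $p$ on the interval $\left(\sum_{q>p}h^q,\ \sum_{q\ge p}h^q\right)$, so that for an integer $y$ the value $T(y)$ is the sum of the $y$ largest Hodge numbers. Let $z=\dim Z(\phi^{\mathrm{ss}})$ be the dimension of the centralizer in $\mathrm{GAut}(V)$ of the semisimple part of $\phi$. If $e$ is a positive integer such that $$\sum_{p>0}h^p\ \ge\ z+e\qquad\text{and}\qquad \sum_{p>0}p\,h^p\ >\ T(z+e)+T\!\left(\tfrac{h^0}{2}+z+e\right),$$ then the (Zariski closure of the) set of bad filtrations has codimension at least $e$ in $\mathcal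 H$. -/

import Mathlib

noncomputable section

namespace BadFil

section Dimension

/-- The coordinate ring of (the Zariski closure of) a subset `S` of a `K`-vector space `E`: the
`K`-algebra of functions `S → K` that are restrictions of polynomial functions on `E`. For
`E` finite-dimensional it is `K[E] / I(S)`, with `I(S)` the ideal of polynomials that vanish on
`S`. -/
def coordRing (K : Type*) [Field K] {E : Type*} [AddCommGroup E] [Module K E] (S : Set E) :
    Subalgebra K (S → K) :=
  Algebra.adjoin K (Set.range fun (l : Module.Dual K E) (x : S) => l (x : E))

/-- The dimension of the Zariski closure of a subset of a vector space (`⊥` for the empty set). -/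
def zariskiDim (K : Type*) [Field K] {E : Type*} [AddCommGroup E] [Module K E] (S : Set E) :
    WithBot ℕ∞ :=
  ringKrullDim (coordRing K S)

end Dimension

variable {K : Type*} [Field K] {V : Type*} [AddCommGroup V] [Module K V]

/-- The quotient `P / Q` for subspaces `Q ≤ P` of `V`. -/
abbrev SubQuot (P Q : Submodule K V) : Type _ := P ⧸ Q.submoduleOf P

/-- `GAut(V)`: the linear automorphisms that preserve the bilinear form up to a nonzero scalar. -/
def GAut (B : LinearMap.BilinForm K V) : Subgroup (V ≃ₗ[K] V) where
  carrier := {g | ∃ c : Kˣ, ∀ v w, B (g v) (g w) = (c : K) * B v w}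
  one_mem' := ⟨1, fun v w => by simp⟩
  mul_mem' := by
    rintro g h ⟨c, hc⟩ ⟨c', hc'⟩
    refine ⟨c * c', fun v w => ?_⟩
    simp only [LinearEquiv.mul_apply, hc, hc', Units.val_mul, mul_assoc]
  inv_mem' := by
    rintro g ⟨c, hc⟩
    refine ⟨c⁻¹, fun v w => ?_⟩
    have h := hc (g⁻¹ v) (g⁻¹ w)
    have e : ∀ u, g (g⁻¹ u) = u := fun u => g.apply_symm_apply u
    rw [e, e] at h
    rw [h, Units.inv_mul_cancel_left]

/-- `Lie GAut(V)`: the endomorphisms `X` with `⟨Xv, w⟩ + ⟨v, Xw⟩ = c ⟨v, w⟩` for some scalar `c`. -/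
def lieGAut (B : LinearMap.BilinForm K V) : Submodule K (Module.End K V) where
  carrier := {X | ∃ c : K, ∀ v w, B (X v) w + B v (X w) = c * B v w}
  zero_mem' := ⟨0, fun v w => by simp⟩
  add_mem' := by
    rintro X Y ⟨c, hc⟩ ⟨c', hc'⟩
    refine ⟨c + c', fun v w => ?_⟩
    have h1 := hc v w
    have h2 := hc' v w
    simp only [LinearMap.add_apply, map_add]
    linear_combination h1 + h2
  smul_mem' := by
    rintro a X ⟨c, hc⟩
    refine ⟨a * c, fun v w => ?_⟩
    have h1 := hc v w
    simp only [LinearMap.smul_apply, map_smul, smul_eq_mul]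
    linear_combination a * h1

/-- A decreasing filtration `V = F⁰ ⊇ F¹ ⊇ ⋯ ⊇ Fᵈ ⊇ Fᵈ⁺¹ = 0`, extended to all integer indices in
the obvious way, that is self-dual: `F^{d+1-p}` is the orthogonal complement of `F^p`. -/
structure IsSelfDualFiltration (B : LinearMap.BilinForm K V) (d : ℕ) (F : ℤ → Submodule K V) :
    Prop where
  antitone : Antitone F
  eq_top : ∀ p : ℤ, p ≤ 0 → F p = ⊤
  eq_bot : ∀ p : ℤ, (d : ℤ) < p → F p = ⊥
  self_dual : ∀ p : ℤ, F (d + 1 - p) = B.orthogonal (F p)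

/-- An increasing self-dual flag `0 = f⁰ ⊆ f¹ ⊆ ⋯ ⊆ f^{2m+1} = V`; equalities are permitted, and
`f^{2m+1-i}` is the orthogonal complement of `f^i`. Indices beyond `2m+1` play no role. -/
structure IsSelfDualFlag (B : LinearMap.BilinForm K V) (m : ℕ) (f : ℕ → Submodule K V) :
    Prop where
  monotone : Monotone f
  eq_bot : f 0 = ⊥
  eq_top : f (2 * m + 1) = ⊤
  self_dual : ∀ i, i ≤ 2 * m + 1 → f (2 * m + 1 - i) = B.orthogonal (f i)

/-- The weight `(∑ p · dim gr^p W) / dim W` of a decreasing filtration of `W` that is all of `W` in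
degrees `≤ 0` and zero in degrees `> d`. -/
def weight (d : ℕ) {W : Type*} [AddCommGroup W] [Module K W] (F : ℤ → Submodule K W) : ℚ :=
  (∑ p ∈ Finset.range (d + 1),
    (p : ℚ) * (Module.finrank K (SubQuot (F (p : ℤ)) (F ((p : ℤ) + 1))) : ℚ)) /
    (Module.finrank K W : ℚ)

/-- The graded piece `gr^j = f^{j+1} / f^j`. -/
abbrev Gr (f : ℕ → Submodule K V) (j : ℕ) : Type _ := SubQuot (f (j + 1)) (f j)

/-- The class in `gr^j = f^{j+1} / f^j` of an element of `f^{j+1}`. -/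
abbrev toGr (f : ℕ → Submodule K V) (j : ℕ) : f (j + 1) →ₗ[K] Gr f j :=
  ((f j).submoduleOf (f (j + 1))).mkQ

/-- The filtration induced by `F` on `gr^j`: the image of `F^p ∩ f^{j+1}`. -/
def inducedFil (F : ℤ → Submodule K V) (f : ℕ → Submodule K V) (j : ℕ) (p : ℤ) :
    Submodule K (Gr f j) :=
  ((F p).submoduleOf (f (j + 1))).map (toGr f j)

/-- The filtration `F` is bad: there is a self-dual flag `f` such that
(a) `f` is `φ`-stable;
(b) the filtration induced by `F` on each nonzero graded piece of `f` has weight `d / 2`;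
(c) for `0 ≤ j ≤ m` the graded piece `gr^j = f^{j+1} / f^j`, with the induced filtration and the
induced automorphism, is isomorphic to `A j`, and on the middle piece `gr^m = (f^m)^⊥ / f^m` the
isomorphism carries the form induced by `B` to the given form on `A m`. -/
def IsBad (B : LinearMap.BilinForm K V) (φ : V ≃ₗ[K] V) (d m : ℕ)
    (A : Fin (m + 1) → Type*) [∀ j, AddCommGroup (A j)] [∀ j, Module K (A j)]
    (FA : ∀ j, ℤ → Submodule K (A j)) (φA : ∀ j, A j ≃ₗ[K] A j)
    (BA : LinearMap.BilinForm K (A (Fin.last m)))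
    (F : ℤ → Submodule K V) : Prop :=
  ∃ f : ℕ → Submodule K V, IsSelfDualFlag B m f ∧
    (∀ i, i ≤ 2 * m + 1 → ∀ v ∈ f i, φ v ∈ f i) ∧
    (∀ k, k ≤ 2 * m → Nontrivial (Gr f k) → weight d (inducedFil F f k) = (d : ℚ) / 2) ∧
    ∃ e : ∀ j : Fin (m + 1), Gr f (j : ℕ) ≃ₗ[K] A j,
      (∀ j : Fin (m + 1), ∀ p : ℤ,
        (inducedFil F f (j : ℕ) p).map (e j : Gr f (j : ℕ) →ₗ[K] A j) = FA j p) ∧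
      (∀ j : Fin (m + 1), ∀ x y : f ((j : ℕ) + 1), (y : V) = φ (x : V) →
        e j (toGr f j y) = φA j (e j (toGr f j x))) ∧
      (∀ x y : f ((Fin.last m : ℕ) + 1),
        BA (e (Fin.last m) (toGr f _ x)) (e (Fin.last m) (toGr f _ y)) = B (x : V) (y : V))

/-- The filtration that `F` induces on `Lie GAut(V)`. -/
def adjFil (B : LinearMap.BilinForm K V) (F : ℤ → Submodule K V) (p : ℤ) :
    Submodule K (Module.End K V) where
  carrier := {X | X ∈ lieGAut B ∧ ∀ i : ℤ, ∀ v ∈ F i, X v ∈ F (i + p)}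
  zero_mem' := ⟨zero_mem _, fun i v _ => by simp⟩
  add_mem' := by
    rintro X Y ⟨hX, hX'⟩ ⟨hY, hY'⟩
    exact ⟨add_mem hX hY, fun i v hv => add_mem (hX' i v hv) (hY' i v hv)⟩
  smul_mem' := by
    rintro a X ⟨hX, hX'⟩
    exact ⟨Submodule.smul_mem _ a hX, fun i v hv => Submodule.smul_mem _ a (hX' i v hv)⟩

/-- The adjoint Hodge number `h^p = dim gr^p_F Lie GAut(V)`. -/
def hodge (B : LinearMap.BilinForm K V) (F : ℤ → Submodule K V) (p : ℤ) : ℕ :=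
  Module.finrank K (SubQuot (adjFil B F p) (adjFil B F (p + 1)))

/-- The continuous piecewise linear function `T` on `[0, ∑ h^p]` with `T 0 = 0` and slope `p` on the
interval from `∑_{q > p} h^q` to `∑_{q ≥ p} h^q`; at an integer `x` it is the sum of the `x` largest
members of the list in which each `p` occurs `h^p` times. Only `-d ≤ p ≤ d` occur. -/
def topSum (d : ℕ) (h : ℤ → ℕ) (x : ℝ) : ℝ :=
  ∑ p ∈ Finset.Icc (-(d : ℤ)) d,
    (p : ℝ) * max 0 (min (h p : ℝ) (x - ∑ q ∈ Finset.Ioc p (d : ℤ), (h q : ℝ)))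

/-- `s` is the semisimple part of `φ` in its Jordan decomposition. -/
def IsSemisimplePart (φ s : Module.End K V) : Prop :=
  s.IsSemisimple ∧ Commute s φ ∧ IsNilpotent (φ - s)

/-- The centralizer of `s` in `GAut(V)`, as a subset of the vector space `End(V)`. -/
def centralizerGAut (B : LinearMap.BilinForm K V) (s : Module.End K V) :
    Set (Module.End K V) :=
  {g | (∃ g' ∈ GAut B, (g' : V →ₗ[K] V) = g) ∧ Commute g s}

/-- The self-dual filtrations with the same dimension data as `F₀`. -/
def flagVariety (B : LinearMap.BilinForm K V) (d : ℕ) (F₀ : ℤ → Submodule K V) :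
    Set (ℤ → Submodule K V) :=
  {F | IsSelfDualFiltration B d F ∧
    ∀ p, Module.finrank K (F p) = Module.finrank K (F₀ p)}

/-- The multi-cone, under the Plücker embeddings, over a set `S` of filtrations with
`dim F^p = k p`: all tuples `(x_p)` for `0 ≤ p ≤ d + 1`, with `x_p` a nonzero element of the line
`⋀^{k p} F^p` in `⋀^{k p} V`, for some `F` in `S`. -/
def pluckerCone (d : ℕ) (k : ℤ → ℕ) (S : Set (ℤ → Submodule K V)) :
    Set ((p : Fin (d + 2)) → ⋀[K]^(k (p : ℕ)) V) :=
  {x | ∃ F ∈ S, ∀ p : Fin (d + 2), x p ≠ 0 ∧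
    x p ∈ LinearMap.range (exteriorPower.map (k (p : ℕ)) (F (p : ℕ)).subtype)}

/-- A set `S` of filtrations has codimension at least `e` in `flagVariety B d F₀`. Both cones have
dimension exactly `d + 2` more than the sets of filtrations below them, and the flag variety is
homogeneous under `GAut(V)`, hence equidimensional. So this says that the Zariski closure of `S`
has dimension at most that of the flag variety minus `e`; it holds if `S` is empty. -/
def CodimAtLeast (B : LinearMap.BilinForm K V) (d : ℕ) (F₀ : ℤ → Submodule K V)
    (S : Set (ℤ → Submodule K V)) (e : ℕ) : Prop :=
  zariskiDim K (pluckerCone d (fun p => Module.finrank K (F₀ p)) S) + (e : WithBot ℕ∞) ≤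
    zariskiDim K (pluckerCone d (fun p => Module.finrank K (F₀ p)) (flagVariety B d F₀))

end BadFil

end

/-! Let one bad filtration `F` with flag `f` be given (if there is none, nothing is to be shown).
For another bad filtration `F'` with flag `f'`, condition (c) gives isomorphisms of the graded
pieces of `f` and `f'` up to the middle one, compatible with filtrations, automorphisms and the
middle form. Such isomorphisms lift to an isometry `g` of `V` with `g F = F'` and `g f = f'`
(`exists_isometry_lift`). So the bad set lies in the image, under `g ↦ g F`, of the set of
transporters: the isometries `g` such that `φ` stabilizes `g f` and `φ g`, `g φ` agree on the graded
pieces up to the middle one (`exists_isTransporter`).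

Differentiating these equations at `g` and translating to the identity gives skew endomorphisms `Y`
with `Y - φ⁻¹ Y φ` in the nilradical `U` of the stabilizer of `g f`. The kernel of `Y ↦ Y - φ⁻¹ Y φ`
commutes with `φ`, hence with its semisimple part, so the space of such `Y` has dimension at most
`dim U + z`. It contains `U`, and the part of `U` that preserves `g F` does not move `g F`. The
orbit map therefore has rank at most `z` plus the number of negative Hodge numbers of `U`
(`zariskiDim_orbit_le`), while the flag variety has dimension at least `∑_{p>0} h^p`
(`le_zariskiDim_pluckerCone`).

It remains to see that `U` has at most `∑_{p>0} h^p - z - e` negative Hodge numbers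
(`sum_neg_add_le`). By (b) the Hodge numbers of `U` sum to zero, and `U` takes up at most half of
the Lie algebra because the opposite nilradical is disjoint from it. If `U` had more negative Hodge
numbers, then fewer than `z + e` would be missing, at a cost of at most `T(z + e)`; fewer than `h⁰/2
+ z + e` places would be left for positive ones, whose sum is at most `T(h⁰/2 + z + e)`. Balance
then contradicts the numerical hypothesis.

Dimensions are Krull dimensions of rings of polynomial functions on sets of `K`-points. They are
bounded above by the rank of a differential (`zariskiDim_range_le`, which uses characteristic zero)
and below by polynomial maps that are immersive at the origin (`le_zariskiDim`). The maps for the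
lower bounds come from the Cayley transform with its denominator cleared (`exists_cayley`). The
symmetric and alternating cases are treated together through the sign `ε` with `B w v = ε B v w`. -/

noncomputable section

namespace BadFil

/-! ### Derivations, Noether normalization and Krull dimension. -/

section CommutativeAlgebra

open MvPolynomial

/-- Partial derivatives extend along transcendental field extensions in characteristic zero. -/
theorem exists_derivation_of_injective {K L : Type*} [Field K] [CharZero K] [Field L] [Algebra K L]
    [Algebra.EssFiniteType K L] {n : ℕ} (g : MvPolynomial (Fin n) K →ₐ[K] L)
    (hg : Function.Injective g) :
    ∃ D : Fin n → Derivation K L L, ∀ i j, D i (g (X j)) = if j = i then 1 else 0 := by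
  classical
  let : Algebra (MvPolynomial (Fin n) K) L := g.toRingHom.toAlgebra
  have hmap : ∀ x, algebraMap (MvPolynomial (Fin n) K) L x = g x := fun _ => rfl
  have : IsScalarTower K (MvPolynomial (Fin n) K) L :=
    IsScalarTower.of_algebraMap_eq fun x => by rw [hmap]; simp
  have : FaithfulSMul (MvPolynomial (Fin n) K) L :=
    (faithfulSMul_iff_algebraMap_injective _ _).2 hg
  let F := FractionRing (MvPolynomial (Fin n) K)
  let : Algebra F L := FractionRing.liftAlgebra _ _
  have : IsScalarTower (MvPolynomial (Fin n) K) F L := FractionRing.isScalarTower_liftAlgebra _ _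
  have : IsScalarTower K F L := by
    refine IsScalarTower.of_algebraMap_eq fun x => ?_
    rw [IsScalarTower.algebraMap_apply K (MvPolynomial (Fin n) K) F,
      ← IsScalarTower.algebraMap_apply (MvPolynomial (Fin n) K) F L,
      ← IsScalarTower.algebraMap_apply]
  have : CharZero F := algebraRat.charZero F
  have : Algebra.EssFiniteType F L := Algebra.EssFiniteType.of_comp K F L
  have : Algebra.FormallySmooth (MvPolynomial (Fin n) K) F :=
    .of_isLocalization (nonZeroDivisors _)
  have : Algebra.FormallySmooth (MvPolynomial (Fin n) K) L := .comp _ F _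
  -- In characteristic zero `L` is formally smooth over the polynomial ring, so `H1Cotangent`
  -- vanishes and the differentials of the variables stay independent in the Kähler differentials of
  -- `L`. Dual coordinates composed with `d` are then the wanted derivations.
  have hinj : Function.Injective
      (KaehlerDifferential.mapBaseChange K (MvPolynomial (Fin n) K) L) := by
    rw [injective_iff_map_eq_zero]
    intro x hx
    obtain ⟨y, rfl⟩ := (Algebra.H1Cotangent.exact_δ_mapBaseChange K _ L x).mp hx
    rw [Subsingleton.elim y 0, map_zero]
  let b := (KaehlerDifferential.mvPolynomialBasis K (Fin n)).baseChange L
  have hli : LinearIndependent L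
      (fun i => KaehlerDifferential.mapBaseChange K (MvPolynomial (Fin n) K) L (b i)) :=
    b.linearIndependent.map' _ (LinearMap.ker_eq_bot.2 hinj)
  have hb : ∀ i, KaehlerDifferential.mapBaseChange K (MvPolynomial (Fin n) K) L (b i) =
      KaehlerDifferential.D K L (g (X i)) := by
    intro i
    simp [b, Module.Basis.baseChange_apply, hmap]
  let B := Module.Basis.extend hli.linearIndepOn_id
  have hmem : ∀ i, KaehlerDifferential.D K L (g (X i)) ∈
      hli.linearIndepOn_id.extend (Set.subset_univ _) := fun i =>
    (hli.linearIndepOn_id.subset_extend _) ⟨i, hb i⟩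
  refine ⟨fun i => (B.coord ⟨_, hmem i⟩).compDer (KaehlerDifferential.D K L), fun i j => ?_⟩
  have h1 : KaehlerDifferential.D K L (g (X j)) = B ⟨_, hmem j⟩ := by
    simp [B]
  have h2 : ((B.coord ⟨_, hmem i⟩).compDer (KaehlerDifferential.D K L)) (g (X j)) =
      B.coord ⟨_, hmem i⟩ (KaehlerDifferential.D K L (g (X j))) := rfl
  rw [h2, h1, Module.Basis.coord_apply, Module.Basis.repr_self, Finsupp.single_apply]
  have h3 : Function.Injective (fun i => KaehlerDifferential.D K L (g (X i))) := by
    have := hli.injective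
    simpa only [hb] using this
  congr 1
  simp only [Subtype.mk.injEq, eq_iff_iff]
  exact ⟨fun h => h3 h, fun h => by rw [h]⟩

/-- Incomparability: contraction along an integral map keeps strict inclusions of primes strict. -/
theorem ringKrullDim_le_of_isIntegral {A C : Type*} [CommRing A] [CommRing C] (g : A →+* C)
    (hg : g.IsIntegral) : ringKrullDim C ≤ ringKrullDim A := by
  let := g.toAlgebra
  have : Algebra.IsIntegral A C := ⟨hg⟩
  refine Order.krullDim_le_of_strictMono (PrimeSpectrum.comap g) fun p q hpq => ?_
  exact Ideal.IsIntegral.comap_lt_comap (R := A) (A := C) hpq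

/-- Lying over for the first prime of a chain, then going up for the rest, lifts the whole chain. -/
theorem le_ringKrullDim_of_isIntegral {A C : Type*} [CommRing A] [CommRing C] (g : A →+* C)
    (hinj : Function.Injective g) (hg : g.IsIntegral) : ringKrullDim A ≤ ringKrullDim C := by
  let := g.toAlgebra
  have : Algebra.IsIntegral A C := ⟨hg⟩
  refine iSup_le fun l => ?_
  obtain ⟨Q, -, hQ, hQ'⟩ := Ideal.exists_ideal_over_prime_of_isIntegral (S := C) l.head.asIdeal ⊥
    (by
      rw [← RingHom.ker_eq_comap_bot, (RingHom.injective_iff_ker_eq_bot (algebraMap A C)).1 hinj]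
      exact bot_le)
  have : Q.LiesOver l.head.asIdeal := ⟨hQ'.symm⟩
  obtain ⟨l₁, hlift, -⟩ := Ideal.exists_ltSeries_of_hasGoingUp l Q
  rw [← hlift]
  exact le_iSup (fun l : LTSeries (PrimeSpectrum C) => (l.length : WithBot ℕ∞)) l₁

/-- Noether normalization, with the dimension. -/
theorem exists_integral_injective_of_finiteType (K R : Type*) [Field K] [CommRing R] [Nontrivial R]
    [Algebra K R] [Algebra.FiniteType K R] :
    ∃ (n : ℕ) (g : MvPolynomial (Fin n) K →ₐ[K] R), Function.Injective g ∧ g.IsIntegral ∧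
      ringKrullDim R = n := by
  obtain ⟨n, g, hg, hint⟩ := exists_integral_inj_algHom_of_fg K R
  refine ⟨n, g, hg, hint, ?_⟩
  have h : ringKrullDim (MvPolynomial (Fin n) K) = n := by
    rw [MvPolynomial.ringKrullDim_of_isNoetherianRing, ringKrullDim_eq_zero_of_field]
    simp
  rw [← h]
  exact le_antisymm (ringKrullDim_le_of_isIntegral g.toRingHom hint)
    (le_ringKrullDim_of_isIntegral g.toRingHom hg hint)

/-- Algebraically independent elements bound the dimension of a finitely generated algebra from
below. -/
theorem le_ringKrullDim_of_injective {K R : Type*} [Field K] [CommRing R] [Algebra K R]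
    [Algebra.FiniteType K R] {N : ℕ} (y : MvPolynomial (Fin N) K →ₐ[K] R)
    (hy : Function.Injective y) : (N : WithBot ℕ∞) ≤ ringKrullDim R := by
  have : Nontrivial R := hy.nontrivial
  obtain ⟨n, g, hg, hg', hdim⟩ := exists_integral_injective_of_finiteType K R
  rw [hdim]
  -- Modulo a prime over the zero ideal of the polynomial ring, `y` remains injective and the target
  -- is a domain, so transcendence degrees apply.
  obtain ⟨p, hp, hpy⟩ := Ideal.exists_comap_eq_of_mem_minimalPrimes_of_injective
    (f := y.toRingHom) hy ⊥ (by rw [IsDomain.minimalPrimes_eq_singleton_bot]; rfl)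
  let A := R ⧸ p
  have : IsDomain A := Ideal.Quotient.isDomain p
  let π := Ideal.Quotient.mkₐ K p
  have hy' : Function.Injective (π.comp y) := by
    rw [injective_iff_map_eq_zero]
    intro x hx
    have : x ∈ p.comap y.toRingHom := Ideal.mem_comap.2 (Ideal.Quotient.eq_zero_iff_mem.1 hx)
    rwa [hpy] at this
  have h1 : AlgebraicIndependent K (fun i => π (y (X i))) := by
    have : aeval (fun i => π (y (X i))) = π.comp y := by ext; simp
    rw [AlgebraicIndependent, this]
    exact hy'
  have h2 : (N : Cardinal) ≤ Algebra.trdeg K A := by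
    have := h1.lift_cardinalMk_le_trdeg
    simpa using this
  -- `A` is integral over the subalgebra generated by the `n` images of the Noether variables.
  have h3 : Algebra.trdeg K A ≤ n := by
    let v : Fin n → A := fun i => π (g (X i))
    have : Algebra.IsAlgebraic (Algebra.adjoin K (Set.range v)) A := by
      have hint : (π.comp g).toRingHom.IsIntegral :=
        RingHom.IsIntegral.trans g.toRingHom π.toRingHom hg'
          (RingHom.isIntegral_of_surjective _ Ideal.Quotient.mk_surjective)
      refine ⟨fun x => ?_⟩
      refine IsIntegral.isAlgebraic ?_
      obtain ⟨q, hq, hq'⟩ := hint x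
      have hmem : ∀ z, (π.comp g) z ∈ Algebra.adjoin K (Set.range v) := by
        intro z
        have : π.comp g = aeval v := by ext; simp [v]
        rw [this, ← aeval_range]
        exact ⟨z, rfl⟩
      let θ : MvPolynomial (Fin n) K →+* Algebra.adjoin K (Set.range v) :=
        ((π.comp g).codRestrict _ hmem).toRingHom
      refine ⟨q.map θ, hq.map θ, ?_⟩
      rw [Polynomial.eval₂_map]
      exact hq'
    have := Algebra.IsAlgebraic.trdeg_le_cardinalMk K (s := Set.range v)
    refine this.trans ?_
    have := Cardinal.mk_range_le_lift (f := v)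
    simpa using this
  have : (N : Cardinal) ≤ n := h2.trans h3
  exact_mod_cast this

end CommutativeAlgebra

/-! ### Derivations at points of algebras of functions. -/

section PointDerivations

open MvPolynomial

variable {K : Type*} [Field K]

/-- A derivation at the point `s` of an algebra of functions. -/
structure PointDerivation {P : Type*} (R : Subalgebra K (P → K)) (s : P) where
  /-- the underlying linear map -/
  toLin : R →ₗ[K] K
  leibniz : ∀ f g : R, toLin (f * g) = (f : P → K) s * toLin g + (g : P → K) s * toLin f

/-- Take `y` in all the other minimal primes but not in `p`: products with elements of `p` lie in
every minimal prime, so they vanish in a reduced ring. Geometrically, a point where `y ≠ 0` lies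
only on the component of `p`. -/
theorem exists_notMem_mul_eq_zero {R : Type*} [CommRing R] [IsNoetherianRing R] [IsReduced R]
    {p : Ideal R} (hp : p ∈ minimalPrimes R) : ∃ y ∉ p, ∀ x ∈ p, y * x = 0 := by
  classical
  have hfin := minimalPrimes.finite_of_isNoetherianRing R
  have hpp : p.IsPrime := hp.1.1
  let s := hfin.toFinset.erase p
  have h : ¬ s.inf id ≤ p := by
    rw [Ideal.IsPrime.inf_le' hpp]
    rintro ⟨q, hq, hqp⟩
    rw [Finset.mem_erase, Set.Finite.mem_toFinset] at hq
    exact hq.1 (le_antisymm hqp (hp.2 hq.2.1 hqp))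
  obtain ⟨y, hy, hyp⟩ := SetLike.not_le_iff_exists.1 h
  refine ⟨y, hyp, fun x hx => ?_⟩
  have hmem : y * x ∈ sInf (minimalPrimes R) := by
    rw [Submodule.mem_sInf]
    intro q hq
    by_cases hqp : q = p
    · rw [hqp]; exact Ideal.mul_mem_left _ _ hx
    · refine Ideal.mul_mem_right _ _ ?_
      have : s.inf id ≤ q := Finset.inf_le (f := id)
        (Finset.mem_erase.2 ⟨hqp, hfin.mem_toFinset.2 hq⟩)
      exact this hy
  have h0 : sInf (minimalPrimes R) = ⊥ := by
    rw [minimalPrimes, Ideal.sInf_minimalPrimes]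
    exact nilradical_eq_zero R
  rwa [h0] at hmem

/-- A common denominator for finitely many derivations of the fraction field. -/
theorem exists_denominator {A L : Type*} [CommRing A] [IsDomain A] [Algebra K A]
    [Algebra.FiniteType K A] [Field L] [Algebra A L] [IsFractionRing A L] [Algebra K L]
    [IsScalarTower K A L] {ι : Type*} [Finite ι] (D : ι → Derivation K L L) :
    ∃ h : A, h ≠ 0 ∧ ∀ i a, ∃ c : A, algebraMap A L c = algebraMap A L h * D i (algebraMap A L a) := by
  classical
  cases nonempty_fintype ι
  obtain ⟨t, ht⟩ := Algebra.FiniteType.out (R := K) (A := A)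
  obtain ⟨b, hb⟩ := IsLocalization.exist_integer_multiples_of_finset (nonZeroDivisors A)
    ((Finset.univ ×ˢ t).image fun ia : ι × A => D ia.1 (algebraMap A L ia.2))
  refine ⟨b, nonZeroDivisors.coe_ne_zero b, fun i a => ?_⟩
  have ha : a ∈ Algebra.adjoin K (t : Set A) := by rw [ht]; trivial
  induction ha using Algebra.adjoin_induction with
  | mem x hx =>
    obtain ⟨c, hc⟩ := hb (D i (algebraMap A L x))
      (Finset.mem_image.2 ⟨(i, x), Finset.mem_product.2 ⟨Finset.mem_univ _, hx⟩, rfl⟩)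
    exact ⟨c, by rw [hc, Algebra.smul_def]⟩
  | algebraMap r =>
    exact ⟨0, by rw [← IsScalarTower.algebraMap_apply, Derivation.map_algebraMap]; simp⟩
  | add x y _ _ hx hy =>
    obtain ⟨c, hc⟩ := hx
    obtain ⟨c', hc'⟩ := hy
    exact ⟨c + c', by simp only [map_add, hc, hc']; ring⟩
  | mul x y _ _ hx hy =>
    obtain ⟨c, hc⟩ := hx
    obtain ⟨c', hc'⟩ := hy
    refine ⟨x * c' + y * c, ?_⟩
    simp only [map_add, map_mul, hc, hc', Derivation.leibniz, smul_eq_mul]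
    ring

/-- Algebraically independent elements of a finitely generated domain have, up to a common
nonzero factor, dual derivations. -/
theorem exists_derivation_of_isDomain [CharZero K] {A : Type*} [CommRing A] [IsDomain A]
    [Algebra K A] [Algebra.FiniteType K A] {n : ℕ} (g : MvPolynomial (Fin n) K →ₐ[K] A)
    (hg : Function.Injective g) :
    ∃ (h : A) (D : Fin n → Derivation K A A), h ≠ 0 ∧
      ∀ i j, D i (g (X j)) = if j = i then h else 0 := by
  let L := FractionRing A
  have hinj := IsFractionRing.injective A L
  have hg' : Function.Injective ((IsScalarTower.toAlgHom K A L).comp g) :=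
    hinj.comp hg
  have : Algebra.EssFiniteType A L := Algebra.EssFiniteType.of_isLocalization L (nonZeroDivisors A)
  have : Algebra.EssFiniteType K L := Algebra.EssFiniteType.comp K A L
  obtain ⟨D, hD⟩ := exists_derivation_of_injective _ hg'
  obtain ⟨h, h0, hh⟩ := exists_denominator (K := K) (A := A) (L := L) D
  choose C hC using hh
  have hadd : ∀ i a b, C i (a + b) = C i a + C i b := by
    intro i a b
    apply hinj
    simp only [map_add, hC, mul_add]
  have hsmul : ∀ i (r : K) a, C i (r • a) = r • C i a := by
    intro i r a
    apply hinj
    have e1 : ∀ a : A, algebraMap A L (r • a) = r • algebraMap A L a := fun a =>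
      map_smul (IsScalarTower.toAlgHom K A L) r a
    rw [e1, hC, hC, e1, Derivation.map_smul, mul_smul_comm]
  have hmul : ∀ i a b, C i (a * b) = a • C i b + b • C i a := by
    intro i a b
    apply hinj
    simp only [map_add, map_mul, hC, Derivation.leibniz, smul_eq_mul]
    ring
  refine ⟨h, fun i => Derivation.mk' ⟨⟨C i, hadd i⟩, hsmul i⟩ (hmul i), h0, fun i j => ?_⟩
  apply hinj
  have h2 : D i (algebraMap A L (g (X j))) = if j = i then 1 else 0 := hD i j
  change algebraMap A L (C i (g (X j))) = _
  rw [hC, h2]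
  split_ifs <;> simp

/-- Algebraically independent elements of an algebra of functions have independent
differentials at some point. -/
theorem exists_pointDerivation [CharZero K] {P : Type*} (R : Subalgebra K (P → K))
    [Algebra.FiniteType K R] {n : ℕ} (y : MvPolynomial (Fin n) K →ₐ[K] R)
    (hy : Function.Injective y) :
    ∃ (s : P) (δ : Fin n → PointDerivation R s) (c : K), c ≠ 0 ∧
      ∀ i j, (δ i).toLin (y (X j)) = if j = i then c else 0 := by
  have : IsNoetherianRing R := Algebra.FiniteType.isNoetherianRing K R
  have : IsReduced R := isReduced_of_injective R.val Subtype.val_injective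
  obtain ⟨p, hp, hpy⟩ := Ideal.exists_minimalPrimes_comap_eq (I := (⊥ : Ideal R)) y.toRingHom ⊥
    (by
      rw [Ideal.comap_bot_of_injective y.toRingHom hy]
      change ⊥ ∈ minimalPrimes (MvPolynomial (Fin n) K)
      rw [IsDomain.minimalPrimes_eq_singleton_bot]; rfl)
  have hpp : p.IsPrime := hp.1.1
  have : IsDomain (R ⧸ p) := Ideal.Quotient.isDomain p
  let π : R →ₐ[K] R ⧸ p := Ideal.Quotient.mkₐ K p
  have hy' : Function.Injective (π.comp y) := by
    rw [injective_iff_map_eq_zero]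
    intro x hx
    have : x ∈ p.comap y.toRingHom := Ideal.mem_comap.2 (Ideal.Quotient.eq_zero_iff_mem.1 hx)
    rwa [hpy] at this
  have : Algebra.FiniteType K (R ⧸ p) :=
    Algebra.FiniteType.of_surjective π (Ideal.Quotient.mkₐ_surjective K p)
  obtain ⟨h, D, h0, hD⟩ := exists_derivation_of_isDomain (A := R ⧸ p) (π.comp y) hy'
  obtain ⟨h', rfl⟩ := Ideal.Quotient.mk_surjective h
  obtain ⟨w, hw, hwp⟩ := exists_notMem_mul_eq_zero hp
  have hne : (w * h' : R) ≠ 0 := by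
    intro h1
    have : w * h' ∈ p := by rw [h1]; exact p.zero_mem
    rcases hpp.mem_or_mem this with h2 | h2
    · exact hw h2
    · exact h0 (Ideal.Quotient.eq_zero_iff_mem.2 h2)
  -- A nonzero function has a nonzero value. Where `w ≠ 0` all of `p` vanishes, so evaluation
  -- factors through `R ⧸ p`; where `h' ≠ 0` the common factor of the dual derivations survives.
  obtain ⟨s, hs⟩ : ∃ s, ((w * h' : R) : P → K) s ≠ 0 := by
    by_contra! hcon
    exact hne (Subtype.ext (funext hcon))
  have hs' : (w : P → K) s * (h' : P → K) s ≠ 0 := hs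
  have hws := left_ne_zero_of_mul hs'
  have hhs := right_ne_zero_of_mul hs'
  let ev : R →ₐ[K] K := (Pi.evalAlgHom K (fun _ : P => K) s).comp R.val
  have hev : ∀ x ∈ p, ev x = 0 := by
    intro x hx
    have h1 : (w : P → K) s * (x : P → K) s = 0 :=
      congrArg (fun f : R => (f : P → K) s) (hwp x hx)
    exact (mul_eq_zero.1 h1).resolve_left hws
  let evA : (R ⧸ p) →ₐ[K] K := Ideal.Quotient.liftₐ p ev hev
  have hevA : ∀ f : R, evA (π f) = (f : P → K) s := fun f => rfl
  let δ : Fin n → PointDerivation R s := fun i =>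
    { toLin := evA.toLinearMap ∘ₗ (D i).toLinearMap ∘ₗ π.toLinearMap
      leibniz := fun f g => by
        change evA (D i (π (f * g))) = _ * evA (D i (π g)) + _ * evA (D i (π f))
        rw [map_mul, Derivation.leibniz, map_add, smul_eq_mul, smul_eq_mul, map_mul, map_mul,
          hevA, hevA] }
  refine ⟨s, δ, (h' : P → K) s, hhs, fun i j => ?_⟩
  change evA (D i ((π.comp y) (X j))) = _
  rw [hD]
  split_ifs
  · rfl
  · exact map_zero evA

end PointDerivations

/-! ### Differential calculus along a tangent vector. -/

section TangentVectors

open MvPolynomial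

variable {K : Type*} [Field K] {P : Type*} {s : P}

/-- A tangent vector at `s`, acting on some class of functions on `P`: `rel f a` says that the
function `f` is in the class, and that its derivative is `a`. -/
structure Tangent (K : Type*) [Field K] {P : Type*} (s : P) where
  /-- `rel f a`: the derivative of `f` is `a` -/
  rel : (P → K) → K → Prop
  const : ∀ c, rel (fun _ => c) 0
  add : ∀ {f g a b}, rel f a → rel g b → rel (fun x => f x + g x) (a + b)
  mul : ∀ {f g a b}, rel f a → rel g b → rel (fun x => f x * g x) (f s * b + g s * a)
  unique : ∀ {f a b}, rel f a → rel f b → a = b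

namespace Tangent

variable (D : Tangent K s)

theorem rel_sum {ι : Type*} (t : Finset ι) {f : ι → P → K} {a : ι → K}
    (h : ∀ i ∈ t, D.rel (f i) (a i)) : D.rel (fun x => ∑ i ∈ t, f i x) (∑ i ∈ t, a i) := by
  classical
  induction t using Finset.induction_on with
  | empty => simpa using D.const 0
  | insert i t hi ih =>
    simp only [Finset.sum_insert hi]
    exact D.add (h i (Finset.mem_insert_self _ _))
      (ih fun j hj => h j (Finset.mem_insert_of_mem hj))

theorem rel_const_mul (c : K) {f : P → K} {a : K} (h : D.rel f a) :
    D.rel (fun x => c * f x) (c * a) := by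
  simpa using D.mul (D.const c) h

variable {W W' U : Type*} [AddCommGroup W] [Module K W] [AddCommGroup W'] [Module K W']
  [AddCommGroup U] [Module K U]

/-- The derivative of the vector valued function `y` is `y'`. -/
def vec (y : P → W) (y' : W) : Prop :=
  ∀ l : Module.Dual K W, D.rel (fun x => l (y x)) (l y')

variable {D}

theorem vec_unique {y : P → W} {a b : W} (ha : D.vec y a) (hb : D.vec y b) : a = b := by
  rw [← sub_eq_zero, ← Module.forall_dual_apply_eq_zero_iff K]
  intro l
  rw [map_sub, D.unique (ha l) (hb l), sub_self]

theorem vec_const (w : W) : D.vec (fun _ => w) 0 := fun l => by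
  simpa using D.const (l w)

theorem vec_linear (L : W →ₗ[K] W') {y : P → W} {y' : W} (h : D.vec y y') :
    D.vec (fun x => L (y x)) (L y') := fun l => h (l ∘ₗ L)

theorem vec_add {y x : P → W} {y' x' : W} (hy : D.vec y y') (hx : D.vec x x') :
    D.vec (fun t => y t + x t) (y' + x') := fun l => by
  simpa only [map_add] using D.add (hy l) (hx l)

theorem vec_sub {y x : P → W} {y' x' : W} (hy : D.vec y y') (hx : D.vec x x') :
    D.vec (fun t => y t - x t) (y' - x') := fun l => by
  simpa [sub_eq_add_neg] using D.add (hy l) (D.rel_const_mul (-1) (hx l))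

theorem vec_sum {ι : Type*} (t : Finset ι) {y : ι → P → W} {y' : ι → W}
    (h : ∀ i ∈ t, D.vec (y i) (y' i)) : D.vec (fun x => ∑ i ∈ t, y i x) (∑ i ∈ t, y' i) := by
  intro l
  simpa only [map_sum] using D.rel_sum t fun i hi => h i hi l

theorem vec_smul {f : P → K} {a : K} (hf : D.rel f a) {y : P → W} {y' : W} (hy : D.vec y y') :
    D.vec (fun x => f x • y x) (f s • y' + a • y s) := fun l => by
  simpa [mul_comm a] using D.mul hf (hy l)

theorem vec_bilinear [FiniteDimensional K W] (b : W →ₗ[K] W' →ₗ[K] U) {y : P → W} {y' : W}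
    {x : P → W'} {x' : W'} (hy : D.vec y y') (hx : D.vec x x') :
    D.vec (fun t => b (y t) (x t)) (b (y s) x' + b y' (x s)) := by
  let e := Module.finBasis K W
  have hexp : ∀ (w : W) (v : W'), b w v = ∑ i, e.coord i w • b (e i) v := by
    intro w v
    conv_lhs => rw [← e.sum_repr w]
    simp only [map_sum, map_smul, LinearMap.sum_apply, LinearMap.smul_apply,
      Module.Basis.coord_apply]
  have := vec_sum (D := D) Finset.univ
    fun i _ => vec_smul (hy (e.coord i)) (vec_linear (b (e i)) hx)
  simp only [hexp (y s), hexp y', ← Finset.sum_add_distrib]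
  simpa only [← hexp] using this

theorem vec_pi {ι : Type*} [Fintype ι] {W : ι → Type*} [∀ i, AddCommGroup (W i)]
    [∀ i, Module K (W i)] {y : P → ∀ i, W i} {y' : ∀ i, W i}
    (h : ∀ i, D.vec (fun x => y x i) (y' i)) : D.vec y y' := by
  classical
  intro l
  have hexp : ∀ w : ∀ i, W i, l w = ∑ i, (l ∘ₗ LinearMap.single K W i) (w i) := by
    intro w
    conv_lhs => rw [← Finset.univ_sum_single w]
    simp
  have := D.rel_sum Finset.univ fun i _ => h i (l ∘ₗ LinearMap.single K W i)
  rw [← hexp] at this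
  simpa only [← hexp] using this

/-- Expanding the first argument in a basis and currying lowers the arity by one and leaves the
product rule for a scalar times a vector. This is what differentiates Plücker vectors. -/
theorem vec_multilinear [FiniteDimensional K W] {k : ℕ}
    (M : MultilinearMap K (fun _ : Fin k => W) U) {y : Fin k → P → W} {y' : Fin k → W}
    (hy : ∀ i, D.vec (y i) (y' i)) :
    D.vec (fun t => M fun i => y i t) (∑ i, M (Function.update (fun j => y j s) i (y' i))) := by
  induction k with
  | zero =>
    have : (fun t => M fun i => y i t) = fun _ => M Fin.elim0 := by
      funext t; congr; funext i; exact i.elim0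
    rw [this]
    simpa using vec_const (D := D) _
  | succ k ih =>
    let e := Module.finBasis K W
    have hexp : ∀ (v : Fin (k + 1) → W),
        M v = ∑ a, e.coord a (v 0) • M.curryLeft (e a) (Fin.tail v) := by
      intro v
      have h1 : M v = M.curryLeft (v 0) (Fin.tail v) := by simp
      rw [h1]
      conv_lhs => rw [← e.sum_repr (v 0)]
      simp only [map_sum, map_smul, _root_.sum_apply, _root_.smul_apply,
        Module.Basis.coord_apply]
    have key := vec_sum (D := D) Finset.univ
      fun a _ => vec_smul (hy 0 (e.coord a)) (ih (M.curryLeft (e a)) fun i => hy i.succ)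
    have e1 : (fun t => M fun i => y i t) = fun t => ∑ a, e.coord a (y 0 t) •
        M.curryLeft (e a) fun i : Fin k => y i.succ t := by
      funext t; rw [hexp]; rfl
    rw [e1]
    convert key using 1
    rw [Finset.sum_add_distrib, Fin.sum_univ_succ, add_comm]
    congr 1
    · simp only [Finset.smul_sum]
      rw [Finset.sum_comm]
      refine Finset.sum_congr rfl fun i _ => ?_
      rw [hexp]
      refine Finset.sum_congr rfl fun a _ => ?_
      congr 1
      congr 1
      funext j
      simp [Fin.tail, Function.update_apply]
    · rw [hexp]
      refine Finset.sum_congr rfl fun a _ => ?_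
      congr 1

end Tangent

/-- A point derivation of an algebra of functions, as a tangent vector. -/
def PointDerivation.tangent {R : Subalgebra K (P → K)} (δ : PointDerivation R s) :
    Tangent K s where
  rel f a := ∃ h : f ∈ R, δ.toLin ⟨f, h⟩ = a
  const c := ⟨R.algebraMap_mem c, by
    have h1 : δ.toLin 1 = 0 := by
      have := δ.leibniz 1 1
      simpa using this
    have h2 : (⟨fun _ => c, R.algebraMap_mem c⟩ : R) = c • 1 := by
      ext x; simp
    rw [h2, map_smul, h1, smul_zero]⟩
  add := by
    rintro f g a b ⟨hf, rfl⟩ ⟨hg, rfl⟩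
    exact ⟨R.add_mem hf hg, by rw [← map_add]; rfl⟩
  mul := by
    rintro f g a b ⟨hf, rfl⟩ ⟨hg, rfl⟩
    exact ⟨R.mul_mem hf hg, (δ.leibniz ⟨f, hf⟩ ⟨g, hg⟩)⟩
  unique := by
    rintro f a b ⟨hf, rfl⟩ ⟨hg, rfl⟩
    rfl

/-- The partial derivative at the origin of polynomial functions on affine space. -/
def polyTangent (K : Type*) [Field K] [Infinite K] {N : ℕ} (j : Fin N) :
    Tangent K (0 : Fin N → K) where
  rel f a := ∃ p : MvPolynomial (Fin N) K, (∀ u, eval u p = f u) ∧ eval 0 (pderiv j p) = a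
  const c := ⟨C c, by simp, by simp⟩
  add := by
    rintro f g a b ⟨p, hp, rfl⟩ ⟨q, hq, rfl⟩
    exact ⟨p + q, by simp [hp, hq], by simp⟩
  mul := by
    rintro f g a b ⟨p, hp, rfl⟩ ⟨q, hq, rfl⟩
    refine ⟨p * q, by simp [hp, hq], ?_⟩
    rw [pderiv_mul, map_add, map_mul, map_mul, hp, hq]
    ring
  unique := by
    rintro f a b ⟨p, hp, rfl⟩ ⟨q, hq, rfl⟩
    rw [MvPolynomial.funext fun u => (hp u).trans (hq u).symm]

end TangentVectors

/-! ### Upper and lower bounds for Zariski dimensions. -/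

section Bounds

open MvPolynomial

variable {K : Type*} [Field K] {E E' : Type*} [AddCommGroup E] [Module K E]
  [AddCommGroup E'] [Module K E']

theorem linear_mem_coordRing (S : Set E) (l : Module.Dual K E) :
    (fun x : S => l (x : E)) ∈ coordRing K S := Algebra.subset_adjoin ⟨l, rfl⟩

instance finiteType_coordRing [FiniteDimensional K E] (S : Set E) :
    Algebra.FiniteType K (coordRing K S) := by
  classical
  rw [← Subalgebra.fg_iff_finiteType]
  let b := Module.finBasis K (Module.Dual K E)
  refine ⟨Finset.univ.image fun i => fun x : S => b i (x : E), ?_⟩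
  refine le_antisymm (Algebra.adjoin_mono ?_) (Algebra.adjoin_le ?_)
  · intro f hf
    obtain ⟨i, -, rfl⟩ := Finset.mem_image.1 hf
    exact ⟨b i, rfl⟩
  · rintro _ ⟨l, rfl⟩
    have : (fun x : S => l (x : E)) = ∑ i, b.repr l i • fun x : S => b i (x : E) := by
      funext x
      conv_lhs => rw [← b.sum_repr l]
      simp only [LinearMap.sum_apply, LinearMap.smul_apply, Finset.sum_apply, Pi.smul_apply]
    simp only [this]
    refine Subalgebra.sum_mem _ fun i _ => Subalgebra.smul_mem _ (Algebra.subset_adjoin ?_) _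
    simp

/-- Pullback of functions along a map with regular coordinates. -/
theorem comp_mem_of_mem_coordRing {P : Type*} (R : Subalgebra K (P → K)) (S : Set E) (y : P → S)
    (hy : ∀ l : Module.Dual K E, (fun x => l (y x : E)) ∈ R) {f : S → K}
    (hf : f ∈ coordRing K S) : f ∘ y ∈ R := by
  have : coordRing K S ≤ R.comap (AlgHom.pi fun x => Pi.evalAlgHom K (fun _ : S => K) (y x)) :=
    Algebra.adjoin_le (by rintro _ ⟨l, rfl⟩; exact hy l)
  exact this hf

/-- Restriction of polynomial functions to a smaller set is surjective, and dimension does not grow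
along a surjection. -/
theorem zariskiDim_mono {S S' : Set E} (h : S ⊆ S') : zariskiDim K S ≤ zariskiDim K S' := by
  let y : S → S' := Set.inclusion h
  let ρ : coordRing K S' →ₐ[K] coordRing K S :=
    ((AlgHom.pi fun x => Pi.evalAlgHom K (fun _ : S' => K) (y x)).comp
      (coordRing K S').val).codRestrict _ fun f =>
      comp_mem_of_mem_coordRing (coordRing K S) S' y (fun l => linear_mem_coordRing S l) f.2
  refine ringKrullDim_le_of_surjective ρ.toRingHom ?_
  rintro ⟨f, hf⟩
  have : coordRing K S ≤ (coordRing K S').map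
      (AlgHom.pi fun x => Pi.evalAlgHom K (fun _ : S' => K) (y x)) := by
    refine Algebra.adjoin_le ?_
    rintro _ ⟨l, rfl⟩
    exact ⟨_, linear_mem_coordRing S' l, rfl⟩
  obtain ⟨g, hg, hgf⟩ := this hf
  exact ⟨⟨g, hg⟩, Subtype.ext hgf⟩

/-- The dimension of the image of a regular map is at most its rank at any point. -/
theorem zariskiDim_range_le [CharZero K] [FiniteDimensional K E] [FiniteDimensional K E']
    (P : Set E) (y : P → E') (hy : ∀ l : Module.Dual K E', (fun x => l (y x)) ∈ coordRing K P)
    (r : ℕ)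
    (H : ∀ s : P, ∃ T : Submodule K E', Module.finrank K T ≤ r ∧
      ∀ (δ : PointDerivation (coordRing K P) s) (y' : E'), δ.tangent.vec y y' → y' ∈ T) :
    zariskiDim K (Set.range y) ≤ r := by
  classical
  rcases isEmpty_or_nonempty P with hP | hP
  · have : IsEmpty (Set.range y) := by rw [Set.range_eq_empty]; infer_instance
    have : Subsingleton (coordRing K (Set.range y)) :=
      ⟨fun a b => Subtype.ext (funext fun x => isEmptyElim x)⟩
    rw [zariskiDim, ringKrullDim_eq_bot_of_subsingleton]
    exact bot_le
  have : Nonempty (Set.range y) := ⟨⟨_, hP.some, rfl⟩⟩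
  have : Nontrivial (coordRing K (Set.range y)) := by
    refine ⟨0, 1, fun h => ?_⟩
    have := congrArg (fun f : coordRing K (Set.range y) =>
      (f : Set.range y → K) (Classical.arbitrary _)) h
    simp at this
  obtain ⟨n, g, hg, -, hdim⟩ := exists_integral_injective_of_finiteType K
    (coordRing K (Set.range y))
  rw [zariskiDim, hdim]
  let q : P → Set.range y := fun x => ⟨y x, x, rfl⟩
  let ρ : coordRing K (Set.range y) →ₐ[K] coordRing K P :=
    ((AlgHom.pi fun x => Pi.evalAlgHom K (fun _ : Set.range y => K) (q x)).comp
      (coordRing K (Set.range y)).val).codRestrict _ fun f =>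
      comp_mem_of_mem_coordRing (coordRing K P) _ q hy f.2
  have hρ : Function.Injective ρ := by
    intro f f' hff
    refine Subtype.ext (funext ?_)
    rintro ⟨_, x, rfl⟩
    exact congrFun (congrArg Subtype.val hff) x
  obtain ⟨s, δ, c, hc, hδ⟩ := exists_pointDerivation (coordRing K P) (ρ.comp g) (hρ.comp hg)
  obtain ⟨T, hT, hT'⟩ := H s
  -- By reflexivity, the values of `δ i` on the linear functions composed with `y` come from a
  -- vector, the derivative of `y` along `δ i`.
  let w : Fin n → E' := fun i => (Module.evalEquiv K E').symm
    { toFun := fun l => (δ i).toLin ⟨fun x => l (y x), hy l⟩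
      map_add' := fun l l' => by rw [← map_add]; rfl
      map_smul' := fun a l => by rw [RingHom.id_apply, ← map_smul]; rfl }
  have hw : ∀ i (l : Module.Dual K E'), l (w i) = (δ i).toLin ⟨fun x => l (y x), hy l⟩ := by
    intro i l
    simp only [w, Module.apply_evalEquiv_symm_apply]
    rfl
  have hwT : ∀ i, w i ∈ T := fun i => hT' (δ i) _ fun l => ⟨hy l, (hw i l).symm⟩
  have hli : LinearIndependent K (fun i => (⟨w i, hwT i⟩ : T)) := by
    rw [Fintype.linearIndependent_iff]
    intro a ha j
    have ha' : ∑ i, a i • w i = 0 := by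
      simpa using congrArg Subtype.val ha
    -- A linear relation among the `w i` makes `∑ a i • δ i` vanish on linear functions, hence by
    -- the Leibniz rule on all regular functions of the image. On the independent function `g (X j)`
    -- its value is `a j * c`, so `a j = 0`.
    have hkill : ∀ f (hf : f ∈ coordRing K (Set.range y)),
        ∑ i, a i * (δ i).toLin (ρ ⟨f, hf⟩) = 0 := by
      intro f hf
      induction hf using Algebra.adjoin_induction with
      | mem f hf =>
        obtain ⟨l, rfl⟩ := hf
        have := congrArg l ha'
        simp only [map_sum, map_smul, hw, smul_eq_mul, map_zero] at this
        exact this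
      | algebraMap r =>
        refine Finset.sum_eq_zero fun i _ => ?_
        have h1 := (δ i).tangent.const r
        obtain ⟨h2, h3⟩ := h1
        have h4 : ρ ⟨algebraMap K _ r, Subalgebra.algebraMap_mem _ r⟩ = ⟨fun _ => r, h2⟩ := rfl
        rw [h4, h3, mul_zero]
      | add f f' hf hf' h1 h2 =>
        have h4 : ρ ⟨f + f', add_mem hf hf'⟩ = ρ ⟨f, hf⟩ + ρ ⟨f', hf'⟩ := rfl
        simp only [h4, map_add, mul_add, Finset.sum_add_distrib]
        rw [h1, h2, add_zero]
      | mul f f' hf hf' h1 h2 =>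
        have h4 : ρ ⟨f * f', mul_mem hf hf'⟩ = ρ ⟨f, hf⟩ * ρ ⟨f', hf'⟩ := rfl
        have h5 : ∀ i, a i * (δ i).toLin (ρ ⟨f * f', mul_mem hf hf'⟩) =
            (ρ ⟨f, hf⟩ : P → K) s * (a i * (δ i).toLin (ρ ⟨f', hf'⟩)) +
            (ρ ⟨f', hf'⟩ : P → K) s * (a i * (δ i).toLin (ρ ⟨f, hf⟩)) := by
          intro i; rw [h4, (δ i).leibniz]; ring
        simp only [h5, Finset.sum_add_distrib, ← Finset.mul_sum]
        rw [h1, h2]; simp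
    have h1 := hkill _ (g (X j)).2
    have h2 : ∀ i, (δ i).toLin (ρ (g (X j))) = if j = i then c else 0 := fun i => hδ i j
    simp only [Subtype.coe_eta, h2] at h1
    simpa [hc] using h1
  have := hli.fintype_card_le_finrank
  rw [Fintype.card_fin] at this
  exact_mod_cast this.trans hT

theorem pderiv_aeval {N : ℕ} (y : Fin N → MvPolynomial (Fin N) K) (j : Fin N)
    (q : MvPolynomial (Fin N) K) :
    pderiv j (aeval y q) = ∑ i, pderiv j (y i) * aeval y (pderiv i q) := by
  induction q using MvPolynomial.induction_on with
  | C a => simp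
  | add p q hp hq => simp only [map_add, hp, hq, mul_add, Finset.sum_add_distrib]
  | mul_X p i hp =>
    simp only [map_mul, aeval_X, pderiv_mul, hp, map_add, mul_add, Finset.sum_add_distrib]
    congr 1
    · rw [Finset.sum_mul]
      exact Finset.sum_congr rfl fun k _ => by ring
    · rw [Finset.sum_eq_single i]
      · simp; ring
      · intro k _ hk
        simp [pderiv_X_of_ne hk.symm]
      · simp

/-- Polynomials with invertible linear part are algebraically independent. -/
theorem aeval_injective_of_pderiv [CharZero K] {N : ℕ} (y : Fin N → MvPolynomial (Fin N) K)
    (h0 : ∀ i, eval 0 (y i) = 0)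
    (h1 : ∀ i j, eval 0 (pderiv j (y i)) = if i = j then 1 else 0) :
    Function.Injective (aeval y : MvPolynomial (Fin N) K →ₐ[K] MvPolynomial (Fin N) K) := by
  classical
  rw [injective_iff_map_eq_zero]
  -- By the chain rule the vector of substituted partial derivatives is killed by the Jacobian
  -- matrix, whose determinant is `1` at the origin and so is nonzero in the polynomial ring.
  have hstep : ∀ q : MvPolynomial (Fin N) K, aeval y q = 0 → ∀ i, aeval y (pderiv i q) = 0 := by
    intro q hq i
    let J : Matrix (Fin N) (Fin N) (MvPolynomial (Fin N) K) :=
      Matrix.of fun j i => pderiv j (y i)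
    have hdet : J.det ≠ 0 := by
      intro h
      have h2 : eval 0 J.det = 1 := by
        rw [RingHom.map_det]
        have : (eval (0 : Fin N → K)).mapMatrix J = 1 := by
          ext a b
          change eval 0 (pderiv a (y b)) = _
          rw [h1, Matrix.one_apply]
          simp only [eq_comm]
        rw [this, Matrix.det_one]
      rw [h, map_zero] at h2
      exact zero_ne_one h2
    have := Matrix.eq_zero_of_mulVec_eq_zero (M := J) (v := fun i => aeval y (pderiv i q)) hdet (by
      funext j
      have := pderiv_aeval y j q
      rw [hq, map_zero] at this
      simpa [Matrix.mulVec, dotProduct, J] using this.symm)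
    exact congrFun this i
  -- Relations are stable under partial derivatives and have no constant term, so repeated
  -- differentiation shows that every coefficient is zero; the integer factors are invertible in
  -- characteristic zero.
  have key : ∀ n : ℕ, ∀ m : Fin N →₀ ℕ, m.degree = n → ∀ q : MvPolynomial (Fin N) K,
      aeval y q = 0 → coeff m q = 0 := by
    intro n
    induction n with
    | zero =>
      intro m hm q hq
      rw [Finsupp.degree_eq_zero_iff] at hm
      subst hm
      have h2 : eval 0 (aeval y q) = eval 0 q := by
        have : (eval (0 : Fin N → K)).comp (aeval y : _ →ₐ[K] MvPolynomial (Fin N) K).toRingHom =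
            eval 0 := by
          apply MvPolynomial.ringHom_ext
          · intro r; simp
          · intro i; simpa using h0 i
        exact congrArg (fun f => f q) this
      rw [hq, map_zero] at h2
      rw [← constantCoeff_eq, ← eval_zero, ← h2]
    | succ n ih =>
      intro m hm q hq
      obtain ⟨i, hi⟩ : ∃ i, m i ≠ 0 := by
        by_contra! hcon
        have : m = 0 := Finsupp.ext hcon
        rw [this] at hm
        simp at hm
      have hmi : m - Finsupp.single i 1 + Finsupp.single i 1 = m := by
        refine tsub_add_cancel_of_le ?_
        rw [Finsupp.single_le_iff]
        omega
      have h2 := ih (m - Finsupp.single i 1) (by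
        have := congrArg Finsupp.degree hmi
        rw [map_add, hm, Finsupp.degree_single] at this
        omega) (pderiv i q) (hstep q hq i)
      rw [coeff_pderiv, hmi] at h2
      refine (mul_eq_zero.1 h2).resolve_right ?_
      exact Nat.cast_add_one_ne_zero _
  intro q hq
  ext m
  rw [key _ m rfl q hq, coeff_zero]

/-- A polynomial map that is an immersion at the origin bounds the dimension of a set containing
its image on a nonempty open subset. -/
theorem le_zariskiDim [CharZero K] [FiniteDimensional K E] {N : ℕ} (S : Set E)
    (ψ : (Fin N → K) → E) (h : MvPolynomial (Fin N) K) (h0 : h ≠ 0)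
    (hS : ∀ u, eval u h ≠ 0 → ψ u ∈ S) (ψ' : Fin N → E) (hψ : LinearIndependent K ψ')
    (hd : ∀ j, (polyTangent K j).vec ψ (ψ' j))
    (hpoly : ∀ l : Module.Dual K E, ∃ p : MvPolynomial (Fin N) K, ∀ u, eval u p = l (ψ u)) :
    (N : WithBot ℕ∞) ≤ zariskiDim K S := by
  classical
  -- The components of a left inverse are linear functions dual to the velocities `ψ'`; their
  -- pullbacks, shifted to vanish at the origin, have identity Jacobian there.
  obtain ⟨G, hG⟩ := LinearMap.exists_leftInverse_of_injective
    (Fintype.linearCombination K ψ') (LinearMap.ker_eq_bot.2 hψ.fintypeLinearCombination_injective)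
  let l : Fin N → Module.Dual K E := fun i => LinearMap.proj i ∘ₗ G
  have hl : ∀ i j, l i (ψ' j) = if i = j then 1 else 0 := by
    intro i j
    have := congrFun (LinearMap.congr_fun hG (Pi.single j 1)) i
    simpa [l, Pi.single_apply, Fintype.linearCombination_apply] using this
  choose p hp using fun i => hpoly (l i)
  let y : Fin N → MvPolynomial (Fin N) K := fun i => p i - C (eval 0 (p i))
  have hinj := aeval_injective_of_pderiv y (fun i => by simp [y]) (fun i j => by
    have h1 : (polyTangent K j).rel (fun u => l i (ψ u)) (eval 0 (pderiv j (p i))) :=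
      ⟨p i, hp i, rfl⟩
    have h2 := (polyTangent K j).unique h1 (hd j (l i))
    simp only [y, map_sub, pderiv_C, sub_zero]
    rw [h2, hl])
  let a : Fin N → coordRing K S := fun i =>
    ⟨fun x => l i (x : E), linear_mem_coordRing S (l i)⟩ - algebraMap K _ (eval 0 (p i))
  refine le_ringKrullDim_of_injective (K := K) (aeval a) ?_
  rw [injective_iff_map_eq_zero]
  intro q hq
  apply (injective_iff_map_eq_zero _).1 hinj
  -- A relation on `S` pulls back to a polynomial that vanishes wherever `h` does not; the factor
  -- `h` covers the remaining points.
  have hmul : aeval y q * h = 0 := by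
    refine MvPolynomial.funext fun u => ?_
    rw [map_mul, map_zero]
    by_cases hu : eval u h = 0
    · rw [hu, mul_zero]
    · have h3 : eval u (aeval y q) = ((aeval a q : coordRing K S) : S → K) ⟨ψ u, hS u hu⟩ := by
        have e1 : (eval u).comp (aeval y : _ →ₐ[K] MvPolynomial (Fin N) K).toRingHom =
            ((Pi.evalAlgHom K (fun _ : S => K) ⟨ψ u, hS u hu⟩).comp
              ((coordRing K S).val.comp (aeval a))).toRingHom := by
          apply MvPolynomial.ringHom_ext
          · intro r; simp
          · intro i; simp [y, a, hp]
        exact congrArg (fun f => f q) e1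
      rw [h3, hq]
      simp
  exact (mul_eq_zero.1 hmul).resolve_right h0

end Bounds

/-! ### Bases adapted to two filtrations at once. -/

section AdaptedBasis

variable {K : Type*} [Field K] {V : Type*} [AddCommGroup V] [Module K V]

/-- Induction on `dim W`. Take `v` in the last nonzero step of `F` on `W` and, inside it, in the
lowest possible step `f (j₁ + 1)`; take `l` vanishing on `f j₁` but not at `v`, and continue in `W ⊓
ker l`. The splitting along `v` respects both filtrations: `v` lies in every nonzero `F p ⊓ W`,
while for each `j` either `v ∈ f j` or `l` kills `f j`. -/
theorem exists_adapted_family [FiniteDimensional K V] (d M : ℕ) (F : ℤ → Submodule K V)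
    (hF : Antitone F) (hF0 : F 0 = ⊤) (hFd : ∀ p, (d : ℤ) < p → F p = ⊥)
    (f : ℕ → Submodule K V) (hf : Monotone f) (hf0 : f 0 = ⊥) (hfM : f M = ⊤) (n : ℕ) :
    ∀ W : Submodule K V, Module.finrank K W = n →
      ∃ (v : Fin n → V) (P : Fin n → ℤ) (J : Fin n → ℕ), LinearIndependent K v ∧
        (∀ p, F p ⊓ W = Submodule.span K (v '' {a | p ≤ P a})) ∧
        (∀ j, f j ⊓ W = Submodule.span K (v '' {a | J a < j})) := by
  classical
  induction n with
  | zero =>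
    intro W hW
    rw [Submodule.finrank_eq_zero] at hW
    subst hW
    refine ⟨Fin.elim0, Fin.elim0, Fin.elim0, linearIndependent_empty_type, fun p => ?_, fun j => ?_⟩
    · rw [Set.eq_empty_of_isEmpty {a : Fin 0 | _}]; simp
    · rw [Set.eq_empty_of_isEmpty {a : Fin 0 | _}]; simp
  | succ n ih =>
    intro W hW
    have hW0 : W ≠ ⊥ := by
      rintro rfl
      simp at hW
    obtain ⟨p₀, hp₀, hp₀'⟩ := Int.exists_greatest_of_bdd (P := fun p => F p ⊓ W ≠ ⊥)
      ⟨d, fun p hp => by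
        by_contra hlt
        exact hp (by rw [hFd p (by omega), bot_inf_eq])⟩
      ⟨0, by rw [hF0, top_inf_eq]; exact hW0⟩
    have hex : ∃ j, f j ⊓ (F p₀ ⊓ W) ≠ ⊥ := ⟨M, by rw [hfM, top_inf_eq]; exact hp₀⟩
    obtain ⟨j₁, hj₁⟩ : ∃ j₁, Nat.find hex = j₁ + 1 := by
      refine Nat.exists_eq_succ_of_ne_zero fun h0 => ?_
      have := Nat.find_spec hex
      rw [h0, hf0, bot_inf_eq] at this
      exact this rfl
    have hspec := Nat.find_spec hex
    rw [hj₁] at hspec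
    have hmin : f j₁ ⊓ (F p₀ ⊓ W) = ⊥ := by
      by_contra hcon
      exact Nat.find_min hex (m := j₁) (by omega) hcon
    obtain ⟨v, hv, hv0⟩ := Submodule.exists_mem_ne_zero_of_ne_bot hspec
    obtain ⟨hvf, hvF, hvW⟩ : v ∈ f (j₁ + 1) ∧ v ∈ F p₀ ∧ v ∈ W := ⟨hv.1, hv.2.1, hv.2.2⟩
    have hvn : v ∉ f j₁ := fun h => hv0 (by
      have : v ∈ f j₁ ⊓ (F p₀ ⊓ W) := ⟨h, hvF, hvW⟩
      rwa [hmin] at this)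
    obtain ⟨l, hlv, hl⟩ := Submodule.exists_dual_map_eq_bot_of_notMem hvn inferInstance
    have hlf : ∀ x ∈ f j₁, l x = 0 := fun x hx => by
      have : l x ∈ (f j₁).map l := ⟨x, hx, rfl⟩
      rwa [hl] at this
    let W' := W ⊓ LinearMap.ker l
    have hsub : ∀ x ∈ W, x - (l x / l v) • v ∈ W' := fun x hx =>
      ⟨W.sub_mem hx (W.smul_mem _ hvW), by
        simp [div_mul_cancel₀ _ hlv]⟩
    have hvW' : v ∉ W' := fun h => hlv h.2
    have hsup : W' ⊔ Submodule.span K {v} = W := by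
      refine le_antisymm (sup_le inf_le_left (by simpa using hvW)) fun x hx => ?_
      rw [← sub_add_cancel x ((l x / l v) • v)]
      exact Submodule.add_mem_sup (hsub x hx)
        (Submodule.smul_mem _ _ (Submodule.mem_span_singleton_self v))
    have hinf : W' ⊓ Submodule.span K {v} = ⊥ := by
      rw [eq_bot_iff]
      rintro x ⟨hx, hx'⟩
      obtain ⟨c, rfl⟩ := Submodule.mem_span_singleton.1 hx'
      have h1 : l (c • v) = 0 := hx.2
      rw [map_smul, smul_eq_mul, mul_eq_zero] at h1
      rw [h1.resolve_right hlv, zero_smul]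
      exact zero_mem _
    have hfin : Module.finrank K W' = n := by
      have := Submodule.finrank_sup_add_finrank_inf_eq W' (Submodule.span K {v})
      rw [hsup, hinf, finrank_bot, finrank_span_singleton hv0, hW] at this
      omega
    obtain ⟨v', P', J', hli, hP', hJ'⟩ := ih W' hfin
    have hv'W : ∀ a, v' a ∈ W' := fun a => by
      have : v' a ∈ F (P' a) ⊓ W' := by
        rw [hP']; exact Submodule.subset_span ⟨a, le_refl (P' a), rfl⟩
      exact this.2
    have hv'F : ∀ a p, p ≤ P' a → v' a ∈ F p := fun a p h => by
      have : v' a ∈ F p ⊓ W' := by rw [hP']; exact Submodule.subset_span ⟨a, h, rfl⟩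
      exact this.1
    have hv'f : ∀ a j, J' a < j → v' a ∈ f j := fun a j h => by
      have : v' a ∈ f j ⊓ W' := by rw [hJ']; exact Submodule.subset_span ⟨a, h, rfl⟩
      exact this.1
    refine ⟨Fin.cons v v', Fin.cons p₀ P', Fin.cons j₁ J', ?_, fun p => ?_, fun j => ?_⟩
    · rw [linearIndependent_finCons]
      refine ⟨hli, fun h => hvW' ?_⟩
      exact (Submodule.span_le.2 (by rintro _ ⟨a, rfl⟩; exact hv'W a)) h
    · apply le_antisymm
      · rintro x ⟨hxF, hxW⟩
        have hsucc : Submodule.span K (v' '' {a | p ≤ P' a}) ≤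
            Submodule.span K (Fin.cons (α := fun _ => V) v v' ''
              {a | p ≤ Fin.cons (α := fun _ => ℤ) p₀ P' a}) := by
          rw [Submodule.span_le]
          rintro _ ⟨a, ha, rfl⟩
          exact Submodule.subset_span ⟨a.succ, by simpa using ha, by simp⟩
        by_cases hp : p ≤ p₀
        · rw [← sub_add_cancel x ((l x / l v) • v)]
          refine Submodule.add_mem _ (hsucc ?_) (Submodule.smul_mem _ _
            (Submodule.subset_span ⟨0, by simpa using hp, by simp⟩))
          rw [← hP']
          exact ⟨(F p).sub_mem hxF ((F p).smul_mem _ (hF hp hvF)), hsub x hxW⟩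
        · have h0 : F p ⊓ W = ⊥ := by
            by_contra hcon
            exact hp (hp₀' p hcon)
          have : x ∈ F p ⊓ W := ⟨hxF, hxW⟩
          rw [h0, Submodule.mem_bot] at this
          rw [this]; exact zero_mem _
      · rw [Submodule.span_le]
        rintro _ ⟨a, ha, rfl⟩
        refine Fin.cases (fun h => ?_) (fun a h => ?_) a ha
        · exact ⟨hF (by simpa using h) hvF, hvW⟩
        · exact ⟨hv'F a p (by simpa using h), (hv'W a).1⟩
    · apply le_antisymm
      · rintro x ⟨hxF, hxW⟩
        have hsucc : Submodule.span K (v' '' {a | J' a < j}) ≤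
            Submodule.span K (Fin.cons (α := fun _ => V) v v' ''
              {a | Fin.cons (α := fun _ => ℕ) j₁ J' a < j}) := by
          rw [Submodule.span_le]
          rintro _ ⟨a, ha, rfl⟩
          exact Submodule.subset_span ⟨a.succ, by simpa using ha, by simp⟩
        by_cases hp : j₁ < j
        · rw [← sub_add_cancel x ((l x / l v) • v)]
          refine Submodule.add_mem _ (hsucc ?_) (Submodule.smul_mem _ _
            (Submodule.subset_span ⟨0, by simpa using hp, by simp⟩))
          rw [← hJ']
          exact ⟨(f j).sub_mem hxF ((f j).smul_mem _ (hf hp hvf)), hsub x hxW⟩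
        · refine hsucc ?_
          rw [← hJ']
          exact ⟨hxF, hxW, hlf x (hf (by omega) hxF)⟩
      · rw [Submodule.span_le]
        rintro _ ⟨a, ha, rfl⟩
        refine Fin.cases (fun h => ?_) (fun a h => ?_) a ha
        · exact ⟨hf (by simpa using h) hvf, hvW⟩
        · exact ⟨hv'f a j (by simpa using h), (hv'W a).1⟩

/-- The basis `b` is adapted to the family of subspaces `G`: each `G i` is spanned by
the basis vectors `b a` with `S i a`. -/
def IsAdapted {ι κ : Type*} (b : Module.Basis ι K V) (G : κ → Submodule K V)
    (S : κ → ι → Prop) : Prop :=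
  ∀ i, G i = Submodule.span K (b '' {a | S i a})

/-- Two filtrations have a common adapted basis. -/
theorem exists_adapted_basis [FiniteDimensional K V] (d M : ℕ) (F : ℤ → Submodule K V)
    (hF : Antitone F) (hF0 : F 0 = ⊤) (hFd : ∀ p, (d : ℤ) < p → F p = ⊥)
    (f : ℕ → Submodule K V) (hf : Monotone f) (hf0 : f 0 = ⊥) (hfM : f M = ⊤) :
    ∃ (b : Module.Basis (Fin (Module.finrank K V)) K V) (P : Fin (Module.finrank K V) → ℤ)
      (J : Fin (Module.finrank K V) → ℕ),
      IsAdapted b F (fun p a => p ≤ P a) ∧ IsAdapted b f (fun j a => J a < j) := by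
  obtain ⟨v, P, J, hli, hP, hJ⟩ := exists_adapted_family d M F hF hF0 hFd f hf hf0 hfM
    (Module.finrank K V) ⊤ (finrank_top K V)
  have hspan : ⊤ ≤ Submodule.span K (Set.range v) := by
    have := hP 0
    rw [hF0, top_inf_eq] at this
    rw [this]
    exact Submodule.span_mono (Set.image_subset_range _ _)
  refine ⟨Module.Basis.mk hli hspan, P, J, fun p => ?_, fun j => ?_⟩
  · rw [Module.Basis.coe_mk, ← hP, inf_top_eq]
  · rw [Module.Basis.coe_mk, ← hJ, inf_top_eq]

namespace IsAdapted

variable {ι κ : Type*} {b : Module.Basis ι K V} {G : κ → Submodule K V} {S : κ → ι → Prop}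

theorem mem_iff (h : IsAdapted b G S) (i : κ) (x : V) :
    x ∈ G i ↔ ∀ a, b.repr x a ≠ 0 → S i a := by
  rw [h i, Module.Basis.mem_span_image]
  constructor
  · intro hx a ha
    exact hx (Finsupp.mem_support_iff.2 ha)
  · intro hx a ha
    exact hx a (Finsupp.mem_support_iff.1 ha)

theorem basis_mem_iff (h : IsAdapted b G S) (i : κ) (a : ι) : b a ∈ G i ↔ S i a := by
  classical
  rw [h.mem_iff]
  constructor
  · intro h1
    exact h1 a (by simp)
  · intro h1 a' ha'
    rw [Module.Basis.repr_self, Finsupp.single_apply] at ha'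
    split_ifs at ha' with h2
    · rwa [← h2]
    · exact absurd rfl ha'

theorem finrank_eq [Fintype ι] (h : IsAdapted b G S) (i : κ) [DecidablePred (S i)] :
    Module.finrank K (G i) = (Finset.univ.filter (S i)).card := by
  classical
  rw [h i]
  have hli : LinearIndependent K (fun a : {a // S i a} => b a) :=
    b.linearIndependent.comp _ Subtype.val_injective
  have := finrank_span_eq_card hli
  rw [Fintype.card_subtype] at this
  rw [← this]
  have himg : b '' {a | S i a} = Set.range fun a : {a // S i a} => b a := by
    ext x
    simp
  rw [himg]

theorem inf {κ' : Type*} {G' : κ' → Submodule K V} {S' : κ' → ι → Prop} (h : IsAdapted b G S)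
    (h' : IsAdapted b G' S') :
    IsAdapted b (fun i : κ × κ' => G i.1 ⊓ G' i.2) (fun i a => S i.1 a ∧ S' i.2 a) := by
  rintro ⟨i, i'⟩
  ext x
  rw [Submodule.mem_inf, h.mem_iff, h'.mem_iff, Module.Basis.mem_span_image]
  constructor
  · rintro ⟨h1, h2⟩ a ha
    exact ⟨h1 a (Finsupp.mem_support_iff.1 ha), h2 a (Finsupp.mem_support_iff.1 ha)⟩
  · intro h1
    exact ⟨fun a ha => (h1 (Finsupp.mem_support_iff.2 ha)).1,
      fun a ha => (h1 (Finsupp.mem_support_iff.2 ha)).2⟩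

theorem map {V' : Type*} [AddCommGroup V'] [Module K V'] (h : IsAdapted b G S) (g : V ≃ₗ[K] V') :
    IsAdapted (b.map g) (fun i => (G i).map (g : V →ₗ[K] V')) S := by
  intro i
  simp only [h i, Submodule.map_span]
  congr 1
  ext x
  simp

end IsAdapted

end AdaptedBasis

/-! ### Skew endomorphisms with prescribed support. -/

section Skew

variable {K : Type*} [Field K] {V : Type*} [AddCommGroup V] [Module K V]

/-- The endomorphisms that are skew-adjoint for the form `B`. -/
def skew (B : LinearMap.BilinForm K V) : Submodule K (Module.End K V) where
  carrier := {X | ∀ v w, B (X v) w + B v (X w) = 0}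
  zero_mem' := fun v w => by simp
  add_mem' := by
    intro X Y hX hY v w
    have h1 := hX v w
    have h2 := hY v w
    simp only [LinearMap.add_apply, map_add]
    linear_combination h1 + h2
  smul_mem' := by
    intro a X hX v w
    have h1 := hX v w
    simp only [LinearMap.smul_apply, map_smul, smul_eq_mul]
    linear_combination a * h1

/-- The skew-adjoint endomorphisms whose matrix of values `B (X b_a) b_{a'}` is supported on `Ω`. -/
def skewOn (B : LinearMap.BilinForm K V) {ι : Type*} (b : Module.Basis ι K V) (Ω : ι → ι → Prop) :
    Submodule K (Module.End K V) where
  carrier := {X | X ∈ skew B ∧ ∀ a a', ¬ Ω a a' → B (X (b a)) (b a') = 0}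
  zero_mem' := ⟨zero_mem _, fun a a' _ => by simp⟩
  add_mem' := by
    intro X Y hX hY
    refine ⟨add_mem hX.1 hY.1, fun a a' h => ?_⟩
    simp [hX.2 a a' h, hY.2 a a' h]
  smul_mem' := by
    intro c X hX
    refine ⟨Submodule.smul_mem _ c hX.1, fun a a' h => ?_⟩
    simp [hX.2 a a' h]

variable {B : LinearMap.BilinForm K V} {ε : ℤ}

theorem skew_apply_comm (hε : ε = 1 ∨ ε = -1) (hB : ∀ v w, B w v = (ε : K) * B v w)
    {X : Module.End K V} (hX : X ∈ skew B) (v w : V) : B (X w) v = -(ε : K) * B (X v) w := by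
  have h1 := hX v w
  have h2 := hB v (X w)
  have h3 : (ε : K) * ε = 1 := by rcases hε with rfl | rfl <;> simp
  rw [h2]
  linear_combination (ε : K) * h1

/-- `X` is skew exactly when `B (X v) w` is a `(-ε)`-symmetric form. Such a form is determined by
its entries above the diagonal, and also by those on it if `ε = -1`, and these may be prescribed
freely on the symmetric support `Ω`. -/
theorem two_mul_finrank_skewOn [CharZero K] [FiniteDimensional K V] (hnd : B.Nondegenerate)
    (hε : ε = 1 ∨ ε = -1) (hB : ∀ v w, B w v = (ε : K) * B v w) {n : ℕ}
    (b : Module.Basis (Fin n) K V) (Ω : Fin n → Fin n → Prop) (hΩ : ∀ a a', Ω a a' → Ω a' a)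
    [DecidableRel Ω] :
    2 * (Module.finrank K (skewOn B b Ω) : ℤ) =
      ((Finset.univ : Finset (Fin n × Fin n)).filter fun q => Ω q.1 q.2).card -
        ε * ((Finset.univ : Finset (Fin n)).filter fun a => Ω a a).card := by
  classical
  have hε2 : (ε : K) * ε = 1 := by rcases hε with rfl | rfl <;> simp
  let I := {q : Fin n × Fin n // Ω q.1 q.2 ∧ (q.1 < q.2 ∨ (ε = -1 ∧ q.1 = q.2))}
  let Φ : skewOn B b Ω →ₗ[K] (I → K) :=
    { toFun := fun X q => B ((X : Module.End K V) (b q.1.1)) (b q.1.2)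
      map_add' := fun X Y => by funext q; simp
      map_smul' := fun c X => by funext q; simp }
  have hinj : Function.Injective Φ := by
    rw [injective_iff_map_eq_zero]
    rintro ⟨X, hX, hX'⟩ h0
    have hlt : ∀ a a', a < a' → B (X (b a)) (b a') = 0 := by
      intro a a' haa
      by_cases hO : Ω a a'
      · exact congrFun h0 ⟨(a, a'), hO, Or.inl haa⟩
      · exact hX' a a' hO
    have hall : ∀ a a', B (X (b a)) (b a') = 0 := by
      intro a a'
      rcases lt_trichotomy a a' with h | h | h
      · exact hlt a a' h
      · subst h
        by_cases hO : Ω a a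
        · rcases hε with h1 | h1
          · have := skew_apply_comm (Or.inl h1) hB hX (b a) (b a)
            rw [h1] at this
            push_cast at this
            have h2 : (2 : K) * B (X (b a)) (b a) = 0 := by linear_combination this
            exact (mul_eq_zero.1 h2).resolve_left two_ne_zero
          · exact congrFun h0 ⟨(a, a), hO, Or.inr ⟨h1, rfl⟩⟩
        · exact hX' a a hO
      · rw [skew_apply_comm hε hB hX (b a') (b a), hlt a' a h, mul_zero]
    refine Subtype.ext ?_
    refine b.ext fun a => ?_
    change X (b a) = 0
    refine hnd.1 _ fun w => ?_
    have : B (X (b a)) = 0 := b.ext fun a' => hall a a'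
    rw [this]; rfl
  have hsurj : Function.Surjective Φ := by
    intro c
    -- The prescribed entries are extended by `(-ε)`-symmetry; nondegeneracy of `B` then turns the
    -- matrix into an endomorphism.
    let β : Fin n → Fin n → K := fun a a' =>
      if h : Ω a a' ∧ (a < a' ∨ (ε = -1 ∧ a = a')) then c ⟨(a, a'), h⟩
      else if h : Ω a' a ∧ a' < a then -(ε : K) * c ⟨(a', a), h.1, Or.inl h.2⟩ else 0
    have hβ : ∀ a a', β a' a = -(ε : K) * β a a' := by
      intro a a'
      rcases lt_trichotomy a a' with h | h | h
      · have h1 : ¬ a' < a := not_lt.2 h.le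
        have h2 : a' ≠ a := h.ne'
        by_cases hO : Ω a a'
        · simp [β, h, h1, h2, hO]
        · have hO' : ¬ Ω a' a := fun h => hO (hΩ _ _ h)
          simp [β, hO, hO']
      · subst h
        rcases hε with h1 | h1
        · simp [β, h1]
        · simp [β, h1]
      · have h1 : ¬ a < a' := not_lt.2 h.le
        have h2 : a ≠ a' := h.ne'
        by_cases hO : Ω a' a
        · simp [β, h, h1, h2, hO, hΩ a' a hO, ← mul_assoc, hε2]
        · have hO' : ¬ Ω a a' := fun h => hO (hΩ _ _ h)
          simp [β, hO, hO']
    have hβ0 : ∀ a a', ¬ Ω a a' → β a a' = 0 := by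
      intro a a' hO
      have hO' : ¬ Ω a' a := fun h => hO (hΩ _ _ h)
      simp [β, hO, hO']
    let form : V →ₗ[K] Module.Dual K V := b.constr K fun a => b.constr K (β a)
    have hform : ∀ a a', form (b a) (b a') = β a a' := by
      intro a a'
      simp [form]
    let X : Module.End K V := (B.toDual hnd).symm.toLinearMap ∘ₗ form
    have hX : ∀ v w, B (X v) w = form v w := fun v w => by
      change B ((B.toDual hnd).symm (form v)) w = _
      rw [← LinearMap.BilinForm.toDual_def (b := hnd), LinearEquiv.apply_symm_apply]
    have hXs : X ∈ skew B := by
      intro v w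
      rw [hX, hB (X w) v, hX]
      have : form + (ε : K) • form.flip = 0 := by
        refine b.ext fun a => b.ext fun a' => ?_
        simp only [LinearMap.add_apply, LinearMap.smul_apply, LinearMap.flip_apply, hform,
          smul_eq_mul, LinearMap.zero_apply]
        rw [hβ a a']
        linear_combination (-β a a') * hε2
      have := LinearMap.congr_fun (LinearMap.congr_fun this v) w
      simpa using this
    refine ⟨⟨X, hXs, fun a a' hO => by rw [hX, hform, hβ0 a a' hO]⟩, ?_⟩
    funext q
    change B (X (b q.1.1)) (b q.1.2) = c q
    rw [hX, hform]
    simp only [β]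
    rw [dif_pos q.2]
  have hfin : Module.finrank K (skewOn B b Ω) = Fintype.card I := by
    rw [(LinearEquiv.ofBijective Φ ⟨hinj, hsurj⟩).finrank_eq, Module.finrank_fintype_fun_eq_card]
  rw [hfin, Fintype.card_subtype]
  let U := (Finset.univ : Finset (Fin n × Fin n))
  have hlt : (U.filter fun q => Ω q.1 q.2 ∧ q.2 < q.1).card =
      (U.filter fun q => Ω q.1 q.2 ∧ q.1 < q.2).card := by
    refine Finset.card_bij (fun q _ => q.swap) ?_ ?_ ?_
    · intro q hq
      simp only [U, Finset.mem_filter, Finset.mem_univ, true_and, Prod.fst_swap,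
        Prod.snd_swap] at hq ⊢
      exact ⟨hΩ _ _ hq.1, hq.2⟩
    · intro q _ q' _ h
      exact Prod.swap_injective h
    · intro q hq
      simp only [U, Finset.mem_filter, Finset.mem_univ, true_and] at hq
      refine ⟨q.swap, ?_, by simp⟩
      simp only [U, Finset.mem_filter, Finset.mem_univ, true_and, Prod.fst_swap, Prod.snd_swap]
      exact ⟨hΩ _ _ hq.1, hq.2⟩
  have hdiag : (U.filter fun q => Ω q.1 q.2 ∧ q.1 = q.2).card =
      ((Finset.univ : Finset (Fin n)).filter fun a => Ω a a).card := by
    symm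
    refine Finset.card_bij (fun a _ => (a, a)) ?_ ?_ ?_
    · intro a ha
      simpa [U] using ha
    · intro a _ a' _ h
      exact (Prod.mk.inj h).1
    · rintro ⟨a, a'⟩ hq
      simp only [U, Finset.mem_filter, Finset.mem_univ, true_and] at hq
      obtain ⟨h1, rfl⟩ := hq
      exact ⟨a, by simpa using h1, rfl⟩
  have hsum : (U.filter fun q => Ω q.1 q.2).card =
      (U.filter fun q => Ω q.1 q.2 ∧ q.1 < q.2).card +
      (U.filter fun q => Ω q.1 q.2 ∧ q.1 = q.2).card +
      (U.filter fun q => Ω q.1 q.2 ∧ q.2 < q.1).card := by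
    simp only [Finset.card_filter, ← Finset.sum_add_distrib]
    refine Finset.sum_congr rfl fun q _ => ?_
    rcases lt_trichotomy q.1 q.2 with h | h | h
    · simp [h, h.ne, not_lt.2 h.le]
    · simp [h]
    · simp [h, h.ne', not_lt.2 h.le]
  have hI : (U.filter fun q => Ω q.1 q.2 ∧ (q.1 < q.2 ∨ (ε = -1 ∧ q.1 = q.2))).card =
      (U.filter fun q => Ω q.1 q.2 ∧ q.1 < q.2).card +
      if ε = -1 then (U.filter fun q => Ω q.1 q.2 ∧ q.1 = q.2).card else 0 := by
    split_ifs with h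
    · simp only [Finset.card_filter, ← Finset.sum_add_distrib]
      refine Finset.sum_congr rfl fun q _ => ?_
      rcases lt_trichotomy q.1 q.2 with h1 | h1 | h1
      · simp [h1, h1.ne]
      · simp [h, h1]
      · simp [h1.ne', not_lt.2 h1.le]
    · simp [h]
  rw [hI, hsum, hlt, ← hdiag]
  rcases hε with rfl | rfl
  · norm_num; ring
  · norm_num; ring

end Skew

/-! ### Sums over unordered pairs, counted twice. -/

section PairSum

/-- The sum of `θ` over ordered pairs, corrected on the diagonal by the sign `ε`: for symmetric `θ`
it is twice the sum over unordered pairs, of distinct elements if `ε = 1`. -/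
def pairSum {ι : Type*} [Fintype ι] (ε : ℤ) (θ : ι → ι → ℤ) : ℤ :=
  ∑ a, ∑ a', θ a a' - ε * ∑ a, θ a a

variable {ι : Type*} [Fintype ι] {ε : ℤ}

theorem pairSum_add (θ θ' : ι → ι → ℤ) :
    pairSum ε (fun a a' => θ a a' + θ' a a') = pairSum ε θ + pairSum ε θ' := by
  simp only [pairSum, Finset.sum_add_distrib]
  ring

theorem pairSum_sub (θ θ' : ι → ι → ℤ) :
    pairSum ε (fun a a' => θ a a' - θ' a a') = pairSum ε θ - pairSum ε θ' := by
  simp only [pairSum, Finset.sum_sub_distrib]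
  ring

theorem pairSum_sum {κ : Type*} (t : Finset κ) (θ : κ → ι → ι → ℤ) :
    pairSum ε (fun a a' => ∑ k ∈ t, θ k a a') = ∑ k ∈ t, pairSum ε (θ k) := by
  classical
  induction t using Finset.induction_on with
  | empty => simp [pairSum]
  | insert k t hk ih => simp only [Finset.sum_insert hk, pairSum_add, ih]

theorem pairSum_mul (c : ℤ) (θ : ι → ι → ℤ) :
    pairSum ε (fun a a' => c * θ a a') = c * pairSum ε θ := by
  simp only [pairSum, ← Finset.mul_sum]
  ring

theorem pairSum_comp (σ : ι ≃ ι) (θ : ι → ι → ℤ) :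
    pairSum ε (fun a a' => θ (σ a) (σ a')) = pairSum ε θ := by
  simp only [pairSum]
  congr 1
  · rw [← Equiv.sum_comp σ (fun a => ∑ a', θ a a')]
    exact Finset.sum_congr rfl fun a _ => Equiv.sum_comp σ (fun a' => θ (σ a) a')
  · rw [Equiv.sum_comp σ (fun a => θ a a)]

theorem pairSum_nonneg (hε : ε = 1 ∨ ε = -1) (θ : ι → ι → ℤ) (h : ∀ a a', 0 ≤ θ a a') :
    0 ≤ pairSum ε θ := by
  rw [pairSum, Finset.mul_sum, ← Finset.sum_sub_distrib]
  refine Finset.sum_nonneg fun a _ => ?_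
  have h1 : θ a a ≤ ∑ a', θ a a' :=
    Finset.single_le_sum (fun a' _ => h a a') (Finset.mem_univ a)
  have h2 := h a a
  rcases hε with rfl | rfl
  · linarith
  · linarith

theorem pairSum_mono (hε : ε = 1 ∨ ε = -1) {θ θ' : ι → ι → ℤ} (h : ∀ a a', θ a a' ≤ θ' a a') :
    pairSum ε θ ≤ pairSum ε θ' := by
  have := pairSum_nonneg hε (fun a a' => θ' a a' - θ a a') fun a a' => sub_nonneg.2 (h a a')
  rw [pairSum_sub] at this
  linarith

/-- Functions with the same counts differ by a permutation. -/
theorem exists_perm_of_card_eq (J J' : ι → ℤ)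
    (h : ∀ k, (Finset.univ.filter fun a => J a < k).card =
      (Finset.univ.filter fun a => J' a < k).card) : ∃ σ : ι ≃ ι, ∀ a, J' (σ a) = J a := by
  classical
  have hsplit : ∀ (J : ι → ℤ) k, (Finset.univ.filter fun a => J a < k + 1).card =
      (Finset.univ.filter fun a => J a < k).card + Fintype.card {a // J a = k} := by
    intro J k
    rw [Fintype.card_subtype, Finset.card_filter, Finset.card_filter, Finset.card_filter,
      ← Finset.sum_add_distrib]
    refine Finset.sum_congr rfl fun a _ => ?_
    split_ifs <;> omega
  have hcard : ∀ k, Fintype.card {a // J a = k} = Fintype.card {a // J' a = k} := by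
    intro k
    have h1 := hsplit J k
    have h2 := hsplit J' k
    rw [h, h] at h1
    omega
  refine ⟨Equiv.ofFiberEquiv fun k => Fintype.equivOfCardEq (hcard k), fun a => ?_⟩
  exact Equiv.ofFiberEquiv_map _ a

end PairSum

/-! ### Adjoint Hodge numbers in an adapted basis. -/

section HodgeNumbers

variable {K : Type*} [Field K] {V : Type*} [AddCommGroup V] [Module K V]
  {B : LinearMap.BilinForm K V} {ε : ℤ}

theorem two_mul_finrank_skewOn_eq_pairSum [CharZero K] [FiniteDimensional K V]
    (hnd : B.Nondegenerate) (hε : ε = 1 ∨ ε = -1)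
    (hB : ∀ v w, B w v = (ε : K) * B v w) {n : ℕ} (b : Module.Basis (Fin n) K V)
    (Ω : Fin n → Fin n → Prop) (hΩ : ∀ a a', Ω a a' → Ω a' a) [DecidableRel Ω] :
    2 * (Module.finrank K (skewOn B b Ω) : ℤ) =
      pairSum ε (fun a a' => if Ω a a' then 1 else 0) := by
  rw [two_mul_finrank_skewOn hnd hε hB b Ω hΩ, pairSum]
  congr 1
  · rw [Finset.card_filter, ← Finset.univ_product_univ, Finset.sum_product]
    push_cast
    rfl
  · rw [Finset.card_filter]
    push_cast
    rfl

theorem bilin_eq_zero_of_span (β : V →ₗ[K] V →ₗ[K] K) {S T : Set V}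
    (h : ∀ x ∈ S, ∀ y ∈ T, β x y = 0) {x y : V} (hx : x ∈ Submodule.span K S)
    (hy : y ∈ Submodule.span K T) : β x y = 0 := by
  have h1 : ∀ x ∈ S, Submodule.span K T ≤ LinearMap.ker (β x) := fun x hx =>
    Submodule.span_le.2 fun y hy => h x hx y hy
  have h2 : Submodule.span K S ≤ LinearMap.ker (β.flip y) :=
    Submodule.span_le.2 fun x hx => h1 x hx hy
  exact h2 hx

theorem IsSelfDualFiltration.mem_iff {d : ℕ} {F : ℤ → Submodule K V}
    (hF : IsSelfDualFiltration B d F) (p : ℤ) (x : V) :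
    x ∈ F p ↔ ∀ w ∈ F (d + 1 - p), B w x = 0 := by
  have := hF.self_dual (d + 1 - p)
  rw [sub_sub_cancel] at this
  rw [this]
  rfl

theorem eq_zero_comm (hε : ε = 1 ∨ ε = -1) (hB : ∀ v w, B w v = (ε : K) * B v w) {v w : V} :
    B v w = 0 ↔ B w v = 0 := by
  rw [hB v w]
  rcases hε with rfl | rfl <;> simp

theorem mem_lieGAut_of_mem_skew {X : Module.End K V} (hX : X ∈ skew B) : X ∈ lieGAut B :=
  ⟨0, fun v w => by rw [hX v w, zero_mul]⟩

section Adapted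

variable {d : ℕ} {F : ℤ → Submodule K V} {n : ℕ} {b : Module.Basis (Fin n) K V} {P : Fin n → ℤ}

/-- Since `F (i + p)` is the orthogonal of `F (d + 1 - i - p)`, raising the filtration by `p` is a
vanishing condition on the values `B (X b_a) b_{a'}`: they must be zero once `P a + P a' ≥ d + 1 -
p`. -/
theorem skew_inf_adjFil_eq_skewOn (hε : ε = 1 ∨ ε = -1) (hB : ∀ v w, B w v = (ε : K) * B v w)
    (hF : IsSelfDualFiltration B d F) (hP : IsAdapted b F (fun p a => p ≤ P a)) (p : ℤ) :
    skew B ⊓ adjFil B F p = skewOn B b (fun a a' => P a + P a' ≤ d - p) := by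
  ext X
  constructor
  · rintro ⟨hX, -, hX'⟩
    refine ⟨hX, fun a a' h => ?_⟩
    have h1 := hX' (P a) (b a) ((hP.basis_mem_iff _ _).2 le_rfl)
    rw [hF.mem_iff] at h1
    rw [eq_zero_comm hε hB]
    exact h1 _ ((hP.basis_mem_iff _ _).2 (by omega))
  · rintro ⟨hX, hX'⟩
    refine ⟨hX, mem_lieGAut_of_mem_skew hX, fun i v hv => ?_⟩
    rw [hF.mem_iff]
    intro w hw
    rw [eq_zero_comm hε hB]
    rw [hP] at hv hw
    refine bilin_eq_zero_of_span (B ∘ₗ X) ?_ hv hw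
    rintro _ ⟨a, ha, rfl⟩ _ ⟨a', ha', rfl⟩
    refine hX' a a' ?_
    have h1 : i ≤ P a := ha
    have h2 : (d : ℤ) + 1 - (i + p) ≤ P a' := ha'
    omega

theorem IsSelfDualFiltration.adapted_bounds (hF : IsSelfDualFiltration B d F)
    (hP : IsAdapted b F (fun p a => p ≤ P a)) (a : Fin n) : 0 ≤ P a ∧ P a ≤ d := by
  constructor
  · rw [← hP.basis_mem_iff, hF.eq_top 0 le_rfl]; trivial
  · by_contra h
    have h1 : b a ∈ F (P a) := (hP.basis_mem_iff _ _).2 le_rfl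
    rw [hF.eq_bot _ (by omega)] at h1
    exact b.ne_zero a h1

theorem one_mem_lieGAut : (1 : Module.End K V) ∈ lieGAut B :=
  ⟨2, fun v w => by simp; ring⟩

/-- In positive degree the multiplier `c` is zero. If `P a` is maximal then `F (P a + 1) = 0`, so
`X` kills `b a`; dually `F (d - P a) = V`, so `X V` lies in `F (d + 1 - P a)`, which is orthogonal
to `b a`. Hence `c * B (b a) w = 0` for all `w`. -/
theorem adjFil_eq_of_pos (hF : IsSelfDualFiltration B d F) [CharZero K]
    (hP : IsAdapted b F (fun p a => p ≤ P a)) (hnd : B.Nondegenerate) {p : ℤ} (hp : 0 < p) :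
    adjFil B F p = skew B ⊓ adjFil B F p := by
  refine le_antisymm (fun X hX => ⟨?_, hX⟩) inf_le_right
  obtain ⟨⟨c, hc⟩, hX'⟩ := hX
  rcases Nat.eq_zero_or_pos n with hn | hn
  · subst hn
    intro v w
    have hv : v = 0 := by
      rw [← b.sum_repr v]; simp
    simp [hv]
  have : Nonempty (Fin n) := ⟨⟨0, hn⟩⟩
  obtain ⟨a, ha⟩ := Finite.exists_max P
  have hbot : F (P a + 1) = ⊥ := by
    rw [hP]
    rw [Submodule.span_eq_bot]
    rintro _ ⟨a', ha', rfl⟩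
    have h1 : P a + 1 ≤ P a' := ha'
    have := ha a'
    omega
  have htop : F (d - P a) = ⊤ := by
    have := hF.self_dual (P a + 1)
    rw [hbot] at this
    have e : (d : ℤ) + 1 - (P a + 1) = d - P a := by ring
    rw [e] at this
    rw [this]
    simp
  have hXa : X (b a) = 0 := by
    have h1 := hX' (P a) (b a) ((hP.basis_mem_iff _ _).2 le_rfl)
    have h2 := hF.antitone (show P a + 1 ≤ P a + p by omega) h1
    rwa [hbot] at h2
  have hc0 : c = 0 := by
    by_contra hc0
    refine b.ne_zero a (hnd.1 _ fun w => ?_)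
    have h1 : X w ∈ F (d - P a + p) := hX' _ w (by rw [htop]; trivial)
    have h2 := hF.antitone (show (d : ℤ) + 1 - P a ≤ d - P a + p by omega) h1
    rw [hF.self_dual] at h2
    have h3 : B (b a) (X w) = 0 := h2 _ ((hP.basis_mem_iff _ _).2 le_rfl)
    have h4 := hc (b a) w
    rw [hXa, h3] at h4
    simp only [map_zero, LinearMap.zero_apply, add_zero] at h4
    exact (mul_eq_zero.1 h4.symm).resolve_left hc0
  intro v w
  rw [hc, hc0, zero_mul]

theorem one_notMem_skew [CharZero K] [Nontrivial V] (hnd : B.Nondegenerate) :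
    (1 : Module.End K V) ∉ skew B := by
  intro h
  obtain ⟨v, hv⟩ := exists_ne (0 : V)
  refine hv (hnd.1 _ fun w => ?_)
  have h1 := h v w
  simp only [Module.End.one_apply] at h1
  have h2 : (2 : K) * B v w = 0 := by linear_combination h1
  exact (mul_eq_zero.1 h2).resolve_left two_ne_zero

/-- Subtracting `c / 2` makes an element of `lieGAut B` with multiplier `c` skew, and a nonzero
scalar is never skew. So the scalars add one dimension in degrees `p ≤ 0`; in positive degrees there
are none. -/
theorem finrank_adjFil [CharZero K] [FiniteDimensional K V] [Nontrivial V]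
    (hF : IsSelfDualFiltration B d F)
    (hP : IsAdapted b F (fun p a => p ≤ P a)) (hnd : B.Nondegenerate) (p : ℤ) :
    Module.finrank K (adjFil B F p) =
      Module.finrank K (skew B ⊓ adjFil B F p : Submodule K (Module.End K V)) +
        if p ≤ 0 then 1 else 0 := by
  split_ifs with hp
  · have hsup : (skew B ⊓ adjFil B F p) ⊔ Submodule.span K {(1 : Module.End K V)} =
        adjFil B F p := by
      have h1 : (1 : Module.End K V) ∈ adjFil B F p :=
        ⟨one_mem_lieGAut, fun i v hv => hF.antitone (show i + p ≤ i by omega) hv⟩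
      refine le_antisymm (sup_le inf_le_right (by simpa using h1)) fun X hX => ?_
      obtain ⟨c, hc⟩ := hX.1
      rw [← sub_add_cancel X ((c / 2) • (1 : Module.End K V))]
      refine Submodule.add_mem_sup ⟨fun v w => ?_, Submodule.sub_mem _ hX
        (Submodule.smul_mem _ _ h1)⟩ (Submodule.smul_mem _ _ (Submodule.mem_span_singleton_self _))
      have := hc v w
      simp only [LinearMap.sub_apply, LinearMap.smul_apply, Module.End.one_apply, map_sub,
        map_smul, smul_eq_mul]
      linear_combination this
    have hinf : (skew B ⊓ adjFil B F p) ⊓ Submodule.span K {(1 : Module.End K V)} = ⊥ := by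
      rw [eq_bot_iff]
      rintro X ⟨⟨hX, -⟩, hX'⟩
      obtain ⟨c, rfl⟩ := Submodule.mem_span_singleton.1 hX'
      by_cases hc : c = 0
      · rw [hc, zero_smul]; exact zero_mem _
      · exfalso
        refine one_notMem_skew hnd ?_
        have := Submodule.smul_mem _ c⁻¹ hX
        rwa [smul_smul, inv_mul_cancel₀ hc, one_smul] at this
    have := Submodule.finrank_sup_add_finrank_inf_eq (skew B ⊓ adjFil B F p)
      (Submodule.span K {(1 : Module.End K V)})
    rwa [hsup, hinf, finrank_bot, add_zero, finrank_span_singleton one_ne_zero] at this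
  · rw [← adjFil_eq_of_pos hF hP hnd (by omega), add_zero]

theorem finrank_subQuot [FiniteDimensional K V] {G H : Submodule K V} (h : H ≤ G) :
    Module.finrank K (SubQuot G H) + Module.finrank K H = Module.finrank K G := by
  have := Submodule.finrank_quotient_add_finrank (H.submoduleOf G)
  rwa [(Submodule.submoduleOfEquivOfLe h).finrank_eq] at this

/-- The adjoint Hodge numbers in terms of an adapted basis. -/
theorem two_mul_hodge [CharZero K] [FiniteDimensional K V] [Nontrivial V]
    (hnd : B.Nondegenerate) (hε : ε = 1 ∨ ε = -1) (hB : ∀ v w, B w v = (ε : K) * B v w)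
    (hF : IsSelfDualFiltration B d F) (hP : IsAdapted b F (fun p a => p ≤ P a)) (p : ℤ) :
    2 * (hodge B F p : ℤ) =
      pairSum ε (fun a a' => if (d : ℤ) - P a - P a' = p then 1 else 0) +
        if p = 0 then 2 else 0 := by
  have hle : adjFil B F (p + 1) ≤ adjFil B F p := fun X hX =>
    ⟨hX.1, fun i v hv => hF.antitone (show i + p ≤ i + (p + 1) by omega) (hX.2 i v hv)⟩
  have h1 := finrank_subQuot hle
  -- The scalars contribute equally to steps `p` and `p + 1` except for `p = 0`; this is the extra
  -- `2` in degree zero.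
  have h2 := finrank_adjFil hF hP hnd p
  have h3 := finrank_adjFil hF hP hnd (p + 1)
  rw [skew_inf_adjFil_eq_skewOn hε hB hF hP] at h2 h3
  have h4 := two_mul_finrank_skewOn_eq_pairSum hnd hε hB b
    (fun a a' => P a + P a' ≤ (d : ℤ) - p) (fun a a' h => by omega)
  have h5 := two_mul_finrank_skewOn_eq_pairSum hnd hε hB b
    (fun a a' => P a + P a' ≤ (d : ℤ) - (p + 1)) (fun a a' h => by omega)
  have h6 : pairSum ε (fun a a' => if (d : ℤ) - P a - P a' = p then 1 else 0) =
      pairSum ε (fun a a' => if P a + P a' ≤ (d : ℤ) - p then 1 else 0) -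
      pairSum ε (fun a a' => if P a + P a' ≤ (d : ℤ) - (p + 1) then 1 else 0) := by
    rw [← pairSum_sub]
    congr 1
    funext a a'
    split_ifs <;> omega
  rw [h6, ← h4, ← h5]
  change Module.finrank K (SubQuot (adjFil B F p) (adjFil B F (p + 1))) + _ = _ at h1
  rw [h2, h3] at h1
  change 2 * ((Module.finrank K (SubQuot (adjFil B F p) (adjFil B F (p + 1))) : ℕ) : ℤ) = _
  split_ifs at h1 ⊢ <;> omega

end Adapted

end HodgeNumbers

/-! ### Combinatorics of a balanced self-dual flag. -/

section FlagCombinatorics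

variable {K : Type*} [Field K] {V : Type*} [AddCommGroup V] [Module K V]
  {B : LinearMap.BilinForm K V} {ε : ℤ} {d m : ℕ} {F : ℤ → Submodule K V} {f : ℕ → Submodule K V}
  {n : ℕ} {b : Module.Basis (Fin n) K V} {P : Fin n → ℤ} {J : Fin n → ℕ}

theorem finrank_orthogonal_add [FiniteDimensional K V] (hnd : B.Nondegenerate)
    (W : Submodule K V) :
    Module.finrank K (B.orthogonal W) + Module.finrank K W = Module.finrank K V := by
  have h1 := LinearMap.BilinForm.finrank_orthogonal hnd W
  have h2 := Submodule.finrank_le W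
  omega

theorem card_filter_lt_add (P : Fin n → ℤ) (k : ℤ) :
    (Finset.univ.filter fun a => P a < k).card + (Finset.univ.filter fun a => k ≤ P a).card = n := by
  have := Finset.card_filter_add_card_filter_not (s := (Finset.univ : Finset (Fin n)))
    (fun a => P a < k)
  simpa [not_lt] using this

/-- Orthogonality gives `dim F (d + 1 - p) = dim V - dim F p`, so the jumps of `F` are symmetric
under `p ↦ d - p`. -/
theorem exists_perm_filtration [FiniteDimensional K V] (hnd : B.Nondegenerate)
    (hF : IsSelfDualFiltration B d F) (hP : IsAdapted b F (fun p a => p ≤ P a)) :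
    ∃ σ : Fin n ≃ Fin n, ∀ a, P (σ a) = d - P a := by
  refine exists_perm_of_card_eq (fun a => (d : ℤ) - P a) P fun k => ?_
  have hn : Module.finrank K V = n := by simpa using Module.finrank_eq_card_basis b
  have h1 := finrank_orthogonal_add hnd (F k)
  rw [← hF.self_dual, hP.finrank_eq, hP.finrank_eq, hn] at h1
  have h2 := card_filter_lt_add P k
  have h3 : (Finset.univ.filter fun a => (d : ℤ) - P a < k) =
      Finset.univ.filter fun a => (d : ℤ) + 1 - k ≤ P a := by
    refine Finset.filter_congr fun a _ => ?_
    omega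
  rw [h3]
  omega

theorem IsSelfDualFlag.adapted_le (hf : IsSelfDualFlag B m f)
    (hJ : IsAdapted b f (fun j a => J a < j)) (a : Fin n) : J a ≤ 2 * m := by
  have : b a ∈ f (2 * m + 1) := by rw [hf.eq_top]; trivial
  rw [hJ.basis_mem_iff] at this
  omega

/-- The dimensions of a self-dual flag make the jumps symmetric under `j ↦ 2m - j`. The thresholds
outside `0, …, 2m + 1`, where self-duality says nothing, need only the bounds on `J`. -/
theorem exists_perm_flag [FiniteDimensional K V] (hnd : B.Nondegenerate)
    (hf : IsSelfDualFlag B m f) (hJ : IsAdapted b f (fun j a => J a < j)) :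
    ∃ σ : Fin n ≃ Fin n, ∀ a, (J (σ a) : ℤ) = 2 * m - J a := by
  refine exists_perm_of_card_eq (fun a => 2 * (m : ℤ) - J a) (fun a => (J a : ℤ)) fun k => ?_
  have hle := hf.adapted_le hJ
  have hn : Module.finrank K V = n := by simpa using Module.finrank_eq_card_basis b
  rcases lt_or_ge k 0 with hk | hk
  · have h1 : (Finset.univ.filter fun a => 2 * (m : ℤ) - J a < k) = ∅ := by
      refine Finset.filter_false_of_mem fun a _ => ?_
      have := hle a
      omega
    have h2 : (Finset.univ.filter fun a => (J a : ℤ) < k) = ∅ := by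
      refine Finset.filter_false_of_mem fun a _ => ?_
      omega
    rw [h1, h2]
  lift k to ℕ using hk
  rcases lt_or_ge (2 * m + 1) k with hk | hk
  · have h1 : (Finset.univ.filter fun a => 2 * (m : ℤ) - J a < k) = Finset.univ := by
      refine Finset.filter_true_of_mem fun a _ => ?_
      omega
    have h2 : (Finset.univ.filter fun a => (J a : ℤ) < k) = Finset.univ := by
      refine Finset.filter_true_of_mem fun a _ => ?_
      have := hle a
      omega
    rw [h1, h2]
  have h1 := finrank_orthogonal_add hnd (f k)
  rw [← hf.self_dual k hk, hJ.finrank_eq, hJ.finrank_eq, hn] at h1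
  have h2 := card_filter_lt_add (fun a => (J a : ℤ)) (2 * m + 1 - k)
  have h3 : (Finset.univ.filter fun a => 2 * (m : ℤ) - J a < k) =
      Finset.univ.filter fun a => (2 * (m : ℤ) + 1 - k) ≤ J a := by
    refine Finset.filter_congr fun a _ => ?_
    omega
  have h4 : (Finset.univ.filter fun a => J a < 2 * m + 1 - k) =
      Finset.univ.filter fun a => (J a : ℤ) < 2 * m + 1 - k := by
    refine Finset.filter_congr fun a _ => ?_
    omega
  have h5 : (Finset.univ.filter fun a => J a < k) =
      Finset.univ.filter fun a => (J a : ℤ) < k := by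
    refine Finset.filter_congr fun a _ => ?_
    omega
  rw [h4, h5] at h1
  rw [h3]
  omega

theorem finrank_inducedFil_add [FiniteDimensional K V] (hf : Monotone f) (k : ℕ) (p : ℤ) :
    Module.finrank K (inducedFil F f k p) + Module.finrank K (F p ⊓ f k : Submodule K V) =
      Module.finrank K (F p ⊓ f (k + 1) : Submodule K V) := by
  let N := (F p).submoduleOf (f (k + 1))
  have h1 := LinearMap.finrank_range_add_finrank_ker ((toGr f k).domRestrict N)
  rw [LinearMap.range_domRestrict] at h1
  have h2 : Module.finrank K N = Module.finrank K (F p ⊓ f (k + 1) : Submodule K V) := by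
    rw [← Submodule.finrank_map_subtype_eq (f (k + 1)) N]
    have : N.map (f (k + 1)).subtype = F p ⊓ f (k + 1) :=
      (Submodule.map_comap_subtype (f (k + 1)) (F p)).trans (inf_comm _ _)
    rw [this]
  have h3 : Module.finrank K (LinearMap.ker ((toGr f k).domRestrict N)) =
      Module.finrank K (F p ⊓ f k : Submodule K V) := by
    let ψ : N →ₗ[K] V := (f (k + 1)).subtype ∘ₗ N.subtype
    have hψ : Function.Injective ψ := Subtype.val_injective.comp Subtype.val_injective
    rw [(Submodule.equivMapOfInjective ψ hψ _).finrank_eq]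
    have : (LinearMap.ker ((toGr f k).domRestrict N)).map ψ = F p ⊓ f k := by
      ext x
      constructor
      · rintro ⟨⟨⟨y, hy⟩, hyN⟩, hker, rfl⟩
        have h4 : (⟨y, hy⟩ : f (k + 1)) ∈ (f k).submoduleOf (f (k + 1)) :=
          (Submodule.Quotient.mk_eq_zero _).1 hker
        exact ⟨hyN, h4⟩
      · rintro ⟨hx, hx'⟩
        refine ⟨⟨⟨x, hf (Nat.le_succ k) hx'⟩, hx⟩, ?_, rfl⟩
        exact (Submodule.Quotient.mk_eq_zero _).2 hx'
    rw [this]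
  rw [h2, h3] at h1
  exact h1

/-- The vectors with `J a = k` induce a basis of `Gr f k` adapted to the induced filtration, so
weight `d / 2` says that their degrees `P a` average to `d / 2`. For a zero graded piece the sum is
empty. -/
theorem sum_weight_eq_zero [FiniteDimensional K V] (hF : IsSelfDualFiltration B d F)
    (hf : IsSelfDualFlag B m f)
    (hP : IsAdapted b F (fun p a => p ≤ P a)) (hJ : IsAdapted b f (fun j a => J a < j)) (k : ℕ)
    (hw : Nontrivial (Gr f k) → weight d (inducedFil F f k) = (d : ℚ) / 2) :
    ∑ a ∈ Finset.univ.filter (fun a => J a = k), ((d : ℤ) - 2 * P a) = 0 := by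
  let S := Finset.univ.filter (fun a => J a = k)
  have hc : ∀ p, Module.finrank K (inducedFil F f k p) = (S.filter fun a => p ≤ P a).card := by
    intro p
    have h1 := finrank_inducedFil_add (F := F) hf.monotone k p
    have h2 := (hP.inf hJ).finrank_eq (p, k)
    have h3 := (hP.inf hJ).finrank_eq (p, k + 1)
    simp only at h2 h3
    rw [h2, h3] at h1
    have h4 : (Finset.univ.filter fun a => p ≤ P a ∧ J a < k + 1).card =
        (S.filter fun a => p ≤ P a).card +
        (Finset.univ.filter fun a => p ≤ P a ∧ J a < k).card := by
      rw [Finset.filter_filter]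
      simp only [Finset.card_filter, ← Finset.sum_add_distrib]
      refine Finset.sum_congr rfl fun a _ => ?_
      split_ifs <;> omega
    omega
  have hsub : ∀ p, Module.finrank K (SubQuot (inducedFil F f k p) (inducedFil F f k (p + 1))) =
      (S.filter fun a => P a = p).card := by
    intro p
    have hle : inducedFil F f k (p + 1) ≤ inducedFil F f k p :=
      Submodule.map_mono (Submodule.comap_mono (hF.antitone (by omega)))
    have h1 := finrank_subQuot hle
    rw [hc, hc] at h1
    have h4 : (S.filter fun a => p ≤ P a).card = (S.filter fun a => P a = p).card +
        (S.filter fun a => p + 1 ≤ P a).card := by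
      simp only [Finset.card_filter, ← Finset.sum_add_distrib]
      refine Finset.sum_congr rfl fun a _ => ?_
      split_ifs <;> omega
    omega
  have hgr : Module.finrank K (Gr f k) = S.card := by
    have h1 := hc 0
    have h2 : inducedFil F f k 0 = ⊤ := by
      rw [inducedFil, hF.eq_top 0 le_rfl]
      have : Submodule.submoduleOf (⊤ : Submodule K V) (f (k + 1)) = ⊤ := rfl
      rw [this, Submodule.map_top, LinearMap.range_eq_top]
      exact Submodule.mkQ_surjective _
    rw [h2, finrank_top] at h1
    rw [h1, Finset.filter_true_of_mem fun a _ => (hF.adapted_bounds hP a).1]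
  have hsum : ∑ p ∈ Finset.range (d + 1), (p : ℤ) * ((S.filter fun a => P a = p).card : ℤ) =
      ∑ a ∈ S, P a := by
    simp only [Finset.card_filter, Nat.cast_sum, Finset.mul_sum]
    rw [Finset.sum_comm]
    refine Finset.sum_congr rfl fun a _ => ?_
    obtain ⟨h1, h2⟩ := hF.adapted_bounds hP a
    lift P a to ℕ using h1 with q hq
    rw [Finset.sum_eq_single q]
    · simp
    · intro p _ hp
      have : (q : ℤ) ≠ p := by exact_mod_cast hp.symm
      simp [this]
    · intro h
      exact absurd (Finset.mem_range.2 (by omega)) h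
  change ∑ a ∈ S, ((d : ℤ) - 2 * P a) = 0
  rcases Nat.eq_zero_or_pos S.card with h0 | h0
  · rw [Finset.card_eq_zero.1 h0, Finset.sum_empty]
  · have hnt : Nontrivial (Gr f k) := Module.finrank_pos_iff.1 (by rw [hgr]; exact h0)
    have h1 := hw hnt
    rw [weight, hgr] at h1
    simp only [hsub] at h1
    have h2 : ((∑ p ∈ Finset.range (d + 1), (p : ℤ) * ((S.filter fun a => P a = p).card : ℤ) : ℤ)
        : ℚ) / (S.card : ℚ) = d / 2 := by
      rw [← h1]; push_cast; rfl
    rw [hsum, div_eq_div_iff (by positivity) two_ne_zero] at h2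
    have h3 : (∑ a ∈ S, P a) * 2 = (d : ℤ) * S.card := by exact_mod_cast h2
    rw [Finset.sum_sub_distrib, ← Finset.mul_sum, Finset.sum_const, nsmul_eq_mul]
    linarith

/-- The total Hodge degree of the nilradical of the flag is zero. Whether a pair belongs to the
nilradical depends only on the values of `J`, and twice its degree is `(d - 2 P a) + (d - 2 P a')`;
each summand vanishes after summing over the vectors in one graded piece. -/
theorem pairSum_weight_eq_zero (h : ∀ k, k ≤ 2 * m →
      ∑ a ∈ Finset.univ.filter (fun a => J a = k), ((d : ℤ) - 2 * P a) = 0)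
    (hJ : ∀ a, J a ≤ 2 * m) :
    pairSum ε (fun a a' => if 2 * m < J a + J a' then (d : ℤ) - P a - P a' else 0) = 0 := by
  have hfib : ∀ g : ℕ → ℤ, ∑ a, g (J a) * ((d : ℤ) - 2 * P a) = 0 := by
    intro g
    rw [← Finset.sum_fiberwise_of_maps_to (t := Finset.range (2 * m + 1)) (g := J)
      (fun a _ => Finset.mem_range.2 (by have := hJ a; omega))]
    refine Finset.sum_eq_zero fun k hk => ?_
    rw [← mul_zero (g k), ← h k (by have := Finset.mem_range.1 hk; omega), Finset.mul_sum]
    refine Finset.sum_congr rfl fun a ha => ?_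
    rw [(Finset.mem_filter.1 ha).2]
  rw [pairSum]
  have h1 : ∑ a, (if 2 * m < J a + J a then (d : ℤ) - P a - P a else 0) = 0 := by
    refine Eq.trans (Finset.sum_congr rfl fun a _ => ?_)
      (hfib fun k => if 2 * m < k + k then 1 else 0)
    split_ifs <;> ring
  have h2 : ∑ a, ∑ a', (if 2 * m < J a + J a' then (d : ℤ) - 2 * P a' else 0) = 0 := by
    refine Finset.sum_eq_zero fun a _ => ?_
    refine Eq.trans (Finset.sum_congr rfl fun a' _ => ?_)
      (hfib fun k => if 2 * m < J a + k then 1 else 0)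
    split_ifs <;> ring
  have h3 : ∑ a, ∑ a', (if 2 * m < J a + J a' then (d : ℤ) - 2 * P a else 0) = 0 := by
    rw [Finset.sum_comm]
    refine Eq.trans (Finset.sum_congr rfl fun a _ => Finset.sum_congr rfl fun a' _ => ?_) h2
    rw [add_comm]
  have h4 : 2 * ∑ a, ∑ a', (if 2 * m < J a + J a' then (d : ℤ) - P a - P a' else 0) = 0 := by
    have h5 := congrArg₂ (· + ·) h3 h2
    simp only [← Finset.sum_add_distrib, add_zero] at h5
    refine Eq.trans ?_ h5
    rw [Finset.mul_sum]
    refine Finset.sum_congr rfl fun a _ => ?_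
    rw [Finset.mul_sum]
    refine Finset.sum_congr rfl fun a' _ => ?_
    split_ifs <;> ring
  rw [h1]
  omega

/-- The reflection `J ↦ 2m - J` carries the pairs with `J a + J a' > 2m` to those with `J a + J a' <
2m`: the nilradical and its opposite are disjoint and of equal size. -/
theorem two_mul_pairSum_le (hε : ε = 1 ∨ ε = -1) (σ : Fin n ≃ Fin n)
    (hσ : ∀ a, (J (σ a) : ℤ) = 2 * m - J a) :
    2 * pairSum ε (fun a a' => if 2 * m < J a + J a' then 1 else 0) ≤
      pairSum ε (fun _ _ : Fin n => 1) := by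
  have h1 := pairSum_comp (ε := ε) σ (fun a a' => if 2 * m < J a + J a' then 1 else 0)
  have h2 := pairSum_mono hε (θ := fun a a' => (if 2 * m < J a + J a' then 1 else 0) +
    (if 2 * m < J (σ a) + J (σ a') then 1 else 0)) (θ' := fun _ _ => 1) (fun a a' => by
      have := hσ a
      have := hσ a'
      split_ifs <;> omega)
  rw [pairSum_add, h1] at h2
  linarith

end FlagCombinatorics

/-! ### Inequalities for sums of the largest Hodge numbers. -/

section Numerics

open Finset

theorem sum_Icc_neg_eq {M : Type*} [AddCommMonoid M] (d : ℕ) (g : ℤ → M) :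
    ∑ p ∈ Icc (-(d : ℤ)) d, g p =
      ∑ p ∈ Icc (1 : ℤ) d, g (-p) + (g 0 + ∑ p ∈ Icc (1 : ℤ) d, g p) := by
  have h1 : Icc (-(d : ℤ)) d =
      (Icc (1 : ℤ) d).image (fun p => -p) ∪ (insert 0 (Icc (1 : ℤ) d)) := by
    ext p
    simp only [mem_Icc, mem_union, mem_image, mem_insert]
    constructor
    · intro h
      rcases lt_trichotomy p 0 with hp | hp | hp
      · exact Or.inl ⟨-p, by omega, by omega⟩
      · exact Or.inr (Or.inl hp)
      · exact Or.inr (Or.inr (by omega))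
    · rintro (⟨q, hq, rfl⟩ | rfl | hp) <;> omega
  rw [h1, sum_union, sum_image (fun a _ b _ h => neg_injective h), sum_insert]
  · simp
  · rw [disjoint_left]
    intro p hp hp'
    simp only [mem_Icc, mem_image, mem_insert] at hp hp'
    obtain ⟨q, hq, rfl⟩ := hp
    omega

/-- Abel summation: `p` counts the `k` with `1 ≤ k ≤ p`. Weighted sums can then be compared tail by
tail. -/
theorem sum_mul_eq_sum_sum (d : ℕ) (c : ℤ → ℝ) :
    ∑ p ∈ Icc (1 : ℤ) d, (p : ℝ) * c p = ∑ k ∈ Icc (1 : ℤ) d, ∑ p ∈ Icc k d, c p := by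
  have h1 : ∀ k ∈ Icc (1 : ℤ) d, ∑ p ∈ Icc k d, c p =
      ∑ p ∈ Icc (1 : ℤ) d, if k ≤ p then c p else 0 := by
    intro k hk
    rw [mem_Icc] at hk
    rw [← sum_filter]
    congr 1
    ext p
    simp only [mem_Icc, mem_filter]
    omega
  rw [sum_congr rfl h1, sum_comm]
  refine sum_congr rfl fun p hp => ?_
  rw [mem_Icc] at hp
  rw [← sum_filter, sum_const, nsmul_eq_mul]
  have h2 : ((Icc (1 : ℤ) d).filter fun k => k ≤ p) = Icc 1 p := by
    ext k
    simp only [mem_Icc, mem_filter]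
    omega
  rw [h2, Int.card_Icc]
  congr 1
  have : ((p + 1 - 1).toNat : ℤ) = p := by omega
  exact_mod_cast this.symm

/-- `topSum` dominates every sum of `x` elements of the list. -/
theorem sum_le_topSum (d : ℕ) (h : ℤ → ℕ) (c : ℤ → ℝ) (x : ℝ)
    (hc0 : ∀ p ∈ Icc (1 : ℤ) d, 0 ≤ c p) (hc : ∀ p ∈ Icc (1 : ℤ) d, c p ≤ h p)
    (hx : ∑ p ∈ Icc (1 : ℤ) d, c p ≤ x) (hx' : x ≤ h 0 + ∑ p ∈ Icc (1 : ℤ) d, (h p : ℝ)) :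
    ∑ p ∈ Icc (1 : ℤ) d, (p : ℝ) * c p ≤ topSum d h x := by
  -- The share of the value `p` among the `x` largest entries. Under `hx'` no negative entry is
  -- used.
  let t : ℤ → ℝ := fun p => max 0 (min (h p : ℝ) (x - ∑ q ∈ Ioc p (d : ℤ), (h q : ℝ)))
  have hx0 : 0 ≤ x := (sum_nonneg hc0).trans hx
  have htop : topSum d h x = ∑ p ∈ Icc (1 : ℤ) d, (p : ℝ) * t p := by
    rw [topSum, sum_Icc_neg_eq]
    have h1 : ∑ p ∈ Icc (1 : ℤ) d, ((-p : ℤ) : ℝ) * t (-p) = 0 := by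
      refine sum_eq_zero fun p hp => ?_
      rw [mem_Icc] at hp
      have h2 : (h 0 : ℝ) + ∑ q ∈ Icc (1 : ℤ) d, (h q : ℝ) ≤ ∑ q ∈ Ioc (-p) (d : ℤ), (h q : ℝ) := by
        rw [← sum_insert (f := fun q => (h q : ℝ)) (by simp)]
        refine sum_le_sum_of_subset_of_nonneg (fun q hq => ?_) fun q _ _ => by positivity
        simp only [mem_insert, mem_Icc, mem_Ioc] at hq ⊢
        omega
      have h3 : t (-p) = 0 := by
        apply max_eq_left
        exact (min_le_right _ _).trans (by linarith)
      rw [h3, mul_zero]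
    rw [h1]
    simp [t]
  rw [htop, sum_mul_eq_sum_sum, sum_mul_eq_sum_sum]
  -- Filling greedily from the top gives each tail of `t` the largest mass permitted by both `x` and
  -- `h`, so it dominates the corresponding tail of `c`.
  have htail : ∀ j : ℕ, j ≤ d → ∑ p ∈ Icc ((d : ℤ) + 1 - j) d, t p =
      min x (∑ p ∈ Icc ((d : ℤ) + 1 - j) d, (h p : ℝ)) := by
    intro j
    induction j with
    | zero => intro _; simp [hx0]
    | succ j ih =>
      intro hj
      have ih' := ih (by omega)
      have h1 : Icc ((d : ℤ) + 1 - (j + 1 : ℕ)) d =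
          insert ((d : ℤ) - j) (Icc ((d : ℤ) + 1 - j) d) := by
        ext p
        simp only [mem_Icc, mem_insert]
        push_cast
        omega
      have h2 : (d : ℤ) - j ∉ Icc ((d : ℤ) + 1 - j) d := by
        simp only [mem_Icc]
        omega
      have h3 : Ioc ((d : ℤ) - j) d = Icc ((d : ℤ) + 1 - j) d := by
        ext p
        simp only [mem_Icc, mem_Ioc]
        omega
      rw [h1, sum_insert h2, sum_insert h2, ih']
      simp only [t, h3]
      generalize ∑ p ∈ Icc ((d : ℤ) + 1 - j) d, (h p : ℝ) = H
      have hh : (0 : ℝ) ≤ h ((d : ℤ) - j) := by positivity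
      generalize (h ((d : ℤ) - j) : ℝ) = g at hh
      rcases le_total x H with h4 | h4
      · have h5 : min g (x - H) ≤ 0 := (min_le_right _ _).trans (by linarith)
        rw [min_eq_left h4, max_eq_left h5, zero_add, min_eq_left (by linarith)]
      · rw [min_eq_right h4]
        rcases le_total g (x - H) with h5 | h5
        · rw [min_eq_left h5, max_eq_right hh, min_eq_right (by linarith)]
        · rw [min_eq_right h5, max_eq_right (by linarith), min_eq_left (by linarith)]
          ring
  refine sum_le_sum fun k hk => ?_
  rw [mem_Icc] at hk
  have hk' : (d : ℤ) + 1 - ((d + 1 - k).toNat : ℕ) = k := by omega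
  have := htail (d + 1 - k).toNat (by omega)
  rw [hk'] at this
  rw [this]
  have hsub : ∀ p ∈ Icc k (d : ℤ), p ∈ Icc (1 : ℤ) d := fun p hp => by
    simp only [mem_Icc] at hp ⊢
    omega
  refine le_min ?_ (sum_le_sum fun p hp => hc p (hsub p hp))
  exact (sum_le_sum_of_subset_of_nonneg hsub fun p hp _ => hc0 p hp).trans hx

/-- The inequality behind the codimension bound: `ν` counts the Hodge numbers of a subalgebra of
degree zero and of at most half the dimension. -/
theorem sum_neg_add_le (d : ℕ) (h : ℤ → ℕ) (ν : ℤ → ℝ) (z e : ℕ) (hsym : ∀ p, h (-p) = h p)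
    (hν0 : ∀ p, 0 ≤ ν p) (hν : ∀ p, ν p ≤ h p)
    (hbal : ∑ p ∈ Icc (-(d : ℤ)) d, (p : ℝ) * ν p = 0)
    (hhalf : 2 * ∑ p ∈ Icc (-(d : ℤ)) d, ν p ≤ ∑ p ∈ Icc (-(d : ℤ)) d, (h p : ℝ))
    (hnum : z + e ≤ ∑ p ∈ Icc (1 : ℤ) d, h p)
    (hsum : topSum d h ((z : ℝ) + e) + topSum d h ((h 0 : ℝ) / 2 + z + e) <
      ∑ p ∈ Icc (1 : ℤ) d, (p : ℝ) * (h p : ℝ)) :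
    ∑ p ∈ Icc (1 : ℤ) d, ν (-p) + z + e ≤ ∑ p ∈ Icc (1 : ℤ) d, (h p : ℝ) := by
  by_contra! hcon
  have hnum' : (z : ℝ) + e ≤ ∑ p ∈ Icc (1 : ℤ) d, (h p : ℝ) := by exact_mod_cast hnum
  have hh0 : (0 : ℝ) ≤ h 0 := by positivity
  -- If the claim fails, the negative degrees that `ν` misses have total multiplicity below `z + e`.
  have h1 := sum_le_topSum d h (fun p => h p - ν (-p)) (z + e)
    (fun p _ => by have := hν (-p); rw [hsym] at this; linarith)
    (fun p _ => by have := hν0 (-p); linarith)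
    (by rw [sum_sub_distrib]; linarith) (by linarith)
  rw [sum_Icc_neg_eq, sum_Icc_neg_eq] at hhalf
  simp only [hsym] at hhalf
  have hν00 := hν0 0
  -- Half of the total is `h 0 / 2` plus the positive multiplicities; once the negative part of `ν`
  -- is removed, less than `h 0 / 2 + z + e` remains for its positive part. The balance `hbal` then
  -- adds the two estimates to a contradiction with `hsum`.
  have h2 := sum_le_topSum d h ν ((h 0 : ℝ) / 2 + z + e) (fun p _ => hν0 p) (fun p _ => hν p)
    (by linarith) (by linarith)
  rw [sum_Icc_neg_eq] at hbal
  simp only [Int.cast_neg, Int.cast_zero, zero_mul, zero_add, neg_mul, sum_neg_distrib] at hbal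
  simp only [mul_sub, sum_sub_distrib] at h1
  linarith

end Numerics

open Finset in
theorem sum_ite_eq_Icc (x l u : ℤ) (y : ℤ → ℤ) :
    ∑ p ∈ Icc l u, (if x = p then y p else 0) = if l ≤ x ∧ x ≤ u then y x else 0 := by
  rw [Finset.sum_ite_eq]
  simp only [mem_Icc]

/-! ### The numerical criterion for a balanced flag. -/

section Numerics

variable {K : Type*} [Field K] {V : Type*} [AddCommGroup V] [Module K V]
variable {B : LinearMap.BilinForm K V} {ε : ℤ} {d : ℕ} {F F' : ℤ → Submodule K V}

/-- The adjoint Hodge numbers depend only on the dimensions of the filtration. -/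
theorem hodge_congr [CharZero K] [FiniteDimensional K V] [Nontrivial V]
    (hnd : B.Nondegenerate) (hε : ε = 1 ∨ ε = -1) (hB : ∀ v w, B w v = (ε : K) * B v w)
    (hF : IsSelfDualFiltration B d F) (hF' : IsSelfDualFiltration B d F')
    (hdim : ∀ p, Module.finrank K (F p) = Module.finrank K (F' p)) :
    hodge B F = hodge B F' := by
  -- The trivial flag, so that the existence theorem for two filtrations gives a basis adapted to
  -- one.
  let f : ℕ → Submodule K V := fun i => if i = 0 then ⊥ else ⊤
  have hf : Monotone f := by
    intro i j hij
    simp only [f]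
    split_ifs with h1 h2 <;> first | exact le_rfl | exact bot_le | skip
    omega
  obtain ⟨b, P, -, hP, -⟩ := exists_adapted_basis d 1 F hF.antitone (hF.eq_top 0 le_rfl) hF.eq_bot
    f hf rfl rfl
  obtain ⟨b', P', -, hP', -⟩ := exists_adapted_basis d 1 F' hF'.antitone (hF'.eq_top 0 le_rfl)
    hF'.eq_bot f hf rfl rfl
  obtain ⟨σ, hσ⟩ := exists_perm_of_card_eq P P' fun k => by
    have h1 := card_filter_lt_add P k
    have h2 := card_filter_lt_add P' k
    have h3 := hdim k
    rw [hP.finrank_eq, hP'.finrank_eq] at h3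
    omega
  funext p
  have h1 := two_mul_hodge hnd hε hB hF hP p
  have h2 := two_mul_hodge hnd hε hB hF' hP' p
  have h3 := pairSum_comp (ε := ε) σ (fun a a' => if (d : ℤ) - P' a - P' a' = p then 1 else 0)
  simp only [hσ] at h3
  rw [h3] at h1
  omega

variable {n m : ℕ} {b : Module.Basis (Fin n) K V} {P : Fin n → ℤ} {J : Fin n → ℕ}
  {f : ℕ → Submodule K V}

/-- The numerical criterion bounds the part of negative weight in the unipotent radical attached to
a flag with balanced graded pieces. -/
theorem pairSum_neg_add_le [CharZero K] [FiniteDimensional K V] [Nontrivial V]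
    (hnd : B.Nondegenerate) (hε : ε = 1 ∨ ε = -1) (hB : ∀ v w, B w v = (ε : K) * B v w)
    (hF : IsSelfDualFiltration B d F) (hf : IsSelfDualFlag B m f)
    (hP : IsAdapted b F (fun p a => p ≤ P a)) (hJ : IsAdapted b f (fun j a => J a < j))
    (hw : ∀ k, k ≤ 2 * m → Nontrivial (Gr f k) → weight d (inducedFil F f k) = (d : ℚ) / 2)
    (z e : ℕ)
    (hnum : z + e ≤ ∑ p ∈ Finset.Icc (1 : ℤ) d, hodge B F p)
    (hsum : topSum d (hodge B F) ((z : ℝ) + e) +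
        topSum d (hodge B F) ((hodge B F 0 : ℝ) / 2 + z + e) <
      ∑ p ∈ Finset.Icc (1 : ℤ) d, (p : ℝ) * (hodge B F p : ℝ)) :
    pairSum ε (fun a a' => if 2 * m < J a + J a' ∧ d < P a + P a' then 1 else 0) +
      2 * z + 2 * e ≤ pairSum ε (fun a a' => if d < P a + P a' then 1 else 0) := by
  have hb := hF.adapted_bounds hP
  have hh := two_mul_hodge hnd hε hB hF hP
  obtain ⟨σ, hσ⟩ := exists_perm_filtration hnd hF hP
  obtain ⟨τ, hτ⟩ := exists_perm_flag hnd hf hJ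
  -- Twice the degree `p` multiplicity of the nilradical, as `pairSum` counts each unordered pair
  -- twice; it is halved when `sum_neg_add_le` is applied.
  let N : ℤ → ℤ := fun p => pairSum ε
    (fun a a' => if (d : ℤ) - P a - P a' = p then (if 2 * m < J a + J a' then 1 else 0) else 0)
  have hN0 : ∀ p, 0 ≤ N p := fun p => pairSum_nonneg hε _ fun a a' => by split_ifs <;> simp
  have hNh : ∀ p, N p ≤ 2 * (hodge B F p : ℤ) := fun p => by
    rw [hh]
    have := pairSum_mono hε (θ := fun a a' => if (d : ℤ) - P a - P a' = p then
      (if 2 * m < J a + J a' then 1 else 0) else 0)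
      (θ' := fun a a' => if (d : ℤ) - P a - P a' = p then 1 else 0)
      fun a a' => by split_ifs <;> simp
    have h2 : (0 : ℤ) ≤ if p = 0 then 2 else 0 := by split_ifs <;> simp
    simp only [N]
    omega
  have hsym : ∀ p, hodge B F (-p) = hodge B F p := fun p => by
    have h1 := hh p
    have h2 := hh (-p)
    have h3 := pairSum_comp (ε := ε) σ (fun a a' => if (d : ℤ) - P a - P a' = p then 1 else 0)
    simp only [hσ] at h3
    have h4 : (fun a a' => if (d : ℤ) - (d - P a) - (d - P a') = p then (1 : ℤ) else 0) =
        fun a a' => if (d : ℤ) - P a - P a' = -p then 1 else 0 := by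
      funext a a'
      congr 1
      exact propext ⟨fun h => by omega, fun h => by omega⟩
    rw [h4] at h3
    rw [h3] at h2
    have h5 : (-p = 0) = (p = 0) := propext neg_eq_zero
    simp only [h5] at h2
    omega
  have hbal : ∑ p ∈ Finset.Icc (-(d : ℤ)) d, p * N p = 0 := by
    rw [← pairSum_weight_eq_zero (ε := ε)
      (fun k hk => sum_weight_eq_zero hF hf hP hJ k (hw k hk)) (hf.adapted_le hJ)]
    simp only [N, ← pairSum_mul, ← pairSum_sum, mul_ite, mul_zero]
    congr 1
    funext a a'
    rw [sum_ite_eq_Icc]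
    have := hb a
    have := hb a'
    rw [if_pos (by omega), mul_one]
  have hhalf : 2 * ∑ p ∈ Finset.Icc (-(d : ℤ)) d, N p ≤
      ∑ p ∈ Finset.Icc (-(d : ℤ)) d, 2 * (hodge B F p : ℤ) := by
    have h1 := two_mul_pairSum_le (n := n) (J := J) hε τ hτ
    have h2 : ∑ p ∈ Finset.Icc (-(d : ℤ)) d, N p =
        pairSum ε (fun a a' => if 2 * m < J a + J a' then 1 else 0) := by
      simp only [N, ← pairSum_sum]
      congr 1
      funext a a'
      rw [sum_ite_eq_Icc]
      have := hb a
      have := hb a'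
      rw [if_pos (by omega)]
    have h3 : ∑ p ∈ Finset.Icc (-(d : ℤ)) d,
        pairSum ε (fun a a' => if (d : ℤ) - P a - P a' = p then 1 else 0) =
        pairSum ε (fun _ _ : Fin n => 1) := by
      simp only [← pairSum_sum]
      congr 1
      funext a a'
      rw [sum_ite_eq_Icc]
      have := hb a
      have := hb a'
      rw [if_pos (by omega)]
    rw [h2]
    refine h1.trans ?_
    rw [← h3]
    refine Finset.sum_le_sum fun p _ => ?_
    rw [hh]
    split_ifs <;> omega
  have hneg : ∑ p ∈ Finset.Icc (1 : ℤ) d, N (-p) =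
      pairSum ε (fun a a' => if 2 * m < J a + J a' ∧ d < P a + P a' then 1 else 0) := by
    simp only [N, ← pairSum_sum]
    congr 1
    funext a a'
    have h1 : ∀ p, ((d : ℤ) - P a - P a' = -p) = (P a + P a' - d = p) := fun p =>
      propext ⟨fun h => by omega, fun h => by omega⟩
    simp only [h1]
    rw [sum_ite_eq_Icc]
    have := hb a
    have := hb a'
    split_ifs <;> omega
  have hpos : ∑ p ∈ Finset.Icc (1 : ℤ) d, 2 * (hodge B F p : ℤ) =
      pairSum ε (fun a a' => if d < P a + P a' then 1 else 0) := by
    have h0 : ∑ p ∈ Finset.Icc (1 : ℤ) d, 2 * (hodge B F p : ℤ) = ∑ p ∈ Finset.Icc (1 : ℤ) d,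
        pairSum ε (fun a a' => if (d : ℤ) - P a - P a' = -p then 1 else 0) := by
      refine Finset.sum_congr rfl fun p hp => ?_
      rw [← hsym, hh, if_neg (by rw [Finset.mem_Icc] at hp; omega), add_zero]
    rw [h0]
    simp only [← pairSum_sum]
    congr 1
    funext a a'
    have h1 : ∀ p, ((d : ℤ) - P a - P a' = -p) = (P a + P a' - d = p) := fun p =>
      propext ⟨fun h => by omega, fun h => by omega⟩
    simp only [h1]
    rw [sum_ite_eq_Icc]
    have := hb a
    have := hb a'
    split_ifs <;> omega
  have key := sum_neg_add_le d (hodge B F) (fun p => (N p : ℝ) / 2) z e hsym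
    (fun p => by have : (0 : ℝ) ≤ N p := by exact_mod_cast hN0 p
                 positivity)
    (fun p => by
      have : (N p : ℝ) ≤ 2 * (hodge B F p : ℝ) := by exact_mod_cast hNh p
      linarith)
    (by
      have h1 : ((∑ p ∈ Finset.Icc (-(d : ℤ)) d, p * N p : ℤ) : ℝ) = 0 := by exact_mod_cast hbal
      push_cast at h1
      simp only [← mul_div_assoc, ← Finset.sum_div, h1, zero_div])
    (by
      have h1 : ((2 * ∑ p ∈ Finset.Icc (-(d : ℤ)) d, N p : ℤ) : ℝ) ≤
        ((∑ p ∈ Finset.Icc (-(d : ℤ)) d, 2 * (hodge B F p : ℤ) : ℤ) : ℝ) := by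
          exact_mod_cast hhalf
      push_cast at h1
      rw [← Finset.mul_sum] at h1
      rw [← Finset.sum_div]
      linarith)
    hnum hsum
  have h1 : (((∑ p ∈ Finset.Icc (1 : ℤ) d, N (-p)) + 2 * z + 2 * e : ℤ) : ℝ) ≤
      ((∑ p ∈ Finset.Icc (1 : ℤ) d, 2 * (hodge B F p : ℤ) : ℤ) : ℝ) := by
    push_cast
    rw [← Finset.mul_sum]
    rw [← Finset.sum_div] at key
    linarith
  rw [hneg, hpos] at h1
  exact_mod_cast h1

end Numerics

/-! ### Lifting isomorphisms of graded pieces to an isometry. -/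

section Lift

variable {K : Type*} [Field K] {V : Type*} [AddCommGroup V] [Module K V]
variable {B : LinearMap.BilinForm K V} {ε : ℤ} {d m : ℕ} {F F' : ℤ → Submodule K V}
  {f f' : ℕ → Submodule K V}

theorem IsSelfDualFiltration.mem_iff_left (hε : ε = 1 ∨ ε = -1)
    (hB : ∀ v w, B w v = (ε : K) * B v w) (hF : IsSelfDualFiltration B d F) (p : ℤ) (x : V) :
    x ∈ F p ↔ ∀ w ∈ F (d + 1 - p), B x w = 0 := by
  rw [hF.mem_iff]
  exact forall₂_congr fun w _ => eq_zero_comm hε hB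

theorem IsSelfDualFlag.mem_iff (hf : IsSelfDualFlag B m f) {i : ℕ} (hi : i ≤ 2 * m + 1) (x : V) :
    x ∈ f i ↔ ∀ w ∈ f (2 * m + 1 - i), B w x = 0 := by
  have := hf.self_dual (2 * m + 1 - i) (Nat.sub_le _ _)
  rw [Nat.sub_sub_self hi] at this
  rw [this]
  rfl

theorem IsSelfDualFlag.mem_iff_left (hε : ε = 1 ∨ ε = -1)
    (hB : ∀ v w, B w v = (ε : K) * B v w) (hf : IsSelfDualFlag B m f) {i : ℕ}
    (hi : i ≤ 2 * m + 1) (x : V) :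
    x ∈ f i ↔ ∀ w ∈ f (2 * m + 1 - i), B x w = 0 := by
  rw [hf.mem_iff hi]
  exact forall₂_congr fun w _ => eq_zero_comm hε hB

theorem IsAdapted.apply_mem {ι κ V' : Type*} [AddCommGroup V'] [Module K V']
    {b : Module.Basis ι K V} {G : κ → Submodule K V} {S : κ → ι → Prop} (h : IsAdapted b G S)
    {i : κ} {N : Submodule K V'} (g : V →ₗ[K] V') (hg : ∀ a, S i a → g (b a) ∈ N) {x : V}
    (hx : x ∈ G i) : g x ∈ N := by
  have : G i ≤ N.comap g := by
    rw [h i, Submodule.span_le]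
    rintro _ ⟨a, ha, rfl⟩
    exact hg a ha
  exact this hx

theorem toGr_eq_zero {j : ℕ} {x : V} (hx : x ∈ f (j + 1)) :
    toGr f j ⟨x, hx⟩ = 0 ↔ x ∈ f j := by
  rw [Submodule.mkQ_apply, Submodule.Quotient.mk_eq_zero]
  rfl

theorem mem_inducedFil {j : ℕ} {p : ℤ} {y : Gr f j} :
    y ∈ inducedFil F f j p ↔ ∃ x ∈ F p, ∃ hx : x ∈ f (j + 1), toGr f j ⟨x, hx⟩ = y := by
  constructor
  · rintro ⟨⟨x, hx⟩, h1, h2⟩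
    exact ⟨x, h1, hx, h2⟩
  · rintro ⟨x, h1, hx, h2⟩
    exact ⟨⟨x, hx⟩, h1, h2⟩

/-- `h` lifts the isomorphisms `θ` of graded pieces and respects the filtrations. -/
structure IsGrLift (F F' : ℤ → Submodule K V) (f f' : ℕ → Submodule K V)
    (θ : ∀ j : Fin (m + 1), Gr f (j : ℕ) ≃ₗ[K] Gr f' (j : ℕ)) (h : V →ₗ[K] V) : Prop where
  fil : ∀ p, ∀ x ∈ F p, h x ∈ F' p
  flag : ∀ j : Fin (m + 1), ∀ x (hx : x ∈ f ((j : ℕ) + 1)),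
    ∃ hx' : h x ∈ f' ((j : ℕ) + 1), toGr f' j ⟨h x, hx'⟩ = θ j (toGr f j ⟨x, hx⟩)

/-- For an adapted basis vector with `J a ≤ m`, compatibility of `θ` with the induced filtrations
gives a lift of the image of its class inside `F' (P a) ⊓ f' (J a + 1)`. The other basis vectors are
free at this stage and go to zero. -/
theorem exists_isGrLift [FiniteDimensional K V] (hF : IsSelfDualFiltration B d F)
    (hF' : Antitone F')
    (hf : IsSelfDualFlag B m f) (hf' : IsSelfDualFlag B m f')
    (θ : ∀ j : Fin (m + 1), Gr f (j : ℕ) ≃ₗ[K] Gr f' (j : ℕ))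
    (hθ : ∀ (j : Fin (m + 1)) p, (inducedFil F f (j : ℕ) p).map (θ j : Gr f (j : ℕ) →ₗ[K] Gr f' (j : ℕ)) =
      inducedFil F' f' (j : ℕ) p) : ∃ h, IsGrLift F F' f f' θ h := by
  obtain ⟨b, P, J, hP, hJ⟩ := exists_adapted_basis d (2 * m + 1) F hF.antitone
    (hF.eq_top 0 le_rfl) hF.eq_bot f hf.monotone hf.eq_bot hf.eq_top
  have key : ∀ a, ∃ c ∈ F' (P a), ∀ ha : J a < m + 1, ∃ hc : c ∈ f' (J a + 1),
      toGr f' (J a) ⟨c, hc⟩ =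
        θ ⟨J a, ha⟩ (toGr f (J a) ⟨b a, (hJ.basis_mem_iff _ _).2 (Nat.lt_succ_self _)⟩) := by
    intro a
    by_cases ha : J a < m + 1
    · have h1 : θ ⟨J a, ha⟩ (toGr f (J a) ⟨b a, (hJ.basis_mem_iff _ _).2 (Nat.lt_succ_self _)⟩) ∈
          inducedFil F' f' (J a) (P a) := by
        have := hθ ⟨J a, ha⟩ (P a)
        simp only at this
        rw [← this]
        refine Submodule.mem_map_of_mem ?_
        exact Submodule.mem_map_of_mem (show b a ∈ F (P a) from (hP.basis_mem_iff _ _).2 le_rfl)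
      obtain ⟨⟨c, hc⟩, hc1, hc2⟩ := h1
      exact ⟨c, hc1, fun _ => ⟨hc, hc2⟩⟩
    · exact ⟨0, zero_mem _, fun h => absurd h ha⟩
  choose c hc1 hc2 using key
  refine ⟨b.constr K c, ⟨fun p x hx => ?_, fun j x hx => ?_⟩⟩
  · refine hP.apply_mem _ (fun a ha => ?_) hx
    rw [Module.Basis.constr_basis]
    exact hF' ha (hc1 a)
  · have hind : ∀ a, J a < j + 1 → ∀ hb : b a ∈ f ((j : ℕ) + 1),
        ∃ hx' : b.constr K c (b a) ∈ f' ((j : ℕ) + 1),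
        toGr f' j ⟨b.constr K c (b a), hx'⟩ = θ j (toGr f j ⟨b a, hb⟩) := by
      intro a ha hb
      simp only [Module.Basis.constr_basis]
      obtain ⟨h1, h2⟩ := hc2 a (by omega)
      rcases Nat.lt_succ_iff_lt_or_eq.1 ha with h3 | h3
      · have h4 : c a ∈ f' j := hf'.monotone (show J a + 1 ≤ (j : ℕ) by omega) h1
        have h5 : b a ∈ f j := (hJ.basis_mem_iff _ _).2 h3
        refine ⟨hf'.monotone (Nat.le_succ _) h4, ?_⟩
        rw [(toGr_eq_zero _).2 h4, (toGr_eq_zero _).2 h5, map_zero]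
      · obtain ⟨j, hj⟩ := j
        simp only at h3 ⊢
        subst h3
        exact ⟨h1, h2⟩
    let L : V →ₗ[K] V := b.constr K c
    have hmem : ∀ x ∈ f ((j : ℕ) + 1), L x ∈ f' ((j : ℕ) + 1) := fun x hx =>
      hJ.apply_mem L (fun a ha => (hind a ha ((hJ.basis_mem_iff _ _).2 ha)).1) hx
    refine ⟨hmem x hx, ?_⟩
    let E := LinearMap.eqLocus ((toGr f' j).comp (L.restrict hmem))
      ((θ j : Gr f (j : ℕ) →ₗ[K] Gr f' (j : ℕ)).comp (toGr f j))
    have hE : f ((j : ℕ) + 1) ≤ E.map (f ((j : ℕ) + 1)).subtype := by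
      conv_lhs => rw [hJ (j + 1)]
      rw [Submodule.span_le]
      rintro _ ⟨a, ha, rfl⟩
      exact ⟨⟨b a, (hJ.basis_mem_iff _ _).2 ha⟩, (hind a ha ((hJ.basis_mem_iff _ _).2 ha)).2, rfl⟩
    obtain ⟨⟨y, hy⟩, hy1, rfl⟩ := hE hx
    exact hy1

namespace IsGrLift

variable {θ : ∀ j : Fin (m + 1), Gr f (j : ℕ) ≃ₗ[K] Gr f' (j : ℕ)} {h : V →ₗ[K] V}

/-- Climb the flag: `θ j` matches the induced filtrations exactly, so `x` agrees modulo `f j` with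
some `y ∈ F p`, and `x - y` falls under the induction hypothesis. -/
theorem strict (hh : IsGrLift F F' f f' θ h) (hf : IsSelfDualFlag B m f)
    (hθ : ∀ (j : Fin (m + 1)) p,
      (inducedFil F f (j : ℕ) p).map (θ j : Gr f (j : ℕ) →ₗ[K] Gr f' (j : ℕ)) =
        inducedFil F' f' (j : ℕ) p) (p : ℤ) (j : ℕ) :
    j ≤ m + 1 → ∀ x ∈ f j, h x ∈ F' p → x ∈ F p := by
  induction j with
  | zero =>
    intro _ x hx _
    rw [hf.eq_bot, Submodule.mem_bot] at hx
    rw [hx]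
    exact zero_mem _
  | succ j ih =>
    intro hj x hx hxp
    obtain ⟨h1, h2⟩ := hh.flag ⟨j, hj⟩ x hx
    have h3 : θ ⟨j, hj⟩ (toGr f j ⟨x, hx⟩) ∈ inducedFil F' f' j p :=
      mem_inducedFil.2 ⟨h x, hxp, h1, h2⟩
    have h4 : toGr f j ⟨x, hx⟩ ∈ inducedFil F f j p := by
      have h5 := hθ ⟨j, hj⟩ p
      simp only at h5
      rw [← h5] at h3
      obtain ⟨y, hy, hy'⟩ := h3
      rwa [← (θ ⟨j, hj⟩).injective hy']
    obtain ⟨y, hy, hyf, hyx⟩ := mem_inducedFil.1 h4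
    have h6 : x - y ∈ f j := by
      rw [← toGr_eq_zero (sub_mem hx hyf), ← sub_eq_zero.2 hyx.symm, ← map_sub]
      rfl
    have h7 := ih (by omega) (x - y) h6 (by rw [map_sub]; exact sub_mem hxp (hh.fil p y hy))
    simpa using add_mem h7 hy

theorem surj (hh : IsGrLift F F' f f' θ h) (hf' : IsSelfDualFlag B m f')
    (hf : Monotone f) (j : ℕ) : j ≤ m + 1 → ∀ y ∈ f' j, ∃ x ∈ f j, h x = y := by
  induction j with
  | zero =>
    intro _ y hy
    rw [hf'.eq_bot, Submodule.mem_bot] at hy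
    exact ⟨0, zero_mem _, by rw [hy, map_zero]⟩
  | succ j ih =>
    intro hj y hy
    obtain ⟨⟨x, hx⟩, hx'⟩ := Submodule.mkQ_surjective _ ((θ ⟨j, hj⟩).symm (toGr f' j ⟨y, hy⟩))
    obtain ⟨h1, h2⟩ := hh.flag ⟨j, hj⟩ x hx
    have h3 : y - h x ∈ f' j := by
      rw [← toGr_eq_zero (sub_mem hy h1)]
      have : toGr f' j ⟨h x, h1⟩ = toGr f' j ⟨y, hy⟩ := by
        rw [h2]
        exact (LinearEquiv.eq_symm_apply _).1 hx'
      rw [← sub_eq_zero.2 this.symm, ← map_sub]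
      rfl
    obtain ⟨r, hr, hr'⟩ := ih (by omega) _ h3
    exact ⟨r + x, add_mem (hf (Nat.le_succ j) hr) hx, by rw [map_add, hr']; abel⟩

end IsGrLift

/-- Let `w ∈ W` have image under `h` in `F' (d + 1 - p)`. Strictness puts `w` in `F (d + 1 - p)`,
which is orthogonal to `v`, so the functional `B v` on `W` factors through `V ⧸ F' (d + 1 - p)`.
Extended to that quotient, it is represented by a vector in the orthogonal of `F' (d + 1 - p)`,
which is `F' p`. -/
theorem exists_extend_pairing [FiniteDimensional K V] (hnd : B.Nondegenerate)
    (hε : ε = 1 ∨ ε = -1) (hB : ∀ v w, B w v = (ε : K) * B v w)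
    (hF : IsSelfDualFiltration B d F) (hF' : IsSelfDualFiltration B d F') (W : Submodule K V)
    (h : V →ₗ[K] V) (hW : ∀ p, ∀ x ∈ W, h x ∈ F' p → x ∈ F p) {p : ℤ} {v : V} (hv : v ∈ F p) :
    ∃ c ∈ F' p, ∀ w ∈ W, B c (h w) = B v w := by
  let L : W →ₗ[K] V ⧸ F' (d + 1 - p) := (F' (d + 1 - p)).mkQ ∘ₗ h ∘ₗ W.subtype
  have hmem : (B v).domRestrict W ∈ LinearMap.range L.dualMap := by
    rw [LinearMap.range_dualMap_eq_dualAnnihilator_ker, Submodule.mem_dualAnnihilator]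
    intro w hw
    have h1 : h w ∈ F' (d + 1 - p) := by
      rw [LinearMap.mem_ker] at hw
      exact (Submodule.Quotient.mk_eq_zero _).1 hw
    exact (hF.mem_iff_left hε hB p v).1 hv w (hW _ w w.2 h1)
  obtain ⟨μ, hμ⟩ := hmem
  have hc : ∀ x, B ((B.toDual hnd).symm (μ ∘ₗ (F' (d + 1 - p)).mkQ)) x =
      μ ((F' (d + 1 - p)).mkQ x) := fun x => by
    rw [LinearMap.BilinForm.apply_toDual_symm_apply]
    rfl
  refine ⟨(B.toDual hnd).symm (μ ∘ₗ (F' (d + 1 - p)).mkQ), ?_, fun w hw => ?_⟩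
  · rw [hF'.mem_iff_left hε hB]
    intro w hw
    rw [hc, Submodule.mkQ_apply, (Submodule.Quotient.mk_eq_zero _).2 hw, map_zero]
  · rw [hc]
    exact LinearMap.congr_fun hμ ⟨w, hw⟩

/-- An isometric correction of a lift of isomorphisms of graded pieces. -/
theorem exists_isometry_lift [CharZero K] [FiniteDimensional K V] (hnd : B.Nondegenerate)
    (hε : ε = 1 ∨ ε = -1) (hB : ∀ v w, B w v = (ε : K) * B v w)
    (hF : IsSelfDualFiltration B d F) (hF' : IsSelfDualFiltration B d F')
    (hdim : ∀ p, Module.finrank K (F p) = Module.finrank K (F' p))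
    (hf : IsSelfDualFlag B m f) (hf' : IsSelfDualFlag B m f')
    (θ : ∀ j : Fin (m + 1), Gr f (j : ℕ) ≃ₗ[K] Gr f' (j : ℕ))
    (hθ : ∀ (j : Fin (m + 1)) p,
      (inducedFil F f (j : ℕ) p).map (θ j : Gr f (j : ℕ) →ₗ[K] Gr f' (j : ℕ)) =
        inducedFil F' f' (j : ℕ) p)
    (hθB : ∀ (x y : f (m + 1)) (x' y' : f' (m + 1)),
      θ (Fin.last m) (toGr f m x) = toGr f' m x' → θ (Fin.last m) (toGr f m y) = toGr f' m y' →
        B (x' : V) (y' : V) = B (x : V) (y : V)) :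
    ∃ g : V ≃ₗ[K] V, (∀ v w, B (g v) (g w) = B v w) ∧
      (∀ p, (F p).map (g : V →ₗ[K] V) = F' p) ∧
      (∀ i, i ≤ 2 * m + 1 → (f i).map (g : V →ₗ[K] V) = f' i) ∧
      IsGrLift F F' f f' θ (g : V →ₗ[K] V) := by
  obtain ⟨h, hh⟩ := exists_isGrLift hF hF'.antitone hf hf' θ hθ
  have hstrict : ∀ p, ∀ x ∈ f (m + 1), h x ∈ F' p → x ∈ F p := fun p =>
    hh.strict hf hθ p (m + 1) le_rfl
  have hiso : ∀ x ∈ f (m + 1), ∀ y ∈ f (m + 1), B (h x) (h y) = B x y := by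
    intro x hx y hy
    obtain ⟨h1, h2⟩ := hh.flag (Fin.last m) x hx
    obtain ⟨h3, h4⟩ := hh.flag (Fin.last m) y hy
    exact hθB ⟨x, hx⟩ ⟨y, hy⟩ ⟨h x, h1⟩ ⟨h y, h3⟩ h2.symm h4.symm
  obtain ⟨b, P, J, hP, hJ⟩ := exists_adapted_basis d (2 * m + 1) F hF.antitone
    (hF.eq_top 0 le_rfl) hF.eq_bot f hf.monotone hf.eq_bot hf.eq_top
  -- Keep `h` on `f (m + 1)` and choose the other images with the right pairings against `h (f (m +
  -- 1))`; only pairings outside `f (m + 1)` can still be wrong.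
  have hc : ∀ a, ∃ c ∈ F' (P a), (J a < m + 1 → c = h (b a)) ∧
      ∀ w ∈ f (m + 1), B c (h w) = B (b a) w := by
    intro a
    have ha : b a ∈ F (P a) := (hP.basis_mem_iff _ _).2 le_rfl
    by_cases hJa : J a < m + 1
    · exact ⟨h (b a), hh.fil _ _ ha, fun _ => rfl,
        fun w hw => hiso _ ((hJ.basis_mem_iff _ _).2 hJa) w hw⟩
    · obtain ⟨c, hc, hc'⟩ := exists_extend_pairing hnd hε hB hF hF' (f (m + 1)) h hstrict ha
      exact ⟨c, hc, fun h => absurd h hJa, hc'⟩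
  choose c hcF hch hcB using hc
  let g₀ : V →ₗ[K] V := b.constr K c
  have hg₀ : ∀ x ∈ f (m + 1), g₀ x = h x := by
    intro x hx
    have : (g₀ - h) x ∈ (⊥ : Submodule K V) := hJ.apply_mem (g₀ - h) (fun a ha => by
      rw [LinearMap.sub_apply, Module.Basis.constr_basis, hch a ha, sub_self]
      exact zero_mem _) hx
    exact sub_eq_zero.1 this
  have hg₀F : ∀ p, ∀ x ∈ F p, g₀ x ∈ F' p := fun p x hx =>
    hP.apply_mem g₀ (fun a ha => by
      rw [Module.Basis.constr_basis]
      exact hF'.antitone ha (hcF a)) hx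
  have hg₀B : ∀ x, ∀ y ∈ f (m + 1), B (g₀ x) (g₀ y) = B x y := by
    intro x y hy
    rw [hg₀ y hy]
    have : (B.flip (h y)) ∘ₗ g₀ = B.flip y := b.ext fun a => by
      simp only [LinearMap.comp_apply]
      rw [Module.Basis.constr_basis]
      exact hcB a y hy
    exact LinearMap.congr_fun this x
  -- `N` measures the failure of `g₀` to be an isometry. It is self-adjoint, preserves `F`, kills `f
  -- (m + 1)` and has image in `f m`, the orthogonal of `f (m + 1)`, so `N ∘ N = 0`.
  let N : V →ₗ[K] V := (B.toDual hnd).symm.toLinearMap ∘ₗ (B.compl₁₂ g₀ g₀ - B)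
  have hN : ∀ x y, B (N x) y = B (g₀ x) (g₀ y) - B x y := fun x y => by
    show B ((B.toDual hnd).symm _) y = _
    rw [LinearMap.BilinForm.apply_toDual_symm_apply]
    rfl
  have hε2 : (ε : K) * ε = 1 := by rcases hε with rfl | rfl <;> simp
  have hNsymm : ∀ x y, B x (N y) = B (N x) y := fun x y => by
    rw [hB (N y) x, hN, hN, hB x y, hB (g₀ x) (g₀ y)]
    linear_combination (B (g₀ x) (g₀ y) - B x y) * hε2
  have hNf : ∀ x, N x ∈ f m := fun x => by
    rw [hf.mem_iff_left hε hB (by omega)]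
    intro w hw
    rw [show 2 * m + 1 - m = m + 1 by omega] at hw
    rw [hN, hg₀B x w hw, sub_self]
  have hNf' : ∀ x, N x ∈ f (m + 1) := fun x => hf.monotone (Nat.le_succ m) (hNf x)
  have hNN : ∀ x y, B (N x) (N y) = 0 := fun x y =>
    (hf.mem_iff_left hε hB (show m ≤ 2 * m + 1 by omega) _).1 (hNf x) _
      (by rw [show 2 * m + 1 - m = m + 1 by omega]; exact hNf' y)
  have hN0 : ∀ x ∈ f (m + 1), N x = 0 := fun x hx => hnd.1 _ fun y => by
    rw [← hNsymm, hB (N y) x, hN, hg₀B y x hx, sub_self, mul_zero]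
  have hNF : ∀ p, ∀ x ∈ F p, N x ∈ F p := fun p x hx => by
    rw [hF.mem_iff_left hε hB]
    intro w hw
    rw [hN, (hF.mem_iff_left hε hB p x).1 hx w hw,
      (hF'.mem_iff_left hε hB p _).1 (hg₀F p x hx) _ (hg₀F _ w hw), sub_zero]
  -- As `N` squares to zero, `1 - N / 2` is the inverse square root of `1 + N`, which removes the
  -- error without disturbing `F` or the values on `f (m + 1)`.
  let g₁ : V →ₗ[K] V := g₀ ∘ₗ (LinearMap.id - (2⁻¹ : K) • N)
  have hg₁ : ∀ x, g₁ x = g₀ x - (2⁻¹ : K) • g₀ (N x) := fun x => by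
    simp [g₁]
  have hg₁B : ∀ x y, B (g₁ x) (g₁ y) = B x y := by
    intro x y
    have h1 : B (g₀ x) (g₀ (N y)) = B (N x) y := by rw [hg₀B x _ (hNf' y), hNsymm]
    have h2 : B (g₀ (N x)) (g₀ y) = B (N x) y := by
      rw [hB (g₀ y) (g₀ (N x)), hg₀B y _ (hNf' x), hB (N x) y, ← mul_assoc, hε2, one_mul]
    have h3 : B (g₀ (N x)) (g₀ (N y)) = 0 := by rw [hg₀B _ _ (hNf' y), hNN]
    have h4 := hN x y
    rw [hg₁, hg₁]
    simp only [map_sub, map_smul, LinearMap.sub_apply, LinearMap.smul_apply, smul_eq_mul, h1, h2,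
      h3]
    have h5 : (2 : K) * 2⁻¹ = 1 := mul_inv_cancel₀ two_ne_zero
    linear_combination -(B (N x) y) * h5 - h4
  have hinj : Function.Injective g₁ := by
    rw [injective_iff_map_eq_zero]
    intro x hx
    refine hnd.1 _ fun y => ?_
    rw [← hg₁B, hx, map_zero, LinearMap.zero_apply]
  let g : V ≃ₗ[K] V := LinearEquiv.ofInjectiveEndo g₁ hinj
  have hgB : ∀ v w, B (g v) (g w) = B v w := hg₁B
  have hgF : ∀ p, ∀ x ∈ F p, g x ∈ F' p := fun p x hx => by
    show g₁ x ∈ _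
    rw [hg₁]
    exact sub_mem (hg₀F p x hx) (Submodule.smul_mem _ _ (hg₀F p _ (hNF p x hx)))
  have hgf : ∀ x ∈ f (m + 1), g x = h x := fun x hx => by
    show g₁ x = _
    rw [hg₁, hN0 x hx, map_zero, smul_zero, sub_zero, hg₀ x hx]
  have hgflag : ∀ j : Fin (m + 1), ∀ x (hx : x ∈ f ((j : ℕ) + 1)),
      ∃ hx' : g x ∈ f' ((j : ℕ) + 1), toGr f' j ⟨g x, hx'⟩ = θ j (toGr f j ⟨x, hx⟩) := by
    intro j x hx
    obtain ⟨h1, h2⟩ := hh.flag j x hx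
    have h3 := hgf x (hf.monotone (by omega) hx)
    simp only [h3]
    exact ⟨h1, h2⟩
  have hlow : ∀ i, i ≤ m + 1 → (f i).map (g : V →ₗ[K] V) = f' i := by
    intro i hi
    refine le_antisymm ?_ fun y hy => ?_
    · rintro _ ⟨x, hx, rfl⟩
      cases i with
      | zero =>
        rw [SetLike.mem_coe, hf.eq_bot, Submodule.mem_bot] at hx
        rw [hx, map_zero]
        exact zero_mem _
      | succ j => exact (hgflag ⟨j, hi⟩ x hx).1
    · obtain ⟨x, hx, rfl⟩ := hh.surj hf' hf.monotone i hi y hy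
      exact ⟨x, hx, hgf x (hf.monotone hi hx)⟩
  refine ⟨g, hgB, fun p => ?_, fun i hi => ?_, ⟨hgF, hgflag⟩⟩
  · refine Submodule.eq_of_le_of_finrank_eq ?_ ?_
    · rintro _ ⟨x, hx, rfl⟩
      exact hgF p x hx
    · rw [LinearEquiv.finrank_map_eq, hdim]
  · rcases le_or_gt i (m + 1) with h1 | h1
    · exact hlow i h1
    -- Above the middle, the flag steps are orthogonals of lower ones, and `g` is an isometry.
    · ext y
      obtain ⟨x, rfl⟩ := g.surjective y
      rw [hf'.mem_iff hi, ← hlow (2 * m + 1 - i) (by omega)]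
      constructor
      · rintro ⟨x', hx', h2⟩ _ ⟨w, hw, rfl⟩
        rw [← h2]
        exact (hgB w x').trans ((hf.mem_iff hi x').1 hx' w hw)
      · intro h2
        refine ⟨x, (hf.mem_iff hi x).2 fun w hw => ?_, rfl⟩
        rw [← hgB]
        exact h2 _ ⟨w, hw, rfl⟩

end Lift

/-! ### Plücker vectors and their derivatives. -/

section Wedge

variable {K : Type*} [Field K] {V : Type*} [AddCommGroup V] [Module K V]
variable {W : Submodule K V} {k : ℕ}

theorem ιMulti_basis_ne_zero (w : Module.Basis (Fin k) K W) :
    exteriorPower.ιMulti K k (fun i => (w i : V)) ≠ 0 := by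
  have h1 : exteriorPower.ιMulti K k w ≠ 0 := by
    intro h
    have h2 := exteriorPower.alternatingMapLinearEquiv_apply_ιMulti w.det w
    rw [h, map_zero, w.det_self] at h2
    exact zero_ne_one h2
  have h3 := exteriorPower.map_injective_field (n := k) (f := W.subtype) W.subtype_injective
  have h4 := exteriorPower.map_apply_ιMulti W.subtype (w : Fin k → W)
  intro h
  refine h1 (h3 ?_)
  rw [h4, map_zero]
  exact h

theorem mem_range_map_iff (w : Module.Basis (Fin k) K W) (x : ⋀[K]^k V) :
    x ∈ LinearMap.range (exteriorPower.map k W.subtype) ↔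
      ∃ c : K, c • exteriorPower.ιMulti K k (fun i => (w i : V)) = x := by
  have h4 := exteriorPower.map_apply_ιMulti W.subtype (w : Fin k → W)
  constructor
  · rintro ⟨y, rfl⟩
    have : FiniteDimensional K W := Module.Finite.of_basis w
    have h1 : Module.finrank K (⋀[K]^k W) = 1 := by
      rw [exteriorPower.finrank_eq, Module.finrank_eq_card_basis w, Fintype.card_fin,
        Nat.choose_self]
    have h2 : exteriorPower.ιMulti K k w ≠ 0 := by
      intro h
      rw [h, map_zero] at h4
      exact ιMulti_basis_ne_zero w h4.symm
    obtain ⟨c, rfl⟩ := (finrank_eq_one_iff_of_nonzero' _ h2).1 h1 y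
    exact ⟨c, by rw [map_smul, h4]; rfl⟩
  · rintro ⟨c, rfl⟩
    exact ⟨c • exteriorPower.ιMulti K k w, by rw [map_smul, h4]; rfl⟩

/-- The derivative of the action of endomorphisms on a decomposable vector. -/
def wedgeDeriv (w : Fin k → V) : Module.End K V →ₗ[K] ⋀[K]^k V :=
  ∑ i, ((exteriorPower.ιMulti K k).toMultilinearMap.toLinearMap w i) ∘ₗ LinearMap.applyₗ (w i)

theorem wedgeDeriv_apply (w : Fin k → V) (Y : Module.End K V) :
    wedgeDeriv w Y = ∑ i, exteriorPower.ιMulti K k (Function.update w i (Y (w i))) := by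
  simp [wedgeDeriv, LinearMap.sum_apply]

theorem wedgeDeriv_mem (w : Module.Basis (Fin k) K W) {Y : Module.End K V}
    (hY : ∀ v ∈ W, Y v ∈ W) :
    wedgeDeriv (fun i => (w i : V)) Y ∈
      Submodule.span K {exteriorPower.ιMulti K k (fun i => (w i : V))} := by
  rw [wedgeDeriv_apply]
  refine sum_mem fun i _ => ?_
  rw [Submodule.mem_span_singleton, ← mem_range_map_iff]
  refine ⟨exteriorPower.ιMulti K k (Function.update w i ⟨Y (w i), hY _ (w i).2⟩), ?_⟩
  rw [exteriorPower.map_apply_ιMulti]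
  congr 1
  ext j
  rcases eq_or_ne j i with rfl | h
  · simp
  · simp [Function.update_of_ne h]

theorem det_update_self {M : Type*} [AddCommGroup M] [Module K M] (w : Module.Basis (Fin k) K M)
    (i : Fin k) (x : M) : w.det (Function.update w i x) = w.repr x i := by
  conv_lhs => rw [← w.sum_repr x]
  rw [← AlternatingMap.coe_multilinearMap, MultilinearMap.map_update_sum, Finset.sum_eq_single i]
  · rw [MultilinearMap.map_update_smul, Function.update_eq_self, AlternatingMap.coe_multilinearMap,
      w.det_self, smul_eq_mul, mul_one]
  · intro j _ hj
    rw [MultilinearMap.map_update_smul, AlternatingMap.coe_multilinearMap,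
      AlternatingMap.map_update_self _ _ hj.symm, smul_zero]
  · simp

/-- An endomorphism whose derived action preserves the Plücker line of `W` preserves `W`. -/
theorem apply_mem_of_wedgeDeriv_mem (w : Module.Basis (Fin k) K W) {Y : Module.End K V}
    (hY : wedgeDeriv (fun i => (w i : V)) Y ∈
      Submodule.span K {exteriorPower.ιMulti K k (fun i => (w i : V))}) {v : V} (hv : v ∈ W) :
    Y v ∈ W := by
  have hbasis : ∀ i, Y (w i) ∈ W := by
    intro i
    by_contra hi
    obtain ⟨l, hl, hlW⟩ := Submodule.exists_le_ker_of_notMem hi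
    obtain ⟨π, hπ⟩ := LinearMap.exists_leftInverse_of_injective W.subtype W.ker_subtype
    have hπ' : ∀ x : W, π x = x := fun x => LinearMap.congr_fun hπ x
    -- `ρ` replaces the `i`-th coordinate of the projection `π` by `l`, so it kills `w i` and fixes
    -- the other `w j`. The determinant composed with `ρ` vanishes on the Plücker line of `W` but
    -- takes the nonzero value `l (Y (w i))` on the derivative.
    let ρ : V →ₗ[K] W := π + LinearMap.toSpanSingleton K W (w i) ∘ₗ (l - w.coord i ∘ₗ π)
    have hρ : ∀ x, ρ x = π x + (l x - w.repr (π x) i) • w i := fun x => by simp [ρ]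
    have hρj : ∀ j, j ≠ i → ρ (w j) = w j := fun j hj => by
      rw [hρ, hπ', LinearMap.mem_ker.1 (hlW (w j).2), w.repr_self, Finsupp.single_eq_of_ne hj.symm]
      simp
    have hρi : ρ (w i) = 0 := by
      rw [hρ, hπ', LinearMap.mem_ker.1 (hlW (w i).2), w.repr_self]
      simp
    let Φ := exteriorPower.alternatingMapLinearEquiv (w.det.compLinearMap ρ)
    have hΦ : ∀ x : Fin k → V, Φ (exteriorPower.ιMulti K k x) = w.det (fun j => ρ (x j)) :=
      fun x => exteriorPower.alternatingMapLinearEquiv_apply_ιMulti _ _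
    obtain ⟨c, hc⟩ := Submodule.mem_span_singleton.1 hY
    have h1 : Φ (exteriorPower.ιMulti K k (fun i => (w i : V))) = 0 := by
      rw [hΦ]
      exact AlternatingMap.map_coord_zero _ i hρi
    have h2 : Φ (wedgeDeriv (fun i => (w i : V)) Y) = l (Y (w i)) := by
      rw [wedgeDeriv_apply, map_sum, Finset.sum_eq_single i]
      · rw [hΦ]
        have h3 : (fun j => ρ (Function.update (fun i => (w i : V)) i (Y (w i)) j)) =
            Function.update w i (ρ (Y (w i))) := by
          ext j
          rcases eq_or_ne j i with rfl | h
          · simp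
          · simp [Function.update_of_ne h, hρj j h]
        rw [h3, det_update_self, hρ]
        simp
      · intro j _ hj
        rw [hΦ]
        refine AlternatingMap.map_coord_zero _ i ?_
        rw [Function.update_of_ne hj.symm, hρi]
      · simp
    rw [← hc, map_smul, h1, smul_zero] at h2
    exact hl h2.symm
  have h1 := w.mem_span ⟨v, hv⟩
  have h2 : Submodule.span K (Set.range w) ≤ (W.comap Y).submoduleOf W := by
    rw [Submodule.span_le]
    rintro _ ⟨i, rfl⟩
    exact hbasis i
  exact h2 h1

end Wedge

/-! ### Rank estimates for differentials. -/

section Rank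

variable {K : Type*} [Field K] {E E' : Type*} [AddCommGroup E] [Module K E] [AddCommGroup E']
  [Module K E'] [FiniteDimensional K E]

theorem finrank_map_add_finrank_inf_ker (T : Submodule K E) (L : E →ₗ[K] E') :
    Module.finrank K (T.map L) + Module.finrank K (T ⊓ LinearMap.ker L : Submodule K E) =
      Module.finrank K T := by
  have h1 := LinearMap.finrank_range_add_finrank_ker (L.domRestrict T)
  rw [LinearMap.range_domRestrict] at h1
  rw [← h1]
  congr 1
  rw [← Submodule.finrank_map_subtype_eq T, LinearMap.ker_domRestrict, Submodule.map_comap_subtype]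

variable [FiniteDimensional K E']

theorem finrank_inf_comap_le (S : Submodule K E) (N : Submodule K E') (L : E →ₗ[K] E') :
    Module.finrank K (S ⊓ N.comap L : Submodule K E) ≤
      Module.finrank K N + Module.finrank K (S ⊓ LinearMap.ker L : Submodule K E) := by
  rw [← finrank_map_add_finrank_inf_ker _ L]
  refine add_le_add (Submodule.finrank_mono ?_) (Submodule.finrank_mono ?_)
  · exact (Submodule.map_mono inf_le_right).trans (Submodule.map_comap_le _ _)
  · exact inf_le_inf_right _ inf_le_left

/-- Modulo `Λ` the map `D` kills `N`, so it adds at most `dim T - dim N` to the dimension of `Λ`. -/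
theorem finrank_sup_map_add_le (Λ : Submodule K E') (T N : Submodule K E) (D : E →ₗ[K] E')
    (hN : N ≤ T) (hD : N.map D ≤ Λ) :
    Module.finrank K (Λ ⊔ T.map D : Submodule K E') + Module.finrank K N ≤
      Module.finrank K Λ + Module.finrank K T := by
  have h1 := finrank_map_add_finrank_inf_ker (Λ ⊔ T.map D) Λ.mkQ
  have h2 := finrank_map_add_finrank_inf_ker T (Λ.mkQ ∘ₗ D)
  have h3 : (Λ ⊔ T.map D).map Λ.mkQ = T.map (Λ.mkQ ∘ₗ D) := by
    rw [Submodule.map_sup, Submodule.mkQ_map_self, bot_sup_eq, Submodule.map_comp]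
  have h4 : Module.finrank K N ≤
      Module.finrank K (T ⊓ LinearMap.ker (Λ.mkQ ∘ₗ D) : Submodule K E) := by
    refine Submodule.finrank_mono (le_inf hN ?_)
    rw [LinearMap.ker_comp, Submodule.ker_mkQ, ← Submodule.map_le_iff_le_comap]
    exact hD
  have h5 : Module.finrank K ((Λ ⊔ T.map D) ⊓ LinearMap.ker Λ.mkQ : Submodule K E') ≤
      Module.finrank K Λ := by
    rw [Submodule.ker_mkQ]
    exact Submodule.finrank_mono inf_le_right
  rw [h3] at h1
  omega

theorem exists_vec_coe (S : Set E) {s : S} (δ : PointDerivation (coordRing K S) s) :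
    ∃ x' : E, δ.tangent.vec (fun x : S => (x : E)) x' := by
  let Λ : Module.Dual K (Module.Dual K E) :=
    { toFun := fun l => δ.toLin ⟨fun x : S => l (x : E), linear_mem_coordRing S l⟩
      map_add' := fun l l' => by
        rw [← map_add]
        rfl
      map_smul' := fun c l => by
        rw [RingHom.id_apply, ← map_smul]
        rfl }
  refine ⟨(Module.evalEquiv K E).symm Λ, fun l => ⟨linear_mem_coordRing S l, ?_⟩⟩
  rw [Module.apply_evalEquiv_symm_apply]
  rfl

/-- A dimension bound for the image of a polynomial map in terms of its derivatives. -/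
theorem zariskiDim_range_le_of_tangent [CharZero K] (S : Set E) (y : S → E') (r : ℕ)
    (H : ∀ s : S, ∃ T : Submodule K E', Module.finrank K T ≤ r ∧
      ∀ (δ : PointDerivation (coordRing K S) s) (x' : E),
        δ.tangent.vec (fun x : S => (x : E)) x' → ∃ y' ∈ T, δ.tangent.vec y y') :
    zariskiDim K (Set.range y) ≤ r := by
  refine zariskiDim_range_le S y (fun l => ?_) r fun s => ?_
  · rcases isEmpty_or_nonempty S with hS | ⟨⟨s⟩⟩
    · have : (fun x => l (y x)) = 0 := Subsingleton.elim _ _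
      rw [this]
      exact zero_mem _
    · obtain ⟨T, -, hT⟩ := H s
      -- The zero derivation serves only to extract regularity: having any derivative at all
      -- includes membership in the coordinate ring.
      let δ : PointDerivation (coordRing K S) s := ⟨0, fun f g => by simp⟩
      obtain ⟨y', -, hy⟩ := hT δ 0 fun l => ⟨linear_mem_coordRing S l, by simp [δ]⟩
      exact (hy l).1
  · obtain ⟨T, hr, hT⟩ := H s
    refine ⟨T, hr, fun δ y' hy => ?_⟩
    obtain ⟨x', hx⟩ := exists_vec_coe S δ
    obtain ⟨y'', hy1, hy2⟩ := hT δ x' hx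
    rwa [Tangent.vec_unique hy hy2]

end Rank

/-! ### The set of transporters and its tangent spaces. -/

section Transporter

variable {K : Type*} [Field K] {V : Type*} [AddCommGroup V] [Module K V]
variable {B : LinearMap.BilinForm K V} {ε : ℤ} {d m : ℕ} {F : ℤ → Submodule K V}
  {f : ℕ → Submodule K V} {φ : V ≃ₗ[K] V}

theorem IsSelfDualFiltration.map (hF : IsSelfDualFiltration B d F) {g : V ≃ₗ[K] V}
    (hg : g ∈ GAut B) : IsSelfDualFiltration B d (fun p => (F p).map (g : V →ₗ[K] V)) where
  antitone := fun p q h => Submodule.map_mono (hF.antitone h)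
  eq_top := fun p hp => by rw [hF.eq_top p hp, Submodule.map_top, LinearEquiv.range]
  eq_bot := fun p hp => by rw [hF.eq_bot p hp, Submodule.map_bot]
  self_dual := fun p => by
    obtain ⟨c, hc⟩ := hg
    have hg' : ∀ v w, B (g v) (g w) = 0 ↔ B v w = 0 := fun v w => by
      rw [hc, mul_eq_zero, or_iff_right c.ne_zero]
    ext x
    obtain ⟨x, rfl⟩ := g.surjective x
    rw [LinearMap.BilinForm.mem_orthogonal_iff]
    constructor
    · rintro ⟨x', hx', h⟩ _ ⟨w, hw, rfl⟩
      rw [← h]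
      rw [hF.self_dual] at hx'
      exact (hg' w x').2 (hx' w hw)
    · intro h
      refine ⟨x, ?_, rfl⟩
      rw [hF.self_dual]
      intro w hw
      exact (hg' w x).1 (h _ ⟨w, hw, rfl⟩)

/-- An isometry `g` such that the flag `g f` is `φ`-stable and `g` commutes with the action of `φ`
on the graded pieces up to the middle one. -/
structure IsTransporter (B : LinearMap.BilinForm K V) (φ : V ≃ₗ[K] V) (m : ℕ)
    (f : ℕ → Submodule K V) (g : V ≃ₗ[K] V) : Prop where
  isometry : ∀ v w, B (g v) (g w) = B v w
  stable : ∀ i, i ≤ 2 * m + 1 → ∀ v ∈ f i, ∃ v' ∈ f i, φ (g v) = g v'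
  comm : ∀ j, j ≤ m → ∀ v ∈ f (j + 1), ∀ w ∈ f (2 * m + 1 - j), B (φ (g v) - g (φ v)) (g w) = 0

/-- The operator `Y ↦ Y - φ⁻¹ Y φ`. -/
def adSub (φ : V ≃ₗ[K] V) : Module.End K V →ₗ[K] Module.End K V :=
  LinearMap.id - LinearMap.lcomp K V (φ : V →ₗ[K] V) ∘ₗ
    LinearMap.llcomp K V V V (φ.symm : V →ₗ[K] V)

theorem adSub_apply (Y : Module.End K V) (v : V) : adSub φ Y v = Y v - φ.symm (Y (φ v)) := rfl

theorem adSub_mem_skew (hφ : φ ∈ GAut B) {Y : Module.End K V} (hY : Y ∈ skew B) :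
    adSub φ Y ∈ skew B := by
  obtain ⟨c, hc⟩ := hφ
  intro v w
  have h1 : ∀ x y, (c : K) * B (φ.symm x) y = B x (φ y) := fun x y => by
    rw [← hc, LinearEquiv.apply_symm_apply]
  have h2 : ∀ x y, (c : K) * B x (φ.symm y) = B (φ x) y := fun x y => by
    rw [← hc, LinearEquiv.apply_symm_apply]
  have h3 := hY (φ v) (φ w)
  rw [← h1, ← h2] at h3
  have h4 : B (φ.symm (Y (φ v))) w + B v (φ.symm (Y (φ w))) = 0 := by
    rw [← mul_add] at h3
    exact (mul_eq_zero.1 h3).resolve_left c.ne_zero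
  have h5 := hY v w
  simp only [adSub_apply, map_sub, LinearMap.sub_apply]
  linear_combination h5 - h4

theorem mem_ker_adSub {Y : Module.End K V} :
    Y ∈ LinearMap.ker (adSub φ) ↔ Commute Y (φ : V →ₗ[K] V) := by
  rw [LinearMap.mem_ker]
  constructor
  · intro h
    ext v
    have h1 := LinearMap.congr_fun h v
    rw [adSub_apply, LinearMap.zero_apply, sub_eq_zero, LinearEquiv.eq_symm_apply] at h1
    exact h1.symm
  · intro h
    ext v
    rw [adSub_apply, LinearMap.zero_apply, sub_eq_zero, LinearEquiv.eq_symm_apply]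
    exact (LinearMap.congr_fun h v).symm

/-- The endomorphisms that commute with `s`, as a subspace. -/
def commutant (s : Module.End K V) : Submodule K (Module.End K V) :=
  Subalgebra.toSubmodule (Subalgebra.centralizer K {s})

theorem mem_commutant {s Y : Module.End K V} : Y ∈ commutant s ↔ Commute Y s := by
  simp [commutant, Subalgebra.mem_centralizer_iff, Commute, SemiconjBy, eq_comm]

/-- Whatever commutes with `φ` commutes with its semisimple part. -/
theorem IsSemisimplePart.commute [CharZero K] [FiniteDimensional K V] {φ s : Module.End K V}
    (h : IsSemisimplePart φ s) {Y : Module.End K V} (hY : Commute Y φ) : Commute Y s := by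
  -- The Jordan decomposition with `s₀` a polynomial in `φ`; uniqueness identifies `s₀` with `s`, so
  -- whatever commutes with `φ` commutes with `s`.
  obtain ⟨n₀, hn₀, s₀, hs₀, hn, hss, h₀⟩ := φ.exists_isNilpotent_isSemisimple
  have hcomm : ∀ a ∈ Algebra.adjoin K {φ}, ∀ X : Module.End K V, Commute X φ → Commute X a := by
    intro a ha X hX
    have h1 : Algebra.adjoin K {φ} ≤ Subalgebra.centralizer K {X} := by
      refine Algebra.adjoin_le ?_
      rintro _ rfl
      rw [SetLike.mem_coe, Subalgebra.mem_centralizer_iff]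
      rintro _ rfl
      exact hX
    exact (Subalgebra.mem_centralizer_iff K).1 (h1 ha) X rfl
  have h1 : Commute n₀ s₀ := hcomm s₀ hs₀ n₀ (hcomm n₀ hn₀ φ (Commute.refl φ)).symm
  have h2 := Module.End.isNilpotent_isSemisimple_unique hn hss h.2.2 h.1 h1
    (h.2.1.symm.sub_left (Commute.refl s)) (by rw [← h₀, sub_add_cancel])
  rw [← h2.2]
  exact hcomm s₀ hs₀ Y hY

variable {n : ℕ} {b : Module.Basis (Fin n) K V} {P : Fin n → ℤ} {J : Fin n → ℕ}

/-- The unipotent radical of the stabilizer of the flag `g f`, in an adapted basis. -/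
abbrev radical (B : LinearMap.BilinForm K V) (m : ℕ) (b : Module.Basis (Fin n) K V)
    (J : Fin n → ℕ) (g : V ≃ₗ[K] V) : Submodule K (Module.End K V) :=
  skewOn B (b.map g) (fun a a' => 2 * m < J a + J a')

/-- After applying `φ` to both arguments, hypothesis `h` says that `adSub φ Y` has zero entries at
`(a, a')` with `J a ≤ m` and `J a + J a' ≤ 2m`. If instead `J a > m`, then `J a' < m`, and skewness
exchanges the two indices. -/
theorem adSub_mem_radical (hε : ε = 1 ∨ ε = -1) (hB : ∀ v w, B w v = (ε : K) * B v w)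
    (hφ : φ ∈ GAut B) (hJ : IsAdapted b f (fun j a => J a < j)) {g : V ≃ₗ[K] V}
    (hg : ∀ i, i ≤ 2 * m + 1 → ∀ v ∈ f i, ∃ v' ∈ f i, φ (g v) = g v')
    {Y : Module.End K V} (hY : Y ∈ skew B)
    (h : ∀ j, j ≤ m → ∀ v ∈ f (j + 1), ∀ w ∈ f (2 * m + 1 - j),
      B (φ (Y (g v)) - Y (φ (g v))) (g w) = 0) : adSub φ Y ∈ radical B m b J g := by
  have hZ := adSub_mem_skew hφ hY
  obtain ⟨c, hc⟩ := hφ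
  have key : ∀ a a', J a ≤ m → J a + J a' ≤ 2 * m →
      B (adSub φ Y (g (b a))) (g (b a')) = 0 := by
    intro a a' ha haa
    obtain ⟨v', hv', h1⟩ := hg (2 * m + 1 - J a) (by omega) (b a')
      ((hJ.basis_mem_iff _ _).2 (by omega))
    have h2 := h (J a) ha (b a) ((hJ.basis_mem_iff _ _).2 (Nat.lt_succ_self _)) v' hv'
    have h3 : φ (Y (g (b a))) - Y (φ (g (b a))) = φ (adSub φ Y (g (b a))) := by
      rw [adSub_apply, map_sub, LinearEquiv.apply_symm_apply]
    rw [← h1, h3, hc] at h2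
    exact (mul_eq_zero.1 h2).resolve_left c.ne_zero
  refine ⟨hZ, fun a a' haa => ?_⟩
  rw [Module.Basis.map_apply, Module.Basis.map_apply]
  rcases le_or_gt (J a) m with ha | ha
  · exact key a a' ha (by omega)
  · rw [skew_apply_comm hε hB hZ, key a' a (by omega) (by omega), mul_zero]

/-- Since `φ` stabilizes the flag `g f`, conjugation by it preserves the nilradical. The tangent
space thus contains the nilradical, whose part preserving the filtration can be discounted from the
rank. -/
theorem radical_le (hφ : φ ∈ GAut B) (hJ : IsAdapted b f (fun j a => J a < j)) {g : V ≃ₗ[K] V}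
    (hg : ∀ i, i ≤ 2 * m + 1 → ∀ v ∈ f i, ∃ v' ∈ f i, φ (g v) = g v') :
    radical B m b J g ≤ skew B ⊓ (radical B m b J g).comap (adSub φ) := by
  intro Y hY
  have h1 : ∀ j, j ≤ 2 * m → ∀ v ∈ f (j + 1), ∀ w ∈ f (2 * m + 1 - j), B (Y (g v)) (g w) = 0 := by
    intro j hj v hv w hw
    rw [hJ] at hv hw
    refine bilin_eq_zero_of_span (B.compl₁₂ (Y ∘ₗ (g : V →ₗ[K] V)) (g : V →ₗ[K] V)) ?_ hv hw
    rintro _ ⟨a, ha, rfl⟩ _ ⟨a', ha', rfl⟩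
    have := hY.2 a a' (by
      simp only [Set.mem_ofPred_eq] at ha ha'
      omega)
    rw [Module.Basis.map_apply, Module.Basis.map_apply] at this
    exact this
  refine ⟨hY.1, adSub_mem_skew hφ hY.1, fun a a' haa => ?_⟩
  rw [Module.Basis.map_apply, Module.Basis.map_apply]
  have ha : b a ∈ f (J a + 1) := (hJ.basis_mem_iff _ _).2 (Nat.lt_succ_self _)
  have ha' : b a' ∈ f (2 * m + 1 - J a) := (hJ.basis_mem_iff _ _).2 (by omega)
  obtain ⟨v', hv', h2⟩ := hg (J a + 1) (by omega) _ ha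
  obtain ⟨w', hw', h3⟩ := hg (2 * m + 1 - J a) (by omega) _ ha'
  obtain ⟨c, hc⟩ := hφ
  rw [adSub_apply, map_sub, LinearMap.sub_apply, h1 (J a) (by omega) _ ha _ ha', zero_sub,
    neg_eq_zero]
  have h4 := hc (φ.symm (Y (φ (g (b a))))) (g (b a'))
  rw [LinearEquiv.apply_symm_apply, h2, h3, h1 (J a) (by omega) _ hv' _ hw'] at h4
  rw [h2]
  exact (mul_eq_zero.1 h4.symm).resolve_left c.ne_zero

/-- The tangent space of the set of transporters, in terms of skew endomorphisms. -/
theorem finrank_tangent_le [CharZero K] [FiniteDimensional K V]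
    {s : Module.End K V} (hs : IsSemisimplePart (φ : V →ₗ[K] V) s)
    (U : Submodule K (Module.End K V)) :
    Module.finrank K (skew B ⊓ U.comap (adSub φ) : Submodule K (Module.End K V)) ≤
      Module.finrank K U +
        Module.finrank K (skew B ⊓ commutant s : Submodule K (Module.End K V)) := by
  refine (finrank_inf_comap_le _ _ _).trans (add_le_add_right (Submodule.finrank_mono ?_) _)
  exact inf_le_inf_left _ fun Y hY => mem_commutant.2 (hs.commute (mem_ker_adSub.1 hY))

/-- The orbit map from transporters and scalars to tuples of Plücker vectors. -/
def orbitMap {k : ℤ → ℕ} (w : ∀ p : Fin (d + 2), Module.Basis (Fin (k (p : ℕ))) K (F (p : ℕ)))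
    (x : Module.End K V × (Fin (d + 2) → K)) : (p : Fin (d + 2)) → ⋀[K]^(k (p : ℕ)) V :=
  fun p => x.2 p • exteriorPower.ιMulti K _ (fun i => x.1 (w p i))

/-- The tuples of scalar multiples of given vectors. -/
def scaleMap {κ : Type*} {W : κ → Type*} [∀ p, AddCommGroup (W p)] [∀ p, Module K (W p)]
    (ω : ∀ p, W p) : (κ → K) →ₗ[K] ∀ p, W p :=
  LinearMap.pi fun p => LinearMap.toSpanSingleton K (W p) (ω p) ∘ₗ LinearMap.proj p

/-- With `U` the nilradical of `g f`, the tangent vectors form a space `T` with `dim T ≤ dim U + dim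
(skew B ⊓ commutant s)`. The part `N` of `U` that preserves `g F` only rescales Plücker vectors, so
the rank is at most `(d + 2) + dim T - dim N`; `dim U - dim N` counts the pairs of `U` with `P a + P
a' > d`, which have negative Hodge degree. -/
theorem zariskiDim_orbit_le [CharZero K] [FiniteDimensional K V] (hnd : B.Nondegenerate)
    (hε : ε = 1 ∨ ε = -1) (hB : ∀ v w, B w v = (ε : K) * B v w)
    (hφ : φ ∈ GAut B) {s : Module.End K V} (hs : IsSemisimplePart (φ : V →ₗ[K] V) s)
    (hF : IsSelfDualFiltration B d F)
    (hP : IsAdapted b F (fun p a => p ≤ P a)) (hJ : IsAdapted b f (fun j a => J a < j))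
    {k : ℤ → ℕ} (w : ∀ p : Fin (d + 2), Module.Basis (Fin (k (p : ℕ))) K (F (p : ℕ))) (r : ℕ)
    (hr : 2 * ((d : ℤ) + 2) +
      2 * Module.finrank K (skew B ⊓ commutant s : Submodule K (Module.End K V)) +
      pairSum ε (fun a a' => if 2 * m < J a + J a' ∧ d < P a + P a' then 1 else 0) ≤ 2 * r) :
    zariskiDim K (Set.range fun x : {x : Module.End K V × (Fin (d + 2) → K) |
      ∃ g, IsTransporter B φ m f g ∧ (g : V →ₗ[K] V) = x.1} => orbitMap w x.1) ≤ r := by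
  refine zariskiDim_range_le_of_tangent _ _ r ?_
  rintro ⟨⟨g', c⟩, g, hg, rfl : (g : V →ₗ[K] V) = g'⟩
  let ω : (p : Fin (d + 2)) → ⋀[K]^(k (p : ℕ)) V := fun p =>
    exteriorPower.ιMulti K _ (fun i => g (w p i))
  let Λ := LinearMap.range (scaleMap (K := K) ω)
  let D : Module.End K V →ₗ[K] ((p : Fin (d + 2)) → ⋀[K]^(k (p : ℕ)) V) :=
    LinearMap.pi fun p => c p • wedgeDeriv (fun i => g (w p i))
  let T := skew B ⊓ (radical B m b J g).comap (adSub φ)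
  refine ⟨Λ ⊔ T.map D, ?_, ?_⟩
  · let N := skewOn B (b.map g) (fun a a' => 2 * m < J a + J a' ∧ P a + P a' ≤ d)
    have hNU : N ≤ radical B m b J g := fun Y hY => ⟨hY.1, fun a a' h => hY.2 a a' fun h' => h h'.1⟩
    have hND : N.map D ≤ Λ := by
      rintro _ ⟨Y, hY, rfl⟩
      have h1 : Y ∈ skew B ⊓ adjFil B (fun p => (F p).map (g : V →ₗ[K] V)) 0 := by
        have hgB : g ∈ GAut B := ⟨1, fun v w => by rw [hg.isometry, Units.val_one, one_mul]⟩
        rw [skew_inf_adjFil_eq_skewOn hε hB (hF.map hgB) (hP.map g)]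
        exact ⟨hY.1, fun a a' h => hY.2 a a' fun h' => h (by have := h'.2; omega)⟩
      have h2 : ∀ p : Fin (d + 2), ∃ t : K, t • ω p = wedgeDeriv (fun i => g (w p i)) Y := by
        intro p
        rw [← Submodule.mem_span_singleton]
        refine wedgeDeriv_mem ((w p).map (g.submoduleMap _)) fun v hv => ?_
        have := h1.2.2 _ v hv
        rwa [add_zero] at this
      choose t ht using h2
      refine ⟨fun p => c p * t p, funext fun p => ?_⟩
      show (c p * t p) • ω p = c p • wedgeDeriv (fun i => g (w p i)) Y
      rw [mul_smul, ht]
    have h1 := finrank_sup_map_add_le Λ T N D (hNU.trans (radical_le hφ hJ hg.stable)) hND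
    have h2 : Module.finrank K Λ ≤ d + 2 := by
      have := LinearMap.finrank_range_le (scaleMap (K := K) ω)
      simpa using this
    have h3 := finrank_tangent_le (B := B) hs (radical B m b J g)
    have h4 := two_mul_finrank_skewOn_eq_pairSum hnd hε hB (b.map g)
      (fun a a' => 2 * m < J a + J a') (fun a a' h => by omega)
    have h5 := two_mul_finrank_skewOn_eq_pairSum hnd hε hB (b.map g)
      (fun a a' => 2 * m < J a + J a' ∧ P a + P a' ≤ d) (fun a a' h => by omega)
    have h6 := pairSum_add (ε := ε)
      (fun a a' => if 2 * m < J a + J a' ∧ P a + P a' ≤ d then 1 else 0)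
      (fun a a' => if 2 * m < J a + J a' ∧ d < P a + P a' then 1 else 0)
    have h7 : (fun a a' => (if 2 * m < J a + J a' ∧ P a + P a' ≤ d then (1 : ℤ) else 0) +
        (if 2 * m < J a + J a' ∧ d < P a + P a' then 1 else 0)) =
        fun a a' => if 2 * m < J a + J a' then 1 else 0 := by
      funext a a'
      split_ifs <;> omega
    rw [h7] at h6
    change Module.finrank K T ≤
      Module.finrank K (skewOn B (b.map g) fun a a' => 2 * m < J a + J a') + _ at h3
    simp only [N] at h1
    omega
  · rintro δ ⟨X, c'⟩ hδ
    have hX : δ.tangent.vec (fun x => x.1.1) X :=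
      Tangent.vec_linear (LinearMap.fst K (Module.End K V) (Fin (d + 2) → K)) hδ
    have hc : ∀ p, δ.tangent.rel (fun x => x.1.2 p) (c' p) := fun p =>
      hδ (LinearMap.proj p ∘ₗ LinearMap.snd K (Module.End K V) (Fin (d + 2) → K))
    have hXv : ∀ v : V, δ.tangent.vec (fun x => x.1.1 v) (X v) := fun v =>
      Tangent.vec_linear (LinearMap.applyₗ v) hX
    -- Right translation moves the velocity at `g` to the identity, where the isometry equations
    -- become skewness.
    let Y : Module.End K V := X ∘ₗ (g.symm : V →ₗ[K] V)
    have hYX : ∀ v, Y (g v) = X v := fun v => by simp [Y]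
    have hY : Y ∈ skew B := by
      intro v w
      obtain ⟨v, rfl⟩ := g.surjective v
      obtain ⟨w, rfl⟩ := g.surjective w
      have h1 := Tangent.vec_bilinear B (hXv v) (hXv w)
      have h2 : (fun x : {x : Module.End K V × (Fin (d + 2) → K) |
          ∃ g, IsTransporter B φ m f g ∧ (g : V →ₗ[K] V) = x.1} => B (x.1.1 v) (x.1.1 w)) =
          fun _ => B v w := by
        funext ⟨x, g₁, hg₁, hx⟩
        simp only [← hx]
        exact hg₁.isometry v w
      rw [h2] at h1
      have h3 := Tangent.vec_unique h1 (Tangent.vec_const _)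
      rw [hYX, hYX, add_comm]
      exact h3
    have hYφ : ∀ j, j ≤ m → ∀ v ∈ f (j + 1), ∀ w ∈ f (2 * m + 1 - j),
        B (φ (Y (g v)) - Y (φ (g v))) (g w) = 0 := by
      intro j hj v hv w hw
      have h1 := Tangent.vec_bilinear B
        (Tangent.vec_sub (Tangent.vec_linear (φ : V →ₗ[K] V) (hXv v)) (hXv (φ v))) (hXv w)
      have h2 : (fun x : {x : Module.End K V × (Fin (d + 2) → K) |
          ∃ g, IsTransporter B φ m f g ∧ (g : V →ₗ[K] V) = x.1} =>
            B ((φ : V →ₗ[K] V) (x.1.1 v) - x.1.1 (φ v)) (x.1.1 w)) = fun _ => 0 := by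
        funext ⟨x, g₁, hg₁, hx⟩
        simp only [← hx]
        exact hg₁.comm j hj v hv w hw
      rw [h2] at h1
      have h3 : B (φ (g v) - g (φ v)) (X w) + B (φ (X v) - X (φ v)) (g w) = 0 :=
        Tangent.vec_unique h1 (Tangent.vec_const _)
      -- Differentiating `comm` also yields a term in which `g w` moves; skewness of `Y` cancels it
      -- and turns `X (φ v)` into `Y (φ (g v))`.
      have h4 := hY (φ (g v) - g (φ v)) (g w)
      rw [hYX] at h4
      rw [map_sub Y, hYX] at h4
      rw [hYX]
      simp only [map_sub, LinearMap.sub_apply] at h3 h4 ⊢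
      linear_combination h3 - h4
    have hYT : Y ∈ T := ⟨hY, adSub_mem_radical hε hB hφ hJ hg.stable hY hYφ⟩
    refine ⟨scaleMap ω c' + D Y, Submodule.add_mem_sup ⟨c', rfl⟩ ⟨Y, hYT, rfl⟩, ?_⟩
    refine Tangent.vec_pi fun p => ?_
    have h1 := Tangent.vec_smul (hc p) (Tangent.vec_multilinear
      (exteriorPower.ιMulti K (k (p : ℕ))).toMultilinearMap fun i => hXv (w p i : V))
    convert h1 using 1
    · rfl
    · show c' p • ω p + c p • wedgeDeriv (fun i => g (w p i)) Y = _
      refine (add_comm _ _).trans ?_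
      rw [wedgeDeriv_apply]
      simp only [hYX]
      rfl

end Transporter

/-! ### Bad filtrations as translates by transporters. -/

section Bad

variable {K : Type*} [Field K] {V : Type*} [AddCommGroup V] [Module K V]
variable {B : LinearMap.BilinForm K V} {ε : ℤ} {d m : ℕ} {F F' : ℤ → Submodule K V}
  {φ : V ≃ₗ[K] V}

/-- Two bad filtrations of the same type differ by a transporter. -/
theorem exists_isTransporter [CharZero K] [FiniteDimensional K V] (hnd : B.Nondegenerate)
    (hε : ε = 1 ∨ ε = -1) (hB : ∀ v w, B w v = (ε : K) * B v w)
    {A : Fin (m + 1) → Type*} [∀ j, AddCommGroup (A j)] [∀ j, Module K (A j)]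
    {FA : ∀ j, ℤ → Submodule K (A j)} {φA : ∀ j, A j ≃ₗ[K] A j}
    {BA : LinearMap.BilinForm K (A (Fin.last m))}
    (hF : IsSelfDualFiltration B d F) (hbad : IsBad B φ d m A FA φA BA F) :
    ∃ f, IsSelfDualFlag B m f ∧
      (∀ k, k ≤ 2 * m → Nontrivial (Gr f k) → weight d (inducedFil F f k) = (d : ℚ) / 2) ∧
      ∀ F', IsSelfDualFiltration B d F' → IsBad B φ d m A FA φA BA F' →
        (∀ p, Module.finrank K (F p) = Module.finrank K (F' p)) →
        ∃ g, IsTransporter B φ m f g ∧ ∀ p, (F p).map (g : V →ₗ[K] V) = F' p := by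
  obtain ⟨f, hf, hfφ, hw, e, heF, heφ, heB⟩ := hbad
  refine ⟨f, hf, hw, fun F' hF' hbad' hdim => ?_⟩
  obtain ⟨f', hf', hfφ', -, e', heF', heφ', heB'⟩ := hbad'
  let θ : ∀ j : Fin (m + 1), Gr f (j : ℕ) ≃ₗ[K] Gr f' (j : ℕ) := fun j => (e j).trans (e' j).symm
  have hθe : ∀ j x, e' j (θ j x) = e j x := fun j x => (e' j).apply_symm_apply _
  have hθ : ∀ (j : Fin (m + 1)) p,
      (inducedFil F f (j : ℕ) p).map (θ j : Gr f (j : ℕ) →ₗ[K] Gr f' (j : ℕ)) =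
        inducedFil F' f' (j : ℕ) p := by
    intro j p
    refine Submodule.map_injective_of_injective (f := (e' j : Gr f' (j : ℕ) →ₗ[K] A j))
      (e' j).injective ?_
    rw [heF', ← heF, ← Submodule.map_comp]
    congr 1
    exact LinearMap.ext fun x => hθe j x
  have hθB : ∀ (x y : f (m + 1)) (x' y' : f' (m + 1)),
      θ (Fin.last m) (toGr f m x) = toGr f' m x' → θ (Fin.last m) (toGr f m y) = toGr f' m y' →
        B (x' : V) (y' : V) = B (x : V) (y : V) := by
    intro x y x' y' hx hy
    have h1 := heB x y
    have h2 := heB' x' y'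
    have h3 := hθe (Fin.last m) (toGr f m x)
    have h4 := hθe (Fin.last m) (toGr f m y)
    rw [hx] at h3
    rw [hy] at h4
    rw [← h1, ← h2]
    exact congrArg₂ (fun a b => BA a b) h3 h4
  obtain ⟨g, hgB, hgF, hgf, hlift⟩ := exists_isometry_lift hnd hε hB hF hF' hdim hf hf' θ hθ hθB
  refine ⟨g, ⟨hgB, fun i hi v hv => ?_, fun j hj v hv w hw => ?_⟩, hgF⟩
  · have h1 : g v ∈ f' i := by
      rw [← hgf i hi]
      exact ⟨v, hv, rfl⟩
    have h2 := hfφ' i hi _ h1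
    rw [← hgf i hi] at h2
    obtain ⟨v', hv', h3⟩ := h2
    exact ⟨v', hv', h3.symm⟩
  · have hj' : j < m + 1 := by omega
    have hφv := hfφ (j + 1) (by omega) v hv
    obtain ⟨h1, h2⟩ := hlift.flag ⟨j, hj'⟩ v hv
    obtain ⟨h3, h4⟩ := hlift.flag ⟨j, hj'⟩ (φ v) hφv
    have h5 : φ (g v) ∈ f' (j + 1) := hfφ' (j + 1) (by omega) _ h1
    have h6 := heφ ⟨j, hj'⟩ ⟨v, hv⟩ ⟨φ v, hφv⟩ rfl
    have h7 := heφ' ⟨j, hj'⟩ ⟨g v, h1⟩ ⟨φ (g v), h5⟩ rfl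
    have h8 : toGr f' j ⟨φ (g v), h5⟩ = toGr f' j ⟨g (φ v), h3⟩ := by
      refine (e' ⟨j, hj'⟩).injective ?_
      refine h7.trans ?_
      have h9 := congrArg (e' ⟨j, hj'⟩) h2
      have h10 := congrArg (e' ⟨j, hj'⟩) h4
      rw [hθe] at h9 h10
      exact (congrArg _ h9).trans (h6.symm.trans h10.symm)
    -- Through `e` and `e'`, `φ` induces the same `φA j` on both graded pieces, so `φ g` and `g φ`
    -- agree there. Pairing against `g (f (2 * m + 1 - j))` expresses this membership by bilinear
    -- equations in `g`.
    have h9 : φ (g v) - g (φ v) ∈ f' j := by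
      refine (toGr_eq_zero (sub_mem h5 h3)).1 ?_
      rw [← sub_eq_zero.2 h8, ← map_sub]
      rfl
    refine (hf'.mem_iff_left hε hB (by omega) _).1 h9 _ ?_
    rw [← hgf _ (by omega)]
    exact ⟨w, hw, rfl⟩

/-- The cone over a set of translates of `F` lies in the image of the orbit map. -/
theorem pluckerCone_subset_range {k : ℤ → ℕ}
    (w : ∀ p : Fin (d + 2), Module.Basis (Fin (k (p : ℕ))) K (F (p : ℕ)))
    {S : Set (ℤ → Submodule K V)} {f : ℕ → Submodule K V}
    (hS : ∀ F' ∈ S, ∃ g, IsTransporter B φ m f g ∧ ∀ p, (F p).map (g : V →ₗ[K] V) = F' p) :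
    pluckerCone d k S ⊆ Set.range fun x : {x : Module.End K V × (Fin (d + 2) → K) |
      ∃ g, IsTransporter B φ m f g ∧ (g : V →ₗ[K] V) = x.1} => orbitMap w x.1 := by
  rintro x ⟨F', hF', hx⟩
  obtain ⟨g, hg, hgF⟩ := hS F' hF'
  have h1 : ∀ p : Fin (d + 2), ∃ c : K,
      c • exteriorPower.ιMulti K (k (p : ℕ)) (fun i => g (w p i)) = x p := by
    intro p
    have h2 := (hx p).2
    rw [← hgF] at h2
    exact (mem_range_map_iff ((w p).map (g.submoduleMap _)) _).1 h2
  choose c hc using h1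
  exact ⟨⟨((g : V →ₗ[K] V), c), g, hg, rfl⟩, funext hc⟩

end Bad

open MvPolynomial

/-! ### The Cayley transform. -/

section Cayley

variable {K : Type*} [Field K] {V : Type*} [AddCommGroup V] [Module K V]
variable {B : LinearMap.BilinForm K V}

/-- If `w (1 - Y) = c (1 + Y)` with `Y` skew, then `w` is a similitude, and it commutes with
everything that commutes with `Y`. -/
theorem mem_GAut_of_cayley [FiniteDimensional K V] {Y w : Module.End K V} (hY : Y ∈ skew B) {c : K}
    (hc : c ≠ 0) (h1 : IsUnit (1 - Y)) (h2 : IsUnit (1 + Y)) (hw : w * (1 - Y) = c • (1 + Y)) :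
    (∃ g ∈ GAut B, (g : V →ₗ[K] V) = w) ∧ ∀ s, Commute Y s → Commute w s := by
  have hu : IsUnit w := by
    have h3 : IsUnit (w * (1 - Y)) := by
      rw [hw]
      exact h2.smul (Units.mk0 c hc)
    exact isUnit_of_mul_isUnit_left h3
  have hsurj : Function.Surjective (1 - Y : Module.End K V) := ((Module.End.isUnit_iff _).1 h1).2
  constructor
  · refine ⟨LinearEquiv.ofBijective w ((Module.End.isUnit_iff _).1 hu),
      ⟨Units.mk0 (c ^ 2) (pow_ne_zero 2 hc), fun v v' => ?_⟩, rfl⟩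
    obtain ⟨x, rfl⟩ := hsurj v
    obtain ⟨x', rfl⟩ := hsurj v'
    have h3 : ∀ x, w ((1 - Y) x) = c • (1 + Y) x := fun x => LinearMap.congr_fun hw x
    have h4 := hY x x'
    simp only [LinearEquiv.ofBijective_apply, h3, Units.val_mk0]
    simp only [LinearMap.sub_apply, LinearMap.add_apply, Module.End.one_apply, map_add, map_sub,
      map_smul, LinearMap.smul_apply, smul_eq_mul]
    linear_combination 2 * c ^ 2 * h4
  · intro s hs
    have h3 : (1 - Y) * s = s * (1 - Y) := ((Commute.one_left s).sub_left hs)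
    have h4 : (1 + Y) * s = s * (1 + Y) := ((Commute.one_left s).add_left hs)
    refine h1.mul_right_cancel ?_
    rw [mul_assoc, ← h3, ← mul_assoc, hw, smul_mul_assoc, h4, mul_assoc, hw, mul_smul_comm]

theorem exists_vec_of_polynomial [Infinite K] {W : Type*} [AddCommGroup W] [Module K W]
    [FiniteDimensional K W] {N : ℕ} (y : (Fin N → K) → W)
    (h : ∀ l : Module.Dual K W, ∃ p : MvPolynomial (Fin N) K, ∀ u, eval u p = l (y u))
    (j : Fin N) : ∃ y', (polyTangent K j).vec y y' := by
  let e := Module.finBasis K W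
  choose p hp using fun i => h (e.coord i)
  have h1 : ∀ i, (polyTangent K j).vec (fun u => e.coord i (y u) • e i)
      (e.coord i (y 0) • 0 + eval 0 (pderiv j (p i)) • e i) := fun i =>
    Tangent.vec_smul (D := polyTangent K j) ⟨p i, hp i, rfl⟩ (Tangent.vec_const _)
  have h2 := Tangent.vec_sum Finset.univ fun i _ => h1 i
  have h3 : (fun u => ∑ i, e.coord i (y u) • e i) = y := funext fun u => e.sum_repr (y u)
  rw [h3] at h2
  exact ⟨_, h2⟩

variable {N : ℕ}

/-- The determinant does not involve a variable that is absent from all entries. This makes the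
scalar `t` of `exists_cayley` vanish in directions with `Y j = 0`. -/
theorem pderiv_det_eq_zero {n : ℕ} (M : Matrix (Fin n) (Fin n) (MvPolynomial (Fin N) K)) (j : Fin N)
    (h : ∀ a a', M a a' ∈ supported K {i | i ≠ j}) : pderiv j M.det = 0 := by
  have h1 : M.det ∈ supported K {i | i ≠ j} := by
    rw [Matrix.det_apply']
    exact sum_mem fun σ _ => mul_mem (intCast_mem _ _) (prod_mem fun i _ => h _ _)
  refine pderiv_eq_zero_of_notMem_vars fun hj => ?_
  exact (mem_supported.1 h1) hj rfl

/-- A polynomial family of similitudes, with prescribed derivatives up to scalars, obtained from the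
Cayley transform. -/
theorem exists_cayley [CharZero K] [FiniteDimensional K V] (Y : Fin N → Module.End K V)
    (hY : ∀ i, Y i ∈ skew B) :
    ∃ (w : (Fin N → K) → Module.End K V) (h : MvPolynomial (Fin N) K), h ≠ 0 ∧ w 0 = 1 ∧
      (∀ l : Module.Dual K (Module.End K V), ∃ p : MvPolynomial (Fin N) K, ∀ u,
        eval u p = l (w u)) ∧
      (∀ j, ∃ t : K, (Y j = 0 → t = 0) ∧
        (polyTangent K j).vec w ((2 : K) • Y j + t • (1 : Module.End K V))) ∧
      (∀ u, eval u h ≠ 0 → (∃ g ∈ GAut B, (g : V →ₗ[K] V) = w u) ∧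
        ∀ s, (∀ i, Commute (Y i) s) → Commute (w u) s) := by
  let b := Module.finBasis K V
  let n := Module.finrank K V
  let M : Fin N → Matrix (Fin n) (Fin n) K := fun i => (Matrix.toLinAlgEquiv b).symm (Y i)
  let 𝓨 : Matrix (Fin n) (Fin n) (MvPolynomial (Fin N) K) :=
    ∑ i, (X i : MvPolynomial (Fin N) K) • (M i).map C
  -- The Cayley transform `(1 + 𝓨) (1 - 𝓨)⁻¹` multiplied by `det (1 - 𝓨)`: polynomial in the
  -- parameters, but a similitude instead of an isometry.
  let Q := (1 + 𝓨) * (1 - 𝓨).adjugate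
  let ev : (Fin N → K) → (Matrix (Fin n) (Fin n) (MvPolynomial (Fin N) K) →+* Module.End K V) :=
    fun u => (Matrix.toLinAlgEquiv b).toAlgHom.toRingHom.comp (eval u).mapMatrix
  have hev_apply : ∀ u A, ev u A = Matrix.toLinAlgEquiv b (A.map (eval u)) := fun _ _ => rfl
  let Z : (Fin N → K) → Module.End K V := fun u => ∑ i, u i • Y i
  have hevs : ∀ u (p : MvPolynomial (Fin N) K) A, ev u (p • A) = eval u p • ev u A := by
    intro u p A
    rw [hev_apply, hev_apply, ← map_smul]
    congr 1
    ext a a'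
    simp
  have hev : ∀ u, ev u 𝓨 = Z u := by
    intro u
    rw [map_sum]
    refine Finset.sum_congr rfl fun i _ => ?_
    rw [hevs, eval_X, hev_apply]
    congr 1
    have : ((M i).map C).map (eval u) = M i := by
      ext a a'
      simp
    rw [this]
    exact (Matrix.toLinAlgEquiv b).apply_symm_apply (Y i)
  have hQ : Q * (1 - 𝓨) = (1 - 𝓨).det • (1 + 𝓨) := by
    rw [mul_assoc, Matrix.adjugate_mul, mul_smul_comm, mul_one]
  have hw : ∀ u, ev u Q * (1 - Z u) = eval u (1 - 𝓨).det • (1 + Z u) := by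
    intro u
    have := congrArg (ev u) hQ
    rwa [map_mul, hevs, map_sub, map_add, map_one, hev] at this
  have hunit : ∀ u A, eval u A.det ≠ 0 → IsUnit (ev u A) := by
    intro u A hA
    have h1 : IsUnit ((eval u).mapMatrix A) := by
      rw [Matrix.isUnit_iff_isUnit_det, ← RingHom.map_det]
      exact hA.isUnit
    exact h1.map (Matrix.toLinAlgEquiv b).toAlgHom.toRingHom
  have hZ0 : Z 0 = 0 := by simp [Z]
  have h𝓨0 : (eval 0).mapMatrix 𝓨 = 0 :=
    (Matrix.toLinAlgEquiv b).injective (by rw [map_zero, ← hZ0, ← hev]; rfl)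
  have hd0 : eval 0 (1 - 𝓨).det = 1 := by
    rw [RingHom.map_det, map_sub, map_one, h𝓨0, sub_zero, Matrix.det_one]
  have hd0' : eval 0 (1 + 𝓨).det = 1 := by
    rw [RingHom.map_det, map_add, map_one, h𝓨0, add_zero, Matrix.det_one]
  have hw0 : ev 0 Q = 1 := by
    have := hw 0
    rwa [hZ0, sub_zero, mul_one, add_zero, hd0, one_smul] at this
  have hpoly : ∀ l : Module.Dual K (Module.End K V), ∃ p : MvPolynomial (Fin N) K, ∀ u,
      eval u p = l (ev u Q) := by
    intro l
    refine ⟨∑ a, ∑ a', Q a a' * C (l (Matrix.toLinAlgEquiv b (Matrix.single a a' 1))), fun u => ?_⟩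
    rw [hev_apply, Matrix.matrix_eq_sum_single (Q.map (eval u))]
    simp only [map_sum, map_mul, eval_C]
    refine Finset.sum_congr rfl fun a _ => Finset.sum_congr rfl fun a' _ => ?_
    have : Matrix.single a a' (Q.map (eval u) a a') =
        (eval u (Q a a')) • Matrix.single a a' (1 : K) := by
      rw [Matrix.smul_single, smul_eq_mul, mul_one, Matrix.map_apply]
    rw [this, map_smul, map_smul, smul_eq_mul]
  refine ⟨fun u => ev u Q, (1 - 𝓨).det * (1 + 𝓨).det, ?_, hw0, hpoly, fun j => ?_, fun u hu => ?_⟩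
  · intro h
    have h1 := congrArg (eval 0) h
    rw [map_mul, hd0, hd0', map_zero, mul_one] at h1
    exact one_ne_zero h1
  · obtain ⟨w', hw'⟩ := exists_vec_of_polynomial _ hpoly j
    refine ⟨eval 0 (pderiv j (1 - 𝓨).det), fun hj => ?_, ?_⟩
    · rw [pderiv_det_eq_zero _ j, map_zero]
      intro a a'
      have h𝓨 : 𝓨 a a' = ∑ i, X i * C (M i a a') := by simp [𝓨, Matrix.sum_apply]
      rw [Matrix.sub_apply, h𝓨]
      refine sub_mem ?_ (sum_mem fun i _ => ?_)
      · rw [Matrix.one_apply]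
        split_ifs
        · exact one_mem _
        · exact zero_mem _
      · rcases eq_or_ne i j with rfl | hij
        · have : M i = 0 := by simp only [M, hj, map_zero]
          rw [this, Matrix.zero_apply, map_zero, mul_zero]
          exact zero_mem _
        · exact mul_mem (X_mem_supported.2 hij) (Subalgebra.algebraMap_mem _ (M i a a'))
    · have hrel : (polyTangent K j).rel (fun u => eval u (1 - 𝓨).det)
          (eval 0 (pderiv j (1 - 𝓨).det)) := ⟨_, fun _ => rfl, rfl⟩
      have hZ : (polyTangent K j).vec Z (Y j) := by
        have h1 : ∀ i ∈ Finset.univ, (polyTangent K j).vec (fun u => u i • Y i)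
            ((0 : Fin N → K) i • (0 : Module.End K V) + (if i = j then (1 : K) else 0) • Y i) :=
          fun i _ => Tangent.vec_smul (D := polyTangent K j)
            ⟨X i, fun u => eval_X _, by
              rw [pderiv_X, Pi.single_apply]
              split_ifs <;> simp⟩ (Tangent.vec_const _)
        have h2 := Tangent.vec_sum Finset.univ h1
        simpa using h2
      -- Differentiate `w (1 - Z) = det (1 - 𝓨) • (1 + Z)` at the origin: `w' - Y j = Y j + t`, with
      -- `t` the derivative of the determinant.
      have h1 := Tangent.vec_bilinear (LinearMap.mul K (Module.End K V)) hw'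
        (Tangent.vec_sub (Tangent.vec_const 1) hZ)
      have h2 := Tangent.vec_smul hrel (Tangent.vec_add (Tangent.vec_const (1 : Module.End K V)) hZ)
      simp only [LinearMap.mul_apply', hw] at h1
      have h3 := Tangent.vec_unique h1 h2
      rw [hw0, hZ0, hd0] at h3
      have h4 : (2 : K) • Y j + (eval 0 (pderiv j (1 - 𝓨).det)) • (1 : Module.End K V) = w' := by
        simp only [zero_sub, sub_zero, one_mul, mul_one, zero_add, add_zero, one_smul] at h3
        rw [two_smul, add_assoc, ← h3]
        abel
      rw [h4]
      exact hw'
  · rw [map_mul] at hu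
    have hu1 := left_ne_zero_of_mul hu
    have hu2 := right_ne_zero_of_mul hu
    have h1 := hunit u _ hu1
    have h2 := hunit u _ hu2
    rw [map_sub, map_one, hev] at h1
    rw [map_add, map_one, hev] at h2
    have hZ : Z u ∈ skew B := sum_mem fun i _ => Submodule.smul_mem _ _ (hY i)
    have h3 := mem_GAut_of_cayley hZ hu1 h1 h2 (hw u)
    refine ⟨h3.1, fun s hs => h3.2 s ?_⟩
    exact Commute.sum_left _ _ _ fun i _ => (hs i).smul_left _

end Cayley

open MvPolynomial

/-! ### Lower bounds for the centralizer and the flag variety. -/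

section LowerBound

variable {K : Type*} [Field K] {V : Type*} [AddCommGroup V] [Module K V]
variable {B : LinearMap.BilinForm K V} {ε : ℤ} {d : ℕ} {F F₀ : ℤ → Submodule K V}

/-- The Cayley family of a basis of `skew B ⊓ commutant s` consists of elements of the centralizer
wherever `h ≠ 0`. Its velocities `2 Y i + t i` are independent because no nonzero scalar is skew. -/
theorem finrank_le_zariskiDim_centralizer [CharZero K] [FiniteDimensional K V] [Nontrivial V]
    (hnd : B.Nondegenerate) (s : Module.End K V) :
    (Module.finrank K (skew B ⊓ commutant s : Submodule K (Module.End K V)) : WithBot ℕ∞) ≤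
      zariskiDim K (centralizerGAut B s) := by
  let C := skew B ⊓ commutant s
  let Y := Module.finBasis K C
  have hY : ∀ i, (Y i : Module.End K V) ∈ skew B := fun i => (Y i).2.1
  obtain ⟨w, h, h0, -, hpoly, hd, hw⟩ := exists_cayley (fun i => (Y i : Module.End K V)) hY
  choose t ht0 ht using hd
  refine le_zariskiDim _ w h h0 (fun u hu => ?_) _ ?_ ht hpoly
  · obtain ⟨h1, h2⟩ := hw u hu
    exact ⟨h1, h2 s fun i => mem_commutant.1 (Y i).2.2⟩
  · rw [Fintype.linearIndependent_iff]
    intro a ha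
    let Z : C := ∑ i, a i • Y i
    have h1 : (2 : K) • (Z : Module.End K V) + (∑ i, a i * t i) • (1 : Module.End K V) = 0 := by
      rw [← ha]
      simp only [Z, Submodule.coe_sum, Submodule.coe_smul, Finset.smul_sum, smul_add,
        Finset.sum_add_distrib, Finset.sum_smul, mul_smul]
      congr 1
      exact Finset.sum_congr rfl fun i _ => smul_comm _ _ _
    have h2 : ∑ i, a i * t i = 0 := by
      by_contra hne
      refine one_notMem_skew (V := V) hnd ?_
      have h3 : (∑ i, a i * t i) • (1 : Module.End K V) ∈ skew B := by
        rw [eq_neg_of_add_eq_zero_right h1]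
        exact neg_mem (Submodule.smul_mem _ _ Z.2.1)
      exact (Submodule.smul_mem_iff _ hne).1 h3
    rw [h2, zero_smul, add_zero, smul_eq_zero, or_iff_right two_ne_zero] at h1
    have h3 : ∑ i, a i • Y i = 0 := Subtype.ext h1
    exact Fintype.linearIndependent_iff.1 Y.linearIndependent a h3

theorem exists_family_mod {E : Type*} [AddCommGroup E] [Module K E] [FiniteDimensional K E]
    {N S : Submodule K E} (h : N ≤ S) :
    ∃ (r : ℕ) (Y : Fin r → E), r + Module.finrank K N = Module.finrank K S ∧ (∀ i, Y i ∈ S) ∧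
      ∀ a : Fin r → K, ∑ i, a i • Y i ∈ N → a = 0 := by
  let e := Module.finBasis K (SubQuot S N)
  choose y hy using fun i => Submodule.mkQ_surjective _ (e i)
  refine ⟨_, fun i => (y i : E), finrank_subQuot h, fun i => (y i).2, fun a ha => ?_⟩
  have h1 : ∑ i, a i • e i = 0 := by
    simp only [← hy, ← map_smul, ← map_sum]
    rw [Submodule.mkQ_apply, Submodule.Quotient.mk_eq_zero]
    show ((∑ i, a i • y i : S) : E) ∈ N
    simpa using ha
  exact funext (Fintype.linearIndependent_iff.1 e.linearIndependent a h1)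

/-- Acting on `F` by the Cayley family of a complement of `F⁰` in `skew B`, and rescaling the `d +
2` Plücker vectors, gives an immersion at the origin into the cone. -/
theorem le_zariskiDim_pluckerCone [CharZero K] [FiniteDimensional K V]
    (hF : F ∈ flagVariety B d F₀) {k : ℤ → ℕ}
    (ω : ∀ p : Fin (d + 2), Module.Basis (Fin (k (p : ℕ))) K (F (p : ℕ))) {r : ℕ}
    (hr : r + Module.finrank K (skew B ⊓ adjFil B F 0 : Submodule K (Module.End K V)) =
      Module.finrank K (skew B)) :
    ((r + (d + 2) : ℕ) : WithBot ℕ∞) ≤ zariskiDim K (pluckerCone d k (flagVariety B d F₀)) := by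
  obtain ⟨r', Y, hr', hYs, hY⟩ := exists_family_mod (K := K)
    (inf_le_left : skew B ⊓ adjFil B F 0 ≤ skew B)
  obtain rfl : r' = r := by omega
  -- The last `d + 2` parameters leave `w` unchanged and only enter the scales `1 + u`, which equal
  -- `1` at the origin.
  let Y' : Fin (r' + (d + 2)) → Module.End K V := Fin.append Y (fun _ => 0)
  have hY' : ∀ i, Y' i ∈ skew B := by
    refine Fin.addCases (fun i => ?_) fun i => ?_
    · simpa [Y'] using hYs i
    · simp [Y']
  obtain ⟨w, h, h0, hw0, hpoly, hd, hw⟩ := exists_cayley Y' hY'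
  choose t ht0 ht using hd
  let x : (p : Fin (d + 2)) → ⋀[K]^(k (p : ℕ)) V := fun p =>
    exteriorPower.ιMulti K _ (fun i => (ω p i : V))
  let ψ : (Fin (r' + (d + 2)) → K) → ((p : Fin (d + 2)) → ⋀[K]^(k (p : ℕ)) V) := fun u =>
    orbitMap ω (w u, fun p => 1 + u (Fin.natAdd r' p))
  let D : Module.End K V →ₗ[K] ((p : Fin (d + 2)) → ⋀[K]^(k (p : ℕ)) V) :=
    LinearMap.pi fun p => wedgeDeriv (fun i => (ω p i : V))
  let c' : Fin (r' + (d + 2)) → Fin (d + 2) → K := fun j q => if Fin.natAdd r' q = j then 1 else 0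
  have hvec : ∀ j, (polyTangent K j).vec ψ (D ((2 : K) • Y' j + t j • 1) + scaleMap x (c' j)) := by
    intro j
    refine Tangent.vec_pi fun p => ?_
    have hrel : (polyTangent K j).rel (fun u => 1 + u (Fin.natAdd r' p)) (c' j p) := by
      refine ⟨1 + X (Fin.natAdd r' p), fun u => by simp, ?_⟩
      rw [map_add, Derivation.map_one_eq_zero, zero_add, pderiv_X, Pi.single_apply]
      simp only [c']
      split_ifs <;> simp
    have h1 := Tangent.vec_smul hrel (Tangent.vec_multilinear
      (exteriorPower.ιMulti K (k (p : ℕ))).toMultilinearMap fun i =>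
        Tangent.vec_linear (LinearMap.applyₗ (ω p i : V)) (ht j))
    convert h1 using 1
    · rfl
    · show wedgeDeriv _ _ + c' j p • x p = _
      rw [wedgeDeriv_apply]
      simp only [Pi.zero_apply, add_zero, one_smul, LinearMap.applyₗ_apply_apply, hw0,
        Module.End.one_apply]
      rfl
  have hψ : LinearIndependent K fun j => D ((2 : K) • Y' j + t j • 1) + scaleMap x (c' j) := by
    rw [Fintype.linearIndependent_iff]
    intro a ha
    let a₁ : Fin r' → K := fun i => a (Fin.castAdd (d + 2) i)
    let Z : Module.End K V := ∑ i, a₁ i • Y i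
    have hZ : ∑ j, a j • Y' j = Z := by
      rw [Fin.sum_univ_add]
      simp [Y', Z, a₁]
    have hsum : D ((2 : K) • Z + (∑ j, a j * t j) • 1) + scaleMap x (∑ j, a j • c' j) = 0 := by
      rw [← ha, ← hZ]
      simp only [map_add, map_sum, map_smul, smul_add, Finset.sum_add_distrib, Finset.smul_sum,
        Finset.sum_smul, mul_smul]
      congr 2
      exact Finset.sum_congr rfl fun j _ => smul_comm _ _ _
    have hcoord : ∀ p : Fin (d + 2), (2 : K) • wedgeDeriv (fun i => (ω p i : V)) Z +
        (∑ j, a j * t j) • wedgeDeriv (fun i => (ω p i : V)) 1 +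
        (∑ j, a j • c' j) p • x p = 0 := by
      intro p
      have h1 := congrFun hsum p
      rw [map_add, map_smul, map_smul] at h1
      exact h1
    -- A linear relation among the velocities says that `Z` moves each Plücker vector within its own
    -- line, hence preserves every step of `F`. By the choice of `Y` modulo `F⁰`, the coefficients
    -- of `Z` vanish, and only the scaling directions remain.
    have hfil : ∀ p : Fin (d + 2), ∀ v ∈ F (p : ℕ), Z v ∈ F (p : ℕ) := by
      intro p v hv
      refine apply_mem_of_wedgeDeriv_mem (ω p) ?_ hv
      rw [← Submodule.smul_mem_iff _ (two_ne_zero : (2 : K) ≠ 0)]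
      rw [eq_neg_of_add_eq_zero_left ((add_assoc _ _ _).symm.trans (hcoord p))]
      refine neg_mem (add_mem (Submodule.smul_mem _ _ ?_) (Submodule.smul_mem _ _ ?_))
      · exact wedgeDeriv_mem (ω p) fun v hv => hv
      · exact Submodule.mem_span_singleton_self _
    have hZs : Z ∈ skew B := sum_mem fun i _ => Submodule.smul_mem _ _ (hYs i)
    have hZF : Z ∈ skew B ⊓ adjFil B F 0 := by
      refine ⟨hZs, mem_lieGAut_of_mem_skew hZs, fun i v hv => ?_⟩
      rw [add_zero]
      rcases lt_or_ge i 0 with hi | hi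
      · rw [hF.1.eq_top i hi.le]
        trivial
      · rcases lt_or_ge (d : ℤ) i with hi' | hi'
        · rw [hF.1.eq_bot i hi', Submodule.mem_bot] at hv
          rw [hv, map_zero]
          exact zero_mem _
        · obtain ⟨q, rfl⟩ := Int.eq_ofNat_of_zero_le hi
          exact hfil ⟨q, by omega⟩ v hv
    have ha₁ : a₁ = 0 := hY a₁ hZF
    have hZ0 : Z = 0 := by simp [Z, ha₁]
    have hat : ∑ j, a j * t j = 0 := by
      rw [Fin.sum_univ_add]
      have h1 : ∀ i, a (Fin.castAdd (d + 2) i) = 0 := fun i => congrFun ha₁ i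
      have h2 : ∀ p, t (Fin.natAdd r' p) = 0 := fun p => ht0 _ (by simp [Y'])
      simp [h1, h2]
    refine Fin.addCases (fun i => congrFun ha₁ i) fun p => ?_
    have h1 := hcoord p
    rw [hZ0, hat, map_zero, smul_zero, zero_smul, zero_add, zero_add, smul_eq_zero,
      or_iff_left (ιMulti_basis_ne_zero (ω p)), Finset.sum_apply] at h1
    simpa [c'] using h1
  refine le_zariskiDim _ ψ (h * ∏ p : Fin (d + 2), (1 + X (Fin.natAdd r' p))) ?_ ?_ _ hψ hvec ?_
  · refine mul_ne_zero h0 (Finset.prod_ne_zero_iff.2 fun p _ hp => ?_)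
    have h1 := congrArg (eval 0) hp
    simp at h1
  · intro u hu
    rw [map_mul, map_prod] at hu
    obtain ⟨⟨g, hg, hgw⟩, -⟩ := hw u (left_ne_zero_of_mul hu)
    have hu2 : ∀ p : Fin (d + 2), 1 + u (Fin.natAdd r' p) ≠ 0 := fun p => by
      have := Finset.prod_ne_zero_iff.1 (right_ne_zero_of_mul hu) p (Finset.mem_univ p)
      simpa using this
    refine ⟨fun p => (F p).map (g : V →ₗ[K] V), ⟨hF.1.map hg, fun p => ?_⟩, fun p => ?_⟩
    · rw [LinearEquiv.finrank_map_eq, hF.2]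
    · let ωg := (ω p).map (g.submoduleMap (F (p : ℕ)))
      have h1 : ψ u p = (1 + u (Fin.natAdd r' p)) •
          exteriorPower.ιMulti K _ (fun i => (ωg i : V)) := by
        simp only [ψ, orbitMap, ← hgw]
        rfl
      rw [h1]
      exact ⟨smul_ne_zero (hu2 p) (ιMulti_basis_ne_zero ωg), (mem_range_map_iff ωg _).2 ⟨_, rfl⟩⟩
  · intro l
    -- Polynomiality of `l ∘ ψ` is part of having a derivative for `polyTangent`; any direction will
    -- do.
    obtain ⟨p, hp, -⟩ := hvec (Fin.natAdd r' 0) l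
    exact ⟨p, hp⟩

end LowerBound

/-! ### The codimension estimate. -/

section Main

variable {K : Type*} [Field K] {V : Type*} [AddCommGroup V] [Module K V]
variable {B : LinearMap.BilinForm K V} {ε : ℤ} {d m : ℕ} {F F₀ : ℤ → Submodule K V}

theorem zariskiDim_empty {E : Type*} [AddCommGroup E] [Module K E] :
    zariskiDim K (∅ : Set E) = ⊥ := by
  have : Subsingleton (coordRing K (∅ : Set E)) :=
    ⟨fun f g => Subtype.ext (funext fun x => x.2.elim)⟩
  exact ringKrullDim_eq_bot_of_subsingleton

/-- Compare the unrestricted support with the support `P a + P a' ≤ d` of `F⁰`: the pairs with `P a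
+ P a' > d` count the quotient, the tangent space of the flag variety at `F`. -/
theorem finrank_skew_eq [CharZero K] [FiniteDimensional K V] (hnd : B.Nondegenerate)
    (hε : ε = 1 ∨ ε = -1) (hB : ∀ v w, B w v = (ε : K) * B v w)
    (hF : IsSelfDualFiltration B d F) {n : ℕ} {b : Module.Basis (Fin n) K V} {P : Fin n → ℤ}
    (hP : IsAdapted b F (fun p a => p ≤ P a)) :
    2 * (Module.finrank K (skew B) : ℤ) =
      2 * Module.finrank K (skew B ⊓ adjFil B F 0 : Submodule K (Module.End K V)) +
        pairSum ε (fun a a' => if d < P a + P a' then 1 else 0) := by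
  have h1 := two_mul_finrank_skewOn_eq_pairSum hnd hε hB b (fun _ _ => True) (fun _ _ h => h)
  have h2 := two_mul_finrank_skewOn_eq_pairSum hnd hε hB b (fun a a' => P a + P a' ≤ (d : ℤ) - 0)
    (fun a a' h => by omega)
  have h3 : skewOn B b (fun _ _ => True) = skew B :=
    le_antisymm (fun X hX => hX.1) fun X hX => ⟨hX, fun a a' h => absurd trivial h⟩
  rw [h3] at h1
  rw [← skew_inf_adjFil_eq_skewOn hε hB hF hP] at h2
  rw [h1, h2, ← pairSum_add]
  congr 1
  funext a a'
  split_ifs <;> omega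

theorem codimAtLeast_bad [CharZero K] [FiniteDimensional K V] (hnd : B.Nondegenerate)
    (hε : ε = 1 ∨ ε = -1) (hB : ∀ v w, B w v = (ε : K) * B v w)
    {φ : V ≃ₗ[K] V} (hφ : φ ∈ GAut B)
    {A : Fin (m + 1) → Type*} [∀ j, AddCommGroup (A j)] [∀ j, Module K (A j)]
    {FA : ∀ j, ℤ → Submodule K (A j)} {φA : ∀ j, A j ≃ₗ[K] A j}
    {BA : LinearMap.BilinForm K (A (Fin.last m))} (hF₀ : IsSelfDualFiltration B d F₀)
    {s : Module.End K V} (hs : IsSemisimplePart (φ : V →ₗ[K] V) s)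
    {z : ℕ} (hz : zariskiDim K (centralizerGAut B s) = (z : WithBot ℕ∞))
    {e : ℕ} (he : 0 < e)
    (hnum : z + e ≤ ∑ p ∈ Finset.Icc (1 : ℤ) d, hodge B F₀ p)
    (hsum : topSum d (hodge B F₀) ((z : ℝ) + e) +
        topSum d (hodge B F₀) ((hodge B F₀ 0 : ℝ) / 2 + z + e) <
      ∑ p ∈ Finset.Icc (1 : ℤ) d, (p : ℝ) * (hodge B F₀ p : ℝ)) :
    CodimAtLeast B d F₀ {F | F ∈ flagVariety B d F₀ ∧ IsBad B φ d m A FA φA BA F} e := by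
  rw [CodimAtLeast]
  by_cases hne : ∃ F, F ∈ flagVariety B d F₀ ∧ IsBad B φ d m A FA φA BA F
  swap
  · have hempty : pluckerCone d (fun p => Module.finrank K (F₀ p))
        {F | F ∈ flagVariety B d F₀ ∧ IsBad B φ d m A FA φA BA F} = ∅ := by
      refine Set.eq_empty_of_forall_notMem ?_
      rintro x ⟨F, hF, -⟩
      exact hne ⟨F, hF⟩
    rw [hempty, zariskiDim_empty, WithBot.bot_add]
    exact bot_le
  -- For `V = 0` all Hodge numbers vanish, which contradicts `hnum` as `e > 0`.
  have hnt : Nontrivial V := by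
    by_contra hV
    rw [not_nontrivial_iff_subsingleton] at hV
    have h1 : ∀ p, hodge B F₀ p = 0 := fun p => Module.finrank_zero_of_subsingleton
    simp only [h1, Finset.sum_const_zero] at hnum
    omega
  obtain ⟨F, hF, hbad⟩ := hne
  obtain ⟨f, hf, hw, htrans⟩ := exists_isTransporter hnd hε hB hF.1 hbad
  obtain ⟨b, P, J, hP, hJ⟩ := exists_adapted_basis d (2 * m + 1) F hF.1.antitone
    (hF.1.eq_top 0 le_rfl) hF.1.eq_bot f hf.monotone hf.eq_bot hf.eq_top
  rw [← hodge_congr hnd hε hB hF.1 hF₀ hF.2] at hnum hsum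
  have key := pairSum_neg_add_le hnd hε hB hF.1 hf hP hJ hw z e hnum hsum
  have hζ : Module.finrank K (skew B ⊓ commutant s : Submodule K (Module.End K V)) ≤ z := by
    have h1 := finrank_le_zariskiDim_centralizer hnd s
    rw [hz] at h1
    exact_mod_cast h1
  -- Together with `key` this gives `e ≤ r`, so the natural subtraction `r + (d + 2) - e` below is
  -- not truncated.
  have hN : 0 ≤ pairSum ε (fun a a' => if 2 * m < J a + J a' ∧ d < P a + P a' then 1 else 0) :=
    pairSum_nonneg hε _ fun a a' => by split_ifs <;> simp
  have hskew := finrank_skew_eq hnd hε hB hF.1 hP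
  let w : ∀ p : Fin (d + 2), Module.Basis (Fin (Module.finrank K (F₀ (p : ℕ)))) K (F (p : ℕ)) :=
    fun p => Module.finBasisOfFinrankEq K _ (hF.2 _)
  obtain ⟨r, hr⟩ : ∃ r, r + Module.finrank K
      (skew B ⊓ adjFil B F 0 : Submodule K (Module.End K V)) = Module.finrank K (skew B) :=
    ⟨_, Nat.sub_add_cancel (Submodule.finrank_mono inf_le_left)⟩
  have hlower := le_zariskiDim_pluckerCone (k := fun p => Module.finrank K (F₀ p)) hF w hr
  have hupper := zariskiDim_orbit_le (m := m) (k := fun p => Module.finrank K (F₀ p)) hnd hε hB hφ hs hF.1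
    hP hJ w (r + (d + 2) - e) (by omega)
  have hsub := zariskiDim_mono (K := K)
    (pluckerCone_subset_range (k := fun p => Module.finrank K (F₀ p)) w
      (S := {F | F ∈ flagVariety B d F₀ ∧ IsBad B φ d m A FA φA BA F}) fun F' hF' =>
        htrans F' hF'.1.1 hF'.2 fun p => (hF.2 p).trans (hF'.1.2 p).symm)
  refine (add_le_add_left (hsub.trans hupper) _).trans (le_trans ?_ hlower)
  rw [← Nat.cast_add, Nat.sub_add_cancel (by omega)]

end Main

end BadFil

end

theorem mainTheorem7 {K : Type*} [Field K] [CharZero K]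
    {V : Type*} [AddCommGroup V] [Module K V] [FiniteDimensional K V]
    (B : LinearMap.BilinForm K V) (hB : B.Nondegenerate) (hB' : B.IsSymm ∨ B.IsAlt)
    (φ : V ≃ₗ[K] V) (hφ : φ ∈ BadFil.GAut B)
    -- the fixed filtered modules with automorphism, and the form on the last one
    (m : ℕ) (A : Fin (m + 1) → Type*) [∀ j, AddCommGroup (A j)] [∀ j, Module K (A j)]
    (FA : ∀ j, ℤ → Submodule K (A j)) (hFA : ∀ j, Antitone (FA j))
    (φA : ∀ j, A j ≃ₗ[K] A j) (BA : LinearMap.BilinForm K (A (Fin.last m)))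
    -- a self-dual filtration, which fixes the dimension data
    (d : ℕ) (F₀ : ℤ → Submodule K V) (hF₀ : BadFil.IsSelfDualFiltration B d F₀)
    -- the dimension of the centralizer of the semisimple part of `φ`
    (s : Module.End K V) (hs : BadFil.IsSemisimplePart (φ : V →ₗ[K] V) s)
    (z : ℕ) (hz : BadFil.zariskiDim K (BadFil.centralizerGAut B s) = (z : WithBot ℕ∞))
    (e : ℕ) (he : 0 < e)
    (hnum : z + e ≤ ∑ p ∈ Finset.Icc (1 : ℤ) d, BadFil.hodge B F₀ p)
    (hsum : BadFil.topSum d (BadFil.hodge B F₀) ((z : ℝ) + e) +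
        BadFil.topSum d (BadFil.hodge B F₀) ((BadFil.hodge B F₀ 0 : ℝ) / 2 + z + e) <
      ∑ p ∈ Finset.Icc (1 : ℤ) d, (p : ℝ) * (BadFil.hodge B F₀ p : ℝ)) :
    BadFil.CodimAtLeast B d F₀
      {F | F ∈ BadFil.flagVariety B d F₀ ∧ BadFil.IsBad B φ d m A FA φA BA F} e := by
  rcases hB' with h | h
  · exact BadFil.codimAtLeast_bad (ε := 1) hB (Or.inl rfl) (fun v w => by
      rw [Int.cast_one, one_mul]
      exact h.eq w v) hφ hF₀ hs hz he hnum hsum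
  · exact BadFil.codimAtLeast_bad (ε := -1) hB (Or.inr rfl) (fun v w => by
      rw [Int.cast_neg, Int.cast_one, neg_one_mul]
      exact (h.neg_eq v w).symm) hφ hF₀ hs hz he hnum hsum
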